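/- Let $K/k$ be an extension of fields of characteristic $0$ and write $\Omega^1_K=\Omega^1_{K/k}$. Let $a_1,\dots,a_N\in K$ be distinct points of $\mathbb P^1_K\setminus\{\infty\}$, $D=\{a_1,\dots,a_N\}$, with multiplicities $m_i\ge 1$ and $m_N\ge 2$. Let $\Omega^1$ be the absolute differentials of $\mathbb P^1_K$ (over $k$) and $\omega$ the relative ones (over $K$). Let $\nabla=d+A$ be a connection on the trivial bundle $E=V\otimes\mathcal O$, $V=K^r$ with basis $(e_\mu)$, where $A$ is an $r\times r$ matrix of sections of $\Omega^1(*D)$ on $\mathbb P^1_K$. Assume that * $\nabla$ is vertical: $\nabla^2$ takes values in $E(*D)\otimes\Omega^2_K$; * $\nabla$ is pseudo-admissible: at each $a_i$, with $z=t-a_i$, one has $A=G\,\frac{dz}{z^{m_i}}+\frac{B}{z^{M_i}}$ with $G\in GL_r(\mathcal O_{a_i})$ and $B$ a matrix over $\mathcal O_{a_i}\otimes\Omega^1_K$, where $M_i=m_i-1$ if $m_i\ge 2$ and $M_i=1$ if $m_i=1$. Then there are matrices $g^{(i)}_s$ over $K$ and $\eta^{(i)}_s,\eta_0$ over $\Omega^1_K$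 with $$A=\sum_{i=1}^N\sum_{s=1}^{m_i}\frac{g^{(i)}_s\,d(t-a_i)}{(t-a_i)^s}+\eta,\qquad \eta=\sum_{i=1}^N\sum_{s=1}^{M_i}\frac{\eta^{(i)}_s}{(t-a_i)^s}+\eta_0 .$$ For any such matrices the following holds. Let $\gamma_K=\sum_{i,s}g^{(i)}_s\frac{dt}{(t-a_i)^s}$ and $\nabla_{/K}=d+\gamma_K$, both regarded as $K$-linear maps $\Gamma(E(*D))\to\Gamma(E\otimes\omega(*D))$. Let $H\subset\Gamma(E\otimes\omega(*D))$ be the $K$-span of the forms $\frac{e_\mu\,dt}{(t-a_i)^s}$ with $2\le s\le m_i$ for $i<N$ and $2\le s\le m_N-1$ for $i=N$, and of the forms $e_\mu\,dt\big(\frac1{t-a_i}-\frac1{t-a_N}\big)$ with $i<N$. 1. $H$ is a complement of $\operatorname{im}\gamma_K$ in $\Gamma(E\otimes\omega(*D))$; and $H$ is a complement of $\operatorname{im}\nabla_{/K}$ provided that, for each $i$ with $m_i=1$, no eigenvalue of $g_1^{(i)}$ lies in $\{0,1,2,\dots\}$. 2. Whenever $H$ is a complement of both images, let $\pi_\gamma,\pi_\nabla:\Gamma(E\otimes\omega(*D))\to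 H$ be the projections along $\operatorname{im}\gamma_K$ and $\operatorname{im}\nabla_{/K}$. Multiplication by $\eta$ followed by $\pi_\gamma\otimes 1$, resp. $\pi_\nabla\otimes 1$, and restricted to $H$, defines the Higgs operator $\eta_\gamma$, resp. the de Rham operator $\eta_\nabla$, both maps $H\to H\otimes_K\Omega^1_K$. Their traces, which are elements of $\Omega^1_K$, satisfy $$\operatorname{Tr}(\eta_\gamma-\eta_\nabla)\equiv\frac12\sum_{m_i\ge2}m_i\,d\log\det\big(g^{(i)}_{m_i}\big)\mod d\log K^\times .$$ -/

import Mathlib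

open scoped TensorProduct

noncomputable section

namespace HiggsDeRham

/-! ### The exterior derivative on algebraic differential forms -/

section ExteriorDerivative

variable (k : Type*) (F : Type*) [CommRing k] [CommRing F] [Algebra k F]

/-- The wedge product of two Kähler one-forms, with values in `⋀² Ω`. -/
def wedge (x y : Ω[F⁄k]) : ⋀[F]^2 Ω[F⁄k] := exteriorPower.ιMulti F 2 ![x, y]

theorem update_pair_zero (x y z : Ω[F⁄k]) : Function.update ![x, y] 0 z = ![z, y] := by
  funext i; fin_cases i <;> rfl

theorem update_pair_one (x y z : Ω[F⁄k]) : Function.update ![x, y] 1 z = ![x, z] := by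
  funext i; fin_cases i <;> rfl

theorem wedge_add_left (x x' y : Ω[F⁄k]) :
    wedge k F (x + x') y = wedge k F x y + wedge k F x' y := by
  have h := (exteriorPower.ιMulti F 2 (M := Ω[F⁄k])).map_update_add ![x, y] 0 x x'
  rwa [update_pair_zero, update_pair_zero, update_pair_zero] at h

theorem wedge_add_right (x y y' : Ω[F⁄k]) :
    wedge k F x (y + y') = wedge k F x y + wedge k F x y' := by
  have h := (exteriorPower.ιMulti F 2 (M := Ω[F⁄k])).map_update_add ![x, y] 1 y y'
  rwa [update_pair_one, update_pair_one, update_pair_one] at h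

theorem wedge_smul_left (c : F) (x y : Ω[F⁄k]) :
    wedge k F (c • x) y = c • wedge k F x y := by
  have h := (exteriorPower.ιMulti F 2 (M := Ω[F⁄k])).map_update_smul ![x, y] 0 c x
  rwa [update_pair_zero, update_pair_zero] at h

theorem wedge_smul_right (c : F) (x y : Ω[F⁄k]) :
    wedge k F x (c • y) = c • wedge k F x y := by
  have h := (exteriorPower.ιMulti F 2 (M := Ω[F⁄k])).map_update_smul ![x, y] 1 c y
  rwa [update_pair_one, update_pair_one] at h

theorem wedge_self (x : Ω[F⁄k]) : wedge k F x x = 0 :=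
  (exteriorPower.ιMulti F 2 (M := Ω[F⁄k])).map_eq_zero_of_eq ![x, x]
    (i := 0) (j := 1) (by simp) (by decide)

theorem wedge_swap (x y : Ω[F⁄k]) : wedge k F x y + wedge k F y x = 0 := by
  have h := wedge_self k F (x + y)
  rw [wedge_add_left, wedge_add_right, wedge_add_right, wedge_self, wedge_self] at h
  simpa using h

theorem wedge_zero_right (x : Ω[F⁄k]) : wedge k F x 0 = 0 := by
  simpa using wedge_smul_right k F 0 x 0

theorem wedge_zero_left (x : Ω[F⁄k]) : wedge k F 0 x = 0 := by
  simpa using wedge_smul_left k F 0 0 x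

/-- The additive map `∑ a [b] ↦ ∑ da ∧ db` on the free module generated by the symbols `[b]`. -/
def extDerivFree : (F →₀ F) →+ ⋀[F]^2 Ω[F⁄k] :=
  Finsupp.liftAddHom fun b =>
    { toFun := fun a => wedge k F (KaehlerDifferential.D k F a) (KaehlerDifferential.D k F b)
      map_zero' := by rw [map_zero, wedge_zero_left]
      map_add' := fun a a' => by rw [map_add, wedge_add_left] }

theorem extDerivFree_single (a b : F) : extDerivFree k F (Finsupp.single b a) =
    wedge k F (KaehlerDifferential.D k F a) (KaehlerDifferential.D k F b) := by
  simp only [extDerivFree, Finsupp.liftAddHom_apply_single]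
  rfl

theorem kerTotal_le_ker_extDerivFree :
    (KaehlerDifferential.kerTotal k F).toAddSubgroup ≤ (extDerivFree k F).ker := by
  intro x hx
  rw [AddMonoidHom.mem_ker]
  rw [Submodule.mem_toAddSubgroup, KaehlerDifferential.kerTotal] at hx
  refine Submodule.closure_induction (p := fun x _ => extDerivFree k F x = 0) (map_zero _)
    (fun x y _ _ hx hy => by rw [map_add, hx, hy, add_zero]) ?_ hx
  rintro s _ ((⟨⟨x, y⟩, rfl⟩ | ⟨⟨x, y⟩, rfl⟩) | ⟨c, rfl⟩)
  · simp only [smul_sub, smul_add, Finsupp.smul_single, smul_eq_mul, mul_one, map_sub, map_add,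
      extDerivFree_single, wedge_add_right, sub_self]
  · simp only [smul_sub, smul_add, Finsupp.smul_single, smul_eq_mul, mul_one, map_sub, map_add,
      extDerivFree_single, Derivation.leibniz, wedge_add_right, wedge_add_left, wedge_smul_left,
      wedge_smul_right]
    have h := wedge_swap k F (KaehlerDifferential.D k F x) (KaehlerDifferential.D k F y)
    rw [add_eq_zero_iff_eq_neg] at h
    rw [h, smul_neg]
    abel
  · simp only [Finsupp.smul_single, smul_eq_mul, mul_one, extDerivFree_single,
      Derivation.map_algebraMap, wedge_zero_right]

/-- The exterior derivative `d : Ω¹ → Ω²`, determined by `d (a db) = da ∧ db`. -/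
def extDeriv : Ω[F⁄k] →+ ⋀[F]^2 Ω[F⁄k] where
  toFun x := QuotientAddGroup.lift (KaehlerDifferential.kerTotal k F).toAddSubgroup
    (extDerivFree k F) (kerTotal_le_ker_extDerivFree k F)
    ((KaehlerDifferential.quotKerTotalEquiv k F).symm x)
  map_zero' := by
    rw [map_zero]
    exact map_zero (QuotientAddGroup.lift (KaehlerDifferential.kerTotal k F).toAddSubgroup
      (extDerivFree k F) (kerTotal_le_ker_extDerivFree k F))
  map_add' x y := by
    rw [map_add]
    exact map_add (QuotientAddGroup.lift (KaehlerDifferential.kerTotal k F).toAddSubgroup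
      (extDerivFree k F) (kerTotal_le_ker_extDerivFree k F)) _ _

theorem extDeriv_smul_D (a b : F) : extDeriv k F (a • KaehlerDifferential.D k F b) =
    wedge k F (KaehlerDifferential.D k F a) (KaehlerDifferential.D k F b) := by
  have h : (KaehlerDifferential.quotKerTotalEquiv k F).symm (a • KaehlerDifferential.D k F b) =
      (KaehlerDifferential.kerTotal k F).mkQ (Finsupp.single b a) := by
    rw [LinearEquiv.symm_apply_eq]
    exact (Finsupp.linearCombination_single F a b).symm
  exact (congrArg (QuotientAddGroup.lift (KaehlerDifferential.kerTotal k F).toAddSubgroup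
    (extDerivFree k F) (kerTotal_le_ker_extDerivFree k F)) h).trans (extDerivFree_single k F a b)

end ExteriorDerivative

/-! ### Functions and one-forms on the projective line

`K` is a field extension of `k`. The function field of the projective line over `K` is
`RatFunc K`, with coordinate `t = RatFunc.X`. The poles `a i` are distinct `K`-rational points
different from infinity. -/

section ProjectiveLine

variable (k : Type*) {K : Type*} [Field k] [Field K] [Algebra k K] {N r : ℕ}

/-- The linear function `t - c`, a local parameter at the point `c`. -/
def localParam (c : K) : RatFunc K := RatFunc.X - RatFunc.C c

/-- `1 / (t - c)`. -/
def pole (c : K) : RatFunc K := (localParam c)⁻¹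

/-- `Γ(P¹, O(*D)) = K[1/(t - a_1), …, 1/(t - a_N)]`, the functions without pole outside `D`
(in particular without pole at infinity). -/
def regularFunctions (a : Fin N → K) : Subalgebra K (RatFunc K) :=
  Algebra.adjoin K (Set.range fun i => pole (a i))

/-- `Γ(P¹, Ω¹(*D))`, where `Ω¹` are the absolute differentials, i.e. those over `k`: the
differential forms of the affine curve `P¹ ∖ D`. -/
def absForms (a : Fin N → K) : Submodule (regularFunctions a) Ω[RatFunc K⁄k] :=
  Submodule.span _ (Set.range fun f : regularFunctions a =>
    KaehlerDifferential.D k (RatFunc K) (f : RatFunc K))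

/-- `Γ(P¹, ω(*D))`, where `ω` are the relative differentials, i.e. those over `K`. -/
def relForms (a : Fin N → K) : Submodule (regularFunctions a) Ω[RatFunc K⁄K] :=
  Submodule.span _ (Set.range fun f : regularFunctions a =>
    KaehlerDifferential.D K (RatFunc K) (f : RatFunc K))

instance (a : Fin N → K) : AddCommGroup (relForms a) := Submodule.addCommGroup _

instance (a : Fin N → K) : Module (regularFunctions a) (relForms a) := Submodule.module _

instance (a : Fin N → K) : Module K (relForms a) := Submodule.module' _

/-- The local ring of the projective line at the point `c`: the rational functions without
pole at `c`. -/
def localRing (c : K) : Subalgebra K (RatFunc K) where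
  carrier := {f | ∃ p q : Polynomial K, q.eval c ≠ 0 ∧
    f = algebraMap (Polynomial K) (RatFunc K) p / algebraMap (Polynomial K) (RatFunc K) q}
  mul_mem' := by
    rintro _ _ ⟨p, q, hq, rfl⟩ ⟨p', q', hq', rfl⟩
    exact ⟨p * p', q * q', by simp [hq, hq'], by rw [map_mul, map_mul, div_mul_div_comm]⟩
  add_mem' := by
    rintro _ _ ⟨p, q, hq, rfl⟩ ⟨p', q', hq', rfl⟩
    have h0 : algebraMap (Polynomial K) (RatFunc K) q ≠ 0 :=
      RatFunc.algebraMap_ne_zero fun h => hq (by simp [h])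
    have h0' : algebraMap (Polynomial K) (RatFunc K) q' ≠ 0 :=
      RatFunc.algebraMap_ne_zero fun h => hq' (by simp [h])
    exact ⟨p * q' + q * p', q * q', by simp [hq, hq'], by
      rw [map_add, map_mul, map_mul, map_mul, div_add_div _ _ h0 h0']⟩
  algebraMap_mem' c' := ⟨Polynomial.C c', 1, by simp, by
    rw [map_one, div_one, RatFunc.algebraMap_C, RatFunc.algebraMap_eq_C]⟩

/-- The submodule `O_c ⊗ Ω¹_K` of the one-forms of the function field. -/
def baseForms (c : K) : Submodule (localRing c) Ω[RatFunc K⁄k] :=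
  Submodule.span _ (Set.range fun x : K =>
    KaehlerDifferential.D k (RatFunc K) (algebraMap K (RatFunc K) x))

/-! ### Connections on the trivial bundle

A connection `∇ = d + A` on the trivial bundle `⊕ O` of rank `r`, with poles on `D`, is given by
its matrix `A` of absolute one-forms: `∇ e_ν = ∑_μ A μ ν e_μ`. -/

/-- `∇ : E → E ⊗ Ω¹` on vectors of rational functions, `∇ v = dv + A v`. -/
def nablaZero (A : Matrix (Fin r) (Fin r) Ω[RatFunc K⁄k]) (v : Fin r → RatFunc K) :
    Fin r → Ω[RatFunc K⁄k] :=
  fun μ => KaehlerDifferential.D k (RatFunc K) (v μ) + ∑ ν, v ν • A μ ν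

/-- `∇ : E ⊗ Ω¹ → E ⊗ Ω²`, `∇ w = dw + A ∧ w`. -/
def nablaOne (A : Matrix (Fin r) (Fin r) Ω[RatFunc K⁄k]) (w : Fin r → Ω[RatFunc K⁄k]) :
    Fin r → ⋀[RatFunc K]^2 Ω[RatFunc K⁄k] :=
  fun μ => extDeriv k (RatFunc K) (w μ) + ∑ ν, wedge k (RatFunc K) (A μ ν) (w ν)

variable (K) in
/-- The two-forms coming from the base: `K(t) ⊗ Ω²_K`. -/
def baseTwoForms : Submodule (RatFunc K) (⋀[RatFunc K]^2 Ω[RatFunc K⁄k]) :=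
  Submodule.span _ (Set.range fun x : K × K => wedge k (RatFunc K)
    (KaehlerDifferential.D k (RatFunc K) (algebraMap K (RatFunc K) x.1))
    (KaehlerDifferential.D k (RatFunc K) (algebraMap K (RatFunc K) x.2)))

variable {k}

/-- The connection is vertical: its curvature `∇²` takes values in `E(*D) ⊗ Ω²_K`. -/
def IsVertical {a : Fin N → K} (A : Matrix (Fin r) (Fin r) (absForms k a)) : Prop :=
  ∀ (v : Fin r → regularFunctions a) (μ : Fin r),
    nablaOne k (A.map Subtype.val) (nablaZero k (A.map Subtype.val) fun ν => v ν) μ ∈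
      baseTwoForms k K

/-- Near the point `c`, with the local parameter `z = t - c`, the matrix of the connection has
the shape `G dz / z ^ m + η / z ^ M` with `G` having entries in the local ring and `η` having
entries in `O_c ⊗ Ω¹_K`. -/
def HasLocalEquation (A : Matrix (Fin r) (Fin r) Ω[RatFunc K⁄k]) (c : K) (m M : ℕ)
    (G : Matrix (Fin r) (Fin r) (localRing c)) : Prop :=
  ∃ B : Matrix (Fin r) (Fin r) (baseForms k c), ∀ μ ν,
    A μ ν = (pole c ^ m * (G μ ν : RatFunc K)) • KaehlerDifferential.D k (RatFunc K) (localParam c)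
      + pole c ^ M • (B μ ν : Ω[RatFunc K⁄k])

/-- A singularity of multiplicity `m ≥ 2` at which the connection takes values in `Ω¹{𝒟}` and
the relative polar part is an isomorphism. -/
def IsAdmissibleAt (A : Matrix (Fin r) (Fin r) Ω[RatFunc K⁄k]) (c : K) (m : ℕ) : Prop :=
  2 ≤ m ∧ ∃ G : Matrix (Fin r) (Fin r) (localRing c), IsUnit G ∧ HasLocalEquation A c m (m - 1) G

/-- A pseudo-logarithmic singularity: local equation `G dz / z + η / z` with `G` invertible. -/
def IsPseudoLogAt (A : Matrix (Fin r) (Fin r) Ω[RatFunc K⁄k]) (c : K) : Prop :=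
  ∃ G : Matrix (Fin r) (Fin r) (localRing c), IsUnit G ∧ HasLocalEquation A c 1 1 G

/-- A connection with poles on `D = {a i}`, of multiplicity `m i` at `a i`, is pseudo-admissible
if it is admissible at the points of multiplicity `≥ 2` and pseudo-logarithmic at the points of
multiplicity one. -/
def IsPseudoAdmissible (a : Fin N → K) (m : Fin N → ℕ)
    (A : Matrix (Fin r) (Fin r) (absForms k a)) : Prop :=
  ∀ i, IsAdmissibleAt (A.map Subtype.val) (a i) (m i) ∨
    (m i = 1 ∧ IsPseudoLogAt (A.map Subtype.val) (a i))

/-- The pole order `M_i` of the part of the connection coming from `Ω¹_K`. -/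
def etaOrder (m : ℕ) : ℕ := if 2 ≤ m then m - 1 else m

/-- The equation of the connection:
`A = ∑_i ∑_{1 ≤ s ≤ m_i} g_s^{(i)} d(t - a_i) / (t - a_i)^s
   + ∑_i ∑_{1 ≤ s ≤ M_i} η_s^{(i)} / (t - a_i)^s + η_0`,
with matrices `g i s` over `K` and `η i s`, `η₀` over `Ω¹_K`. -/
def HasEquation (a : Fin N → K) (m : Fin N → ℕ) (A : Matrix (Fin r) (Fin r) (absForms k a))
    (g : Fin N → ℕ → Matrix (Fin r) (Fin r) K)
    (η : Fin N → ℕ → Matrix (Fin r) (Fin r) Ω[K⁄k]) (η₀ : Matrix (Fin r) (Fin r) Ω[K⁄k]) : Prop :=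
  ∀ μ ν, (A μ ν : Ω[RatFunc K⁄k]) =
    (∑ i, ∑ s ∈ Finset.Icc 1 (m i), (RatFunc.C (g i s μ ν) * pole (a i) ^ s) •
      KaehlerDifferential.D k (RatFunc K) (localParam (a i)))
    + (∑ i, ∑ s ∈ Finset.Icc 1 (etaOrder (m i)), pole (a i) ^ s •
      KaehlerDifferential.map k k K (RatFunc K) (η i s μ ν))
    + KaehlerDifferential.map k k K (RatFunc K) (η₀ μ ν)

/-! ### The Higgs field and the relative connection -/

/-- `Γ(E(*D))`. -/
abbrev Sections (a : Fin N → K) (r : ℕ) : Type _ := Fin r → regularFunctions a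

/-- `Γ(E ⊗ ω(*D))`. -/
abbrev FormSections (a : Fin N → K) (r : ℕ) : Type _ := Fin r → relForms a

/-- The projection from absolute to relative one-forms on `P¹ ∖ D`. -/
def toRel (a : Fin N → K) : absForms k a →ₗ[regularFunctions a] relForms a :=
  ((KaehlerDifferential.map k K (RatFunc K) (RatFunc K)).restrictScalars
    (regularFunctions a)).restrict (by
      intro x hx
      refine Submodule.span_induction ?_ ?_ ?_ ?_ hx
      · rintro _ ⟨f, rfl⟩
        refine Submodule.subset_span ⟨f, ?_⟩
        simp
      · simp
      · intro x y _ _ hx hy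
        rw [map_add]
        exact add_mem hx hy
      · intro c x _ hx
        rw [map_smul]
        exact Submodule.smul_mem _ c hx)

/-- `γ_K : Γ(E(*D)) → Γ(E ⊗ ω(*D))`, multiplication by the matrix of the relative connection. -/
def higgsField {a : Fin N → K} (A : Matrix (Fin r) (Fin r) (absForms k a)) :
    Sections a r →ₗ[K] FormSections a r where
  toFun v μ := ∑ ν, v ν • toRel a (A μ ν)
  map_add' v w := by
    funext μ
    simp [add_smul, Finset.sum_add_distrib]
  map_smul' c v := by
    funext μ
    simp [Finset.smul_sum]

/-- The differential `Γ(O(*D)) → Γ(ω(*D))` over `K`. -/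
def relDiff (a : Fin N → K) : regularFunctions a →ₗ[K] relForms a where
  toFun f := ⟨KaehlerDifferential.D K (RatFunc K) f, Submodule.subset_span ⟨f, rfl⟩⟩
  map_add' f g := by ext; simp
  map_smul' c f := by ext; simp

/-- The relative connection `∇_{/K} = d + γ_K : Γ(E(*D)) → Γ(E ⊗ ω(*D))`. -/
def relConnection {a : Fin N → K} (A : Matrix (Fin r) (Fin r) (absForms k a)) :
    Sections a r →ₗ[K] FormSections a r :=
  (relDiff a).compLeft (Fin r) + higgsField A

/-! ### The subspace `H` -/

theorem pole_mem (a : Fin N → K) (i : Fin N) : pole (a i) ∈ regularFunctions a :=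
  Algebra.subset_adjoin ⟨i, rfl⟩

theorem localParam_ne_zero (c : K) : localParam c ≠ 0 := by
  have h : localParam c = algebraMap (Polynomial K) (RatFunc K) (Polynomial.X - Polynomial.C c) := by
    simp [localParam]
  rw [h]
  exact RatFunc.algebraMap_ne_zero (Polynomial.X_sub_C_ne_zero c)

theorem D_localParam (c : K) : KaehlerDifferential.D K (RatFunc K) (localParam c) =
    KaehlerDifferential.D K (RatFunc K) RatFunc.X := by
  rw [localParam, map_sub, ← RatFunc.algebraMap_eq_C, Derivation.map_algebraMap, sub_zero]

theorem D_pole (c : K) : KaehlerDifferential.D K (RatFunc K) (pole c) =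
    -(pole c ^ 2 • KaehlerDifferential.D K (RatFunc K) RatFunc.X) := by
  rw [pole, Derivation.leibniz_inv, D_localParam, neg_smul]

theorem pole_sq_mem (a : Fin N → K) (i : Fin N) :
    pole (a i) ^ 2 • KaehlerDifferential.D K (RatFunc K) RatFunc.X ∈ relForms a := by
  rw [← neg_mem_iff, ← D_pole]
  exact Submodule.subset_span ⟨⟨pole (a i), pole_mem a i⟩, rfl⟩

/-- The form `dt / (t - a_i) ^ s`, which has no pole at infinity as `s ≥ 2`. -/
def polarForm (a : Fin N → K) (i : Fin N) (s : ℕ) (hs : 2 ≤ s) : relForms a :=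
  ⟨pole (a i) ^ s • KaehlerDifferential.D K (RatFunc K) RatFunc.X, by
    obtain ⟨n, rfl⟩ := Nat.exists_eq_add_of_le' hs
    rw [pow_add, mul_smul]
    exact Submodule.smul_mem _ (⟨pole (a i) ^ n, pow_mem (pole_mem a i) n⟩ : regularFunctions a)
      (pole_sq_mem a i)⟩

/-- The form `dt (1 / (t - a_i) - 1 / (t - a_j))`, which has no pole at infinity. -/
def simpleForm (a : Fin N → K) (i j : Fin N) : relForms a :=
  ⟨(pole (a i) - pole (a j)) • KaehlerDifferential.D K (RatFunc K) RatFunc.X, by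
    have h : pole (a i) - pole (a j) = (algebraMap K (RatFunc K) (a i - a j) *
        (1 + algebraMap K (RatFunc K) (a j - a i) * pole (a j))) * pole (a i) ^ 2 := by
      have hi := localParam_ne_zero (a i)
      have hj := localParam_ne_zero (a j)
      simp only [pole]
      field_simp
      simp only [localParam, map_sub, RatFunc.algebraMap_eq_C]
      ring
    rw [h, mul_smul]
    exact Submodule.smul_mem _ (⟨_, mul_mem (Subalgebra.algebraMap_mem _ _)
      (add_mem (one_mem _) (mul_mem (Subalgebra.algebraMap_mem _ _) (pole_mem a j)))⟩ :
        regularFunctions a) (pole_sq_mem a i)⟩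

/-- The subspace `H` of `Γ(E ⊗ ω(*D))` spanned by the `e_μ dt / (t - a_i)^s` with `2 ≤ s ≤ m_i`
for `i ≠ o`, those with `2 ≤ s ≤ m_o - 1` for `i = o`, and the
`e_μ dt (1 / (t - a_i) - 1 / (t - a_o))` with `i ≠ o`. -/
def H (a : Fin N → K) (m : Fin N → ℕ) (o : Fin N) (r : ℕ) : Submodule K (FormSections a r) :=
  Submodule.span K
    ({x | ∃ (μ : Fin r) (i : Fin N) (s : ℕ) (hs : 2 ≤ s),
        s ≤ (if i = o then m i - 1 else m i) ∧ x = Pi.single μ (polarForm a i s hs)} ∪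
      {x | ∃ (μ : Fin r) (i : Fin N), i ≠ o ∧ x = Pi.single μ (simpleForm a i o)})

instance (a : Fin N → K) (m : Fin N → ℕ) (o : Fin N) (r : ℕ) : AddCommGroup (H a m o r) :=
  Submodule.addCommGroup _

instance (a : Fin N → K) (m : Fin N → ℕ) (o : Fin N) (r : ℕ) : Module K (H a m o r) :=
  Submodule.module _

instance finite_H (a : Fin N → K) (m : Fin N → ℕ) (o : Fin N) (r : ℕ) :
    Module.Finite K (H a m o r) := by
  refine Module.Finite.span_of_finite K (Set.Finite.union ?_ ?_)
  · refine (Set.finite_range fun p : Fin r × (Σ i : Fin N, {s : Fin (m i + 1) // 2 ≤ s.1}) =>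
      (Pi.single p.1 (polarForm a p.2.1 p.2.2.1.1 p.2.2.2) : FormSections a r)).subset ?_
    rintro _ ⟨μ, i, s, hs, h, rfl⟩
    have h' : s < m i + 1 := by split_ifs at h <;> omega
    exact ⟨⟨μ, ⟨i, ⟨⟨s, h'⟩, hs⟩⟩⟩, rfl⟩
  · refine (Set.finite_range fun p : Fin r × Fin N =>
      (Pi.single p.1 (simpleForm a p.2 o) : FormSections a r)).subset ?_
    rintro _ ⟨μ, i, -, rfl⟩
    exact ⟨⟨μ, i⟩, rfl⟩

/-! ### The Higgs operator, the de Rham operator and their traces -/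

/-- Multiplication by a function `f` on `P¹ ∖ D`, as a map `Γ(ω(*D)) → Γ(ω(*D))`. -/
def mulFun (a : Fin N → K) (f : regularFunctions a) : relForms a →ₗ[K] relForms a where
  toFun x := f • x
  map_add' x y := smul_add f x y
  map_smul' c x := smul_comm f c x

/-- Multiplication by `f B`, for a function `f` on `P¹ ∖ D` and a matrix `B` over `Ω¹_K`:
`f B : Γ(E ⊗ ω(*D)) → Γ(E ⊗ ω(*D)) ⊗ Ω¹_K`, `x ↦ ∑_{μ, ν} (f x_ν) e_μ ⊗ B_{μ ν}`. -/
def mulForm (a : Fin N → K) (f : regularFunctions a) (B : Matrix (Fin r) (Fin r) Ω[K⁄k]) :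
    FormSections a r →ₗ[K] FormSections a r ⊗[K] Ω[K⁄k] where
  toFun x := ∑ μ, ∑ ν, (Pi.single μ (mulFun a f (x ν)) : FormSections a r) ⊗ₜ[K] B μ ν
  map_add' x y := by
    simp only [Pi.add_apply, map_add, Pi.single_add, TensorProduct.add_tmul,
      Finset.sum_add_distrib]
  map_smul' c x := by
    simp only [Pi.smul_apply, map_smul, RingHom.id_apply, Finset.smul_sum,
      TensorProduct.smul_tmul', Pi.single_smul]

/-- Multiplication by `η = ∑_i ∑_{1 ≤ s ≤ M_i} η_s^{(i)} / (t - a_i)^s + η_0`. -/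
def mulEta (a : Fin N → K) (m : Fin N → ℕ) (η : Fin N → ℕ → Matrix (Fin r) (Fin r) Ω[K⁄k])
    (η₀ : Matrix (Fin r) (Fin r) Ω[K⁄k]) :
    FormSections a r →ₗ[K] FormSections a r ⊗[K] Ω[K⁄k] :=
  (∑ i, ∑ s ∈ Finset.Icc 1 (etaOrder (m i)),
    mulForm a (⟨pole (a i), pole_mem a i⟩ ^ s) (η i s)) + mulForm a 1 η₀

/-- For a complement `P` of `W` in `V` with projection `π : V → V / P ≅ W`, the operator
`(π ⊗ 1) ∘ φ ∘ σ : W → W ⊗ M` induced by `φ : V → V ⊗ M`, where `σ` is the inclusion of `W`. -/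
def inducedOperator {V M : Type*} [AddCommGroup V] [Module K V] [AddCommGroup M] [Module K M]
    {W P : Submodule K V} (h : IsCompl W P) (φ : V →ₗ[K] V ⊗[K] M) : W →ₗ[K] W ⊗[K] M :=
  (Submodule.projectionOnto W P h).rTensor M ∘ₗ φ ∘ₗ W.subtype

/-- The trace of a linear map `φ : W → W ⊗ M`, an element of `M`. -/
def tensorTrace {W M : Type*} [AddCommGroup W] [Module K W] [Module.Finite K W]
    [AddCommGroup M] [Module K M] (φ : W →ₗ[K] W ⊗[K] M) : M :=
  ∑ j, TensorProduct.lid K M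
    (((Module.finBasis K W).coord j).rTensor M (φ (Module.finBasis K W j)))

variable (k) in
/-- `dlog f = df / f` in `Ω¹_K`. -/
def dlog (f : K) : Ω[K⁄k] := f⁻¹ • KaehlerDifferential.D k K f

end ProjectiveLine

end HiggsDeRham

end

open HiggsDeRham

noncomputable section

/-! Write z = t - a_i, let g be the matrix of order m_i at a_i, let γ_K = F dt, and let o be the
distinguished index with m_o ≥ 2.

Complements. The Higgs field and the relative connection are the cases ε = 0, 1 of the family ε d +
γ_K (`epsConnection`). Multiplication by F raises the pole order at a_i by m_i, differentiation only
by one. Hence a section with leading term x z^(-n) goes to one with leading term (g - ε n) x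
z^(-m_i-n), where ε n is present only if m_i = 1 (`vecVal_epsConnection`). By partial fractions H is
the space of forms with poles of order at most m_i at a_i and at most m_o - 1 at a_o. If the leading
matrices are invertible for all n ≥ 1, poles can be lowered at all points simultaneously until they
have order at most m_i. A constant section then removes the order m_o term at a_o. The same leading
terms show that the image meets H in zero (`isCompl_H`). Conversely, a dimension count on sections
of bounded pole order recovers the invertibility from the mere fact that H is a complement of the
image of the relative connection (`isUnit_leadMatrix_of_isCompl`).

Traces. Let P w be the section with w - ∇(P w) in H. As ∇ and γ_K differ by d, the projections
satisfy π_γ - π_∇ = π_γ d P. The derivative d(P η x) depends only on the finitely many polar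
coefficients of P η x, so the trace of η_γ - η_∇ is the sum, over i, s, μ, of the coefficient of e_μ
z^(-s) in P η π_γ d(e_μ z^(-s)) (`trace_sub_trace`). For m_i ≥ 2 leading terms suffice, and each s
contributes -s tr(g⁻¹ η_(m_i-1)).

Verticality enters by contracting the curvature with d/dt and a lifted derivation δ of K, which
gives δ(g)-part - dη/dt = [F, θ] (`flatness`). Multiplication by F⁻¹ and the trace remove the
commutator, and the leading coefficient gives tr(g⁻¹ δg) = -(m_i - 1) tr(g⁻¹ η_(m_i-1)). Summing
over 1 ≤ s ≤ m_i - 1 yields (m_i/2) dlog det g. At a_o the sum stops at m_o - 2, which leaves one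
dlog det g too few. A point with m_i = 1 contributes exactly dlog det g. These integral multiples
form the class in dlog K^×. -/

namespace HiggsDeRham

/-! ### Derivations of K(t) and their pairing with differential forms -/

section Derivations

variable {k K : Type*} [Field k] [Field K] [Algebra k K]

/-- A derivation of the polynomial ring extends to the field of rational functions. -/
def extendDerivation (R : Type*) [CommRing R] [Algebra R K]
    (d : Derivation R (Polynomial K) (RatFunc K)) : Derivation R (RatFunc K) (RatFunc K) :=
  haveI := Algebra.FormallyEtale.of_isLocalization (Rₘ := RatFunc K)
    (nonZeroDivisors (Polynomial K))
  ((d.liftKaehlerDifferential.liftBaseChange (RatFunc K)) ∘ₗ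
    (KaehlerDifferential.tensorKaehlerEquivOfFormallyEtale R (Polynomial K)
      (RatFunc K)).symm.toLinearMap).compDer (KaehlerDifferential.D R (RatFunc K))

theorem extendDerivation_algebraMap (R : Type*) [CommRing R] [Algebra R K]
    (d : Derivation R (Polynomial K) (RatFunc K)) (p : Polynomial K) :
    extendDerivation R d (algebraMap (Polynomial K) (RatFunc K) p) = d p := by
  have := Algebra.FormallyEtale.of_isLocalization (Rₘ := RatFunc K)
    (nonZeroDivisors (Polynomial K))
  have h := KaehlerDifferential.tensorKaehlerEquivOfFormallyEtale_symm_D_algebraMap R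
    (Polynomial K) (RatFunc K) p
  refine (congrArg (d.liftKaehlerDifferential.liftBaseChange (RatFunc K)) h).trans ?_
  simp

variable (K) in
/-- The derivation `d/dt` of the field of rational functions over `K`. -/
def ddt : Derivation K (RatFunc K) (RatFunc K) :=
  extendDerivation K
    ((Algebra.linearMap (Polynomial K) (RatFunc K)).compDer Polynomial.derivative')

theorem ddt_X : ddt K RatFunc.X = 1 := by
  rw [← RatFunc.algebraMap_X, ddt, extendDerivation_algebraMap]
  simp

theorem ddt_C (c : K) : ddt K (RatFunc.C c) = 0 := by
  rw [← RatFunc.algebraMap_eq_C]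
  exact Derivation.map_algebraMap _ _

/-- The derivation of the field of rational functions which extends a derivation of the field of
constants and annihilates the coordinate. -/
def liftDer (δ : Derivation k K K) : Derivation k (RatFunc K) (RatFunc K) :=
  extendDerivation k ((Algebra.linearMap (Polynomial K) (RatFunc K) ∘ₗ
    PolynomialModule.equivPolynomialSelf.toLinearMap).compDer δ.mapCoeffs)

theorem liftDer_X (δ : Derivation k K K) : liftDer δ RatFunc.X = 0 := by
  rw [← RatFunc.algebraMap_X, liftDer, extendDerivation_algebraMap]
  simp

theorem liftDer_C (δ : Derivation k K K) (c : K) : liftDer δ (RatFunc.C c) = RatFunc.C (δ c) := by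
  rw [← RatFunc.algebraMap_C, liftDer, extendDerivation_algebraMap]
  simp

/-- The Leibniz and quotient rules reduce everything to constants and t. This is the uniqueness
principle behind `liftDer_ddt_comm` and `relForm_eq`. -/
theorem derivation_ratFunc_eq_zero {M : Type*} [AddCommGroup M] [Module (RatFunc K) M]
    [Module k M] (d : Derivation k (RatFunc K) M)
    (hC : ∀ c : K, d (RatFunc.C c) = 0) (hX : d RatFunc.X = 0) (f : RatFunc K) : d f = 0 := by
  have hp : ∀ p : Polynomial K, d (algebraMap (Polynomial K) (RatFunc K) p) = 0 := by
    intro p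
    induction p using Polynomial.induction_on' with
    | add p q hp hq => rw [map_add, map_add, hp, hq, add_zero]
    | monomial n c =>
      rw [RatFunc.algebraMap_monomial, Derivation.leibniz, Derivation.leibniz_pow, hX, hC]
      simp
  induction f using RatFunc.induction_on with
  | f p q hq => rw [Derivation.leibniz_div, hp, hp]; simp

/-- The bracket of the two derivations is again a derivation, and it vanishes on constants and on t.
-/
theorem liftDer_ddt_comm (δ : Derivation k K K) (f : RatFunc K) :
    liftDer δ (ddt K f) = ddt K (liftDer δ f) := by
  have h := derivation_ratFunc_eq_zero ⁅liftDer δ, (ddt K).restrictScalars k⁆ (fun c => by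
    simp [Derivation.commutator_apply, ddt_C, liftDer_C]) (by
    simp [Derivation.commutator_apply, ddt_X, liftDer_X]) f
  rw [Derivation.commutator_apply, sub_eq_zero] at h
  exact h

/-- The pairing of a one-form with a derivation. -/
abbrev pairing {R : Type*} [CommRing R] {F : Type*} [CommRing F] [Algebra R F]
    (d : Derivation R F F) : Ω[F⁄R] →ₗ[F] F :=
  d.liftKaehlerDifferential

/-- The pairing of a two-form with a pair of derivations. -/
def pairingTwo {F : Type*} [Field F] [Algebra k F] (d e : Derivation k F F) :
    ⋀[F]^2 Ω[F⁄k] →ₗ[F] F :=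
  exteriorPower.alternatingMapLinearEquiv
    ((Matrix.detRowAlternating (n := Fin 2) (R := F)).compLinearMap
      (LinearMap.pi ![pairing d, pairing e]))

theorem pairingTwo_wedge {F : Type*} [Field F] [Algebra k F] (d e : Derivation k F F)
    (x y : Ω[F⁄k]) :
    pairingTwo d e (wedge k F x y) = pairing d x * pairing e y - pairing e x * pairing d y := by
  rw [pairingTwo, wedge, exteriorPower.alternatingMapLinearEquiv_apply_ιMulti]
  simp only [AlternatingMap.compLinearMap_apply]
  exact Matrix.det_fin_two _

/-- Cartan's formula; its third term, the pairing with the bracket of `d` and `e`, is absent because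
they commute. -/
theorem pairingTwo_extDeriv {F : Type*} [Field F] [Algebra k F] (d e : Derivation k F F)
    (hde : ∀ f, d (e f) = e (d f)) (x : Ω[F⁄k]) :
    pairingTwo d e (extDeriv k F x) = d (pairing e x) - e (pairing d x) := by
  have hx : x ∈ Submodule.span F (Set.range (KaehlerDifferential.D k F)) := by
    rw [KaehlerDifferential.span_range_derivation]; trivial
  induction hx using Submodule.closure_induction with
  | zero => simp
  | add x y _ _ hx hy => simp only [map_add, hx, hy]; ring
  | smul_mem c x hx =>
    obtain ⟨b, rfl⟩ := hx
    rw [extDeriv_smul_D, pairingTwo_wedge]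
    simp [hde]
    ring

/-- d/dt annihilates constants, so this contraction sees only the component of a two-form involving
dt, the one that verticality makes vanish. -/
theorem pairingTwo_baseTwoForms (δ : Derivation k K K) {x : ⋀[RatFunc K]^2 Ω[RatFunc K⁄k]}
    (hx : x ∈ baseTwoForms k K) : pairingTwo (liftDer δ) ((ddt K).restrictScalars k) x = 0 := by
  induction hx using Submodule.span_induction with
  | zero => simp
  | add x y _ _ hx hy => rw [map_add, hx, hy, add_zero]
  | smul c x _ hx => rw [map_smul, hx, smul_zero]
  | mem x hx =>
    obtain ⟨p, rfl⟩ := hx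
    simp [pairingTwo_wedge, ddt_C]

theorem pairing_map (f : Ω[RatFunc K⁄k]) :
    pairing (ddt K) (KaehlerDifferential.map k K (RatFunc K) (RatFunc K) f) =
      pairing ((ddt K).restrictScalars k) f := by
  have hx : f ∈ Submodule.span (RatFunc K) (Set.range (KaehlerDifferential.D k (RatFunc K))) := by
    rw [KaehlerDifferential.span_range_derivation]; trivial
  induction hx using Submodule.span_induction with
  | zero => simp
  | add x y _ _ hx hy => simp only [map_add, hx, hy]
  | smul c x _ hx => rw [map_smul, map_smul, map_smul, hx]
  | mem x hx =>
    obtain ⟨p, rfl⟩ := hx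
    simp

/-- The derivation attached to a linear functional on one-forms. -/
def functionalDer (l : Ω[K⁄k] →ₗ[K] K) : Derivation k K K := l.compDer (KaehlerDifferential.D k K)

theorem functionalDer_apply (l : Ω[K⁄k] →ₗ[K] K) (x : K) :
    functionalDer l x = l (KaehlerDifferential.D k K x) := rfl

theorem pairing_ddt_base (x : Ω[K⁄k]) :
    pairing ((ddt K).restrictScalars k) (KaehlerDifferential.map k k K (RatFunc K) x) = 0 := by
  have hx : x ∈ Submodule.span K (Set.range (KaehlerDifferential.D k K)) := by
    rw [KaehlerDifferential.span_range_derivation]; trivial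
  induction hx using Submodule.span_induction with
  | zero => simp
  | add x y _ _ hx hy => simp only [map_add, hx, hy, add_zero]
  | smul c x _ hx => rw [map_smul, ← algebraMap_smul (RatFunc K) c, map_smul, hx, smul_zero]
  | mem x hx =>
    obtain ⟨p, rfl⟩ := hx
    simp [ddt_C]

theorem pairing_liftDer_base (l : Ω[K⁄k] →ₗ[K] K) (x : Ω[K⁄k]) :
    pairing (liftDer (functionalDer l)) (KaehlerDifferential.map k k K (RatFunc K) x) =
      RatFunc.C (l x) := by
  have hx : x ∈ Submodule.span K (Set.range (KaehlerDifferential.D k K)) := by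
    rw [KaehlerDifferential.span_range_derivation]; trivial
  induction hx using Submodule.span_induction with
  | zero => simp
  | add x y _ _ hx hy => simp only [map_add, hx, hy]
  | smul c x _ hx =>
    rw [map_smul, ← algebraMap_smul (RatFunc K) c, map_smul, hx, map_smul, smul_eq_mul, smul_eq_mul,
      map_mul, RatFunc.algebraMap_eq_C]
  | mem x hx =>
    obtain ⟨p, rfl⟩ := hx
    simp [liftDer_C, functionalDer_apply]

/-- Relative forms are multiples of dt, since D - (d/dt) dt is a derivation vanishing on constants
and on t. Everything about them can thus be read off a single rational function. -/
theorem relForm_eq (x : Ω[RatFunc K⁄K]) :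
    x = pairing (ddt K) x • KaehlerDifferential.D K (RatFunc K) RatFunc.X := by
  have hx : x ∈ Submodule.span (RatFunc K) (Set.range (KaehlerDifferential.D K (RatFunc K))) := by
    rw [KaehlerDifferential.span_range_derivation]; trivial
  induction hx using Submodule.span_induction with
  | zero => simp
  | add x y _ _ hx hy => rw [map_add, add_smul, ← hx, ← hy]
  | smul c x _ hx => rw [map_smul, smul_assoc, ← hx]
  | mem x hx =>
    obtain ⟨p, rfl⟩ := hx
    have h := derivation_ratFunc_eq_zero (KaehlerDifferential.D K (RatFunc K) -
      (LinearMap.toSpanSingleton (RatFunc K) _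
        (KaehlerDifferential.D K (RatFunc K) RatFunc.X)).compDer (ddt K))
      (fun c => by
        have := (KaehlerDifferential.D K (RatFunc K)).map_algebraMap c
        rw [RatFunc.algebraMap_eq_C] at this
        simp [ddt_C, this]) (by simp [ddt_X]) p
    simpa [sub_eq_zero] using h

theorem relForm_ext {x y : Ω[RatFunc K⁄K]} (h : pairing (ddt K) x = pairing (ddt K) y) : x = y := by
  rw [relForm_eq x, relForm_eq y, h]

end Derivations

/-! ### Jacobi's formula -/

section DerivativeOfDeterminant

/-- The ring homomorphism to the dual numbers given by a derivation. -/
def dualNumberHom {k K : Type*} [CommRing k] [CommRing K] [Algebra k K] (δ : Derivation k K K) :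
    K →+* DualNumber K where
  toFun x := TrivSqZeroExt.inl x + TrivSqZeroExt.inr (δ x)
  map_one' := by simp
  map_zero' := by simp
  map_add' x y := by ext <;> simp
  map_mul' x y := by ext <;> simp [mul_comm]

/-- Jacobi's formula for a derivation. -/
theorem derivation_det {k K ι : Type*} [Field k] [Field K] [Algebra k K] [Fintype ι]
    [DecidableEq ι] (δ : Derivation k K K) (M : Matrix ι ι K) (hM : IsUnit M.det) :
    δ M.det = M.det * (M⁻¹ * M.map δ).trace := by
  -- M + ε δM = M (1 + ε M⁻¹ δM) over the dual numbers. As ε² = 0, the determinant of the second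
  -- factor is 1 + ε tr(M⁻¹ δM).
  have h1 : (dualNumberHom δ).mapMatrix M = M.map (TrivSqZeroExt.inlHom K K) *
      (1 + (DualNumber.eps : DualNumber K) •
        (M⁻¹ * M.map δ).map (TrivSqZeroExt.inlHom K K)) := by
    rw [Matrix.mul_add, Matrix.mul_one, Matrix.mul_smul, ← Matrix.map_mul, ← Matrix.mul_assoc,
      Matrix.mul_nonsing_inv _ hM, Matrix.one_mul]
    ext i j <;> simp [dualNumberHom]
  have h2 := congrArg Matrix.det h1
  rw [← RingHom.map_det, Matrix.det_mul, Matrix.det_one_add_smul] at h2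
  have h3 := congrArg TrivSqZeroExt.snd h2
  have h4 : (M.map (TrivSqZeroExt.inlHom K K)).det = TrivSqZeroExt.inl M.det :=
    ((TrivSqZeroExt.inlHom K K).map_det M).symm
  have h5 : ((M⁻¹ * M.map δ).map (TrivSqZeroExt.inlHom K K)).trace =
      TrivSqZeroExt.inl (M⁻¹ * M.map δ).trace := by
    exact (AddMonoidHom.map_trace (TrivSqZeroExt.inlHom K K) _).symm
  rw [h4, h5] at h3
  simpa [dualNumberHom, sq] using h3

end DerivativeOfDeterminant

/-! ### Laurent expansions, values and polar coefficients -/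

section LaurentExpansion

variable {K : Type*} [Field K]

/-- The expansion of polynomials at the point `c`. -/
def expandPolynomial (c : K) : Polynomial K →+* LaurentSeries K :=
  (HahnSeries.ofPowerSeries ℤ K).comp
    (Polynomial.eval₂RingHom PowerSeries.C (PowerSeries.X + PowerSeries.C c))

/-- The expansion is the invertible translation p(t) ↦ p(t + c) followed by the inclusion of
polynomials into power series. -/
theorem expandPolynomial_injective (c : K) : Function.Injective (expandPolynomial c) := by
  refine HahnSeries.ofPowerSeries_injective.comp ?_
  have h : ⇑(Polynomial.eval₂RingHom (PowerSeries.C (R := K)) (PowerSeries.X + PowerSeries.C c)) =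
      fun p : Polynomial K => ((p.comp (Polynomial.X + Polynomial.C c) : Polynomial K) : PowerSeries K) := by
    funext p
    have := Polynomial.hom_eval₂ p (Polynomial.C (R := K)) (Polynomial.coeToPowerSeries.ringHom (R := K))
      (Polynomial.X + Polynomial.C c)
    simp only [Polynomial.coeToPowerSeries.ringHom_apply] at this
    rw [Polynomial.comp, this, Polynomial.coe_add, Polynomial.coe_X, Polynomial.coe_C]
    have hC : (Polynomial.coeToPowerSeries.ringHom (R := K)).comp Polynomial.C = PowerSeries.C := by
      ext
      simp
    rw [hC]
    rfl
  rw [h]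
  refine Polynomial.coe_injective K |>.comp ?_
  intro p q hpq
  have := congrArg (fun s => s.comp (Polynomial.X - Polynomial.C c)) hpq
  simpa [Polynomial.comp_assoc] using this

/-- The Laurent expansion of rational functions at the point `c`. -/
def laurentAt (c : K) : RatFunc K →+* LaurentSeries K :=
  RatFunc.liftRingHom (expandPolynomial c)
    (nonZeroDivisors_le_comap_nonZeroDivisors_of_injective _ (expandPolynomial_injective c))

theorem laurentAt_algebraMap (c : K) (p : Polynomial K) :
    laurentAt c (algebraMap (Polynomial K) (RatFunc K) p) = expandPolynomial c p :=
  RatFunc.liftRingHom_algebraMap _ _ _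

theorem laurentAt_C (c x : K) :
    laurentAt c (RatFunc.C x) = HahnSeries.ofPowerSeries ℤ K (PowerSeries.C x) := by
  rw [← RatFunc.algebraMap_C, laurentAt_algebraMap]
  simp [expandPolynomial]

theorem laurentAt_localParam (c c' : K) : laurentAt c (localParam c') =
    HahnSeries.ofPowerSeries ℤ K (PowerSeries.X + PowerSeries.C (c - c')) := by
  rw [localParam, map_sub, laurentAt_C, ← RatFunc.algebraMap_X, laurentAt_algebraMap]
  simp [expandPolynomial, add_sub_assoc]

/-- The coefficient of `(t - c) ^ (-n)` in the expansion at `c`. -/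
def coef (c : K) (n : ℕ) : RatFunc K →ₗ[K] K where
  toFun f := (laurentAt c f).coeff (-n)
  map_add' f g := by simp
  map_smul' x f := by
    rw [RatFunc.smul_eq_C_mul, map_mul, laurentAt_C]
    simp

/-- The function `f` is regular at `c`, with value `x`. -/
def IsVal (c : K) (f : RatFunc K) (x : K) : Prop :=
  ∃ p : PowerSeries K, laurentAt c f = HahnSeries.ofPowerSeries ℤ K p ∧
    PowerSeries.constantCoeff p = x

variable {c : K}

theorem isVal_C (c x : K) : IsVal c (RatFunc.C x) x := ⟨_, laurentAt_C c x, by simp⟩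

theorem isVal_zero (c : K) : IsVal c 0 0 := by simpa using isVal_C c 0

theorem isVal_one (c : K) : IsVal c 1 1 := by simpa using isVal_C c 1

theorem isVal_localParam (c c' : K) : IsVal c (localParam c') (c - c') :=
  ⟨_, laurentAt_localParam c c', by simp⟩

theorem isVal_localParam_self (c : K) : IsVal c (localParam c) 0 := by
  simpa using isVal_localParam c c

theorem IsVal.congr {f g : RatFunc K} {x y : K} (h : IsVal c f x) (hf : f = g) (hx : x = y) :
    IsVal c g y := hf ▸ hx ▸ h

theorem IsVal.unique {f : RatFunc K} {x y : K} (h : IsVal c f x) (h' : IsVal c f y) : x = y := by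
  obtain ⟨p, hp, rfl⟩ := h
  obtain ⟨q, hq, rfl⟩ := h'
  rw [HahnSeries.ofPowerSeries_injective (hp.symm.trans hq)]

theorem IsVal.add {f g : RatFunc K} {x y : K} (h : IsVal c f x) (h' : IsVal c g y) :
    IsVal c (f + g) (x + y) := by
  obtain ⟨p, hp, rfl⟩ := h
  obtain ⟨q, hq, rfl⟩ := h'
  exact ⟨p + q, by rw [map_add, map_add, hp, hq], map_add _ _ _⟩

theorem IsVal.mul {f g : RatFunc K} {x y : K} (h : IsVal c f x) (h' : IsVal c g y) :
    IsVal c (f * g) (x * y) := by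
  obtain ⟨p, hp, rfl⟩ := h
  obtain ⟨q, hq, rfl⟩ := h'
  exact ⟨p * q, by rw [map_mul, map_mul, hp, hq], map_mul _ _ _⟩

theorem IsVal.C_mul {f : RatFunc K} {y : K} (x : K) (h : IsVal c f y) :
    IsVal c (RatFunc.C x * f) (x * y) := (isVal_C c x).mul h

theorem IsVal.neg {f : RatFunc K} {x : K} (h : IsVal c f x) : IsVal c (-f) (-x) :=
  (h.C_mul (-1)).congr (by simp) (by simp)

theorem IsVal.sub {f g : RatFunc K} {x y : K} (h : IsVal c f x) (h' : IsVal c g y) :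
    IsVal c (f - g) (x - y) :=
  (h.add h'.neg).congr (sub_eq_add_neg _ _).symm (sub_eq_add_neg _ _).symm

theorem IsVal.pow {f : RatFunc K} {x : K} (h : IsVal c f x) (n : ℕ) : IsVal c (f ^ n) (x ^ n) := by
  induction n with
  | zero => simpa using isVal_one c
  | succ n ih => rw [pow_succ, pow_succ]; exact ih.mul h

theorem isVal_sum {ι : Type*} (s : Finset ι) {f : ι → RatFunc K} {x : ι → K}
    (h : ∀ i ∈ s, IsVal c (f i) (x i)) : IsVal c (∑ i ∈ s, f i) (∑ i ∈ s, x i) := by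
  classical
  induction s using Finset.induction_on with
  | empty => simpa using isVal_zero c
  | insert i s hi ih =>
    rw [Finset.sum_insert hi, Finset.sum_insert hi]
    exact (h i (by simp)).add (ih fun j hj => h j (by simp [hj]))

theorem IsVal.inv {f : RatFunc K} {x : K} (h : IsVal c f x) (hx : x ≠ 0) : IsVal c f⁻¹ x⁻¹ := by
  obtain ⟨p, hp, rfl⟩ := h
  refine ⟨p⁻¹, ?_, by simp⟩
  have h1 : laurentAt c f * HahnSeries.ofPowerSeries ℤ K p⁻¹ = 1 := by
    rw [hp, ← map_mul, PowerSeries.mul_inv_cancel _ hx, map_one]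
  have h2 : laurentAt c f ≠ 0 := left_ne_zero_of_mul_eq_one h1
  rw [map_inv₀]
  exact (eq_inv_of_mul_eq_one_right h1).symm

theorem isVal_pole {c c' : K} (h : c ≠ c') : IsVal c (pole c') (c - c')⁻¹ :=
  (isVal_localParam c c').inv (sub_ne_zero.mpr h)

theorem localParam_mul_pole (c : K) : localParam c * pole c = 1 :=
  mul_inv_cancel₀ (localParam_ne_zero c)

theorem localParam_pow_mul_pole_pow (c : K) (n : ℕ) : localParam c ^ n * pole c ^ n = 1 := by
  rw [← mul_pow, localParam_mul_pole, one_pow]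

theorem exists_isVal_of_mem_localRing {f : RatFunc K} (hf : f ∈ localRing c) :
    ∃ x, IsVal c f x := by
  have h : ∀ p : Polynomial K, IsVal c (algebraMap _ (RatFunc K) p) (p.eval c) := fun p =>
    ⟨_, laurentAt_algebraMap c p, by
      simp only [Polynomial.coe_eval₂RingHom, Polynomial.eval₂_eq_sum, Polynomial.eval_eq_sum,
        Polynomial.sum, map_sum]
      simp⟩
  obtain ⟨p, q, hq, rfl⟩ := hf
  rw [div_eq_mul_inv]
  exact ⟨_, (h p).mul ((h q).inv hq)⟩

/-- A power series without constant term is divisible by the variable. This is the step by which a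
vanishing leading coefficient lowers a pole order by one. -/
theorem IsVal.exists_of_mul_localParam {f : RatFunc K} (h : IsVal c (localParam c * f) 0) :
    ∃ x, IsVal c f x := by
  obtain ⟨p, hp, h0⟩ := h
  obtain ⟨q, rfl⟩ := PowerSeries.X_dvd_iff.mpr h0
  refine ⟨_, q, ?_, rfl⟩
  rw [map_mul, map_mul, laurentAt_localParam, sub_self, map_zero, add_zero] at hp
  refine mul_left_cancel₀ ?_ hp
  rw [map_ne_zero_iff _ HahnSeries.ofPowerSeries_injective]
  exact PowerSeries.X_ne_zero

theorem isVal_localParam_pow_mul_of_lt {f : RatFunc K} {x : K} {n n' : ℕ}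
    (h : IsVal c (localParam c ^ n * f) x) (hn : n < n') : IsVal c (localParam c ^ n' * f) 0 := by
  obtain ⟨d, rfl⟩ := Nat.exists_eq_add_of_lt hn
  refine (((isVal_localParam_self c).pow (d + 1)).mul h).congr ?_ (by simp)
  ring

theorem exists_isVal_of_le {f : RatFunc K} {x : K} {n n' : ℕ}
    (h : IsVal c (localParam c ^ n * f) x) (hn : n ≤ n') :
    ∃ y, IsVal c (localParam c ^ n' * f) y := by
  rcases hn.eq_or_lt with rfl | hn
  · exact ⟨x, h⟩
  · exact ⟨0, isVal_localParam_pow_mul_of_lt h hn⟩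

theorem IsVal.coef_eq {f : RatFunc K} {x : K} {n : ℕ} (h : IsVal c (localParam c ^ n * f) x) :
    coef c n f = x := by
  obtain ⟨p, hp, rfl⟩ := h
  have h1 : laurentAt c (localParam c) = HahnSeries.single 1 1 := by
    rw [laurentAt_localParam, sub_self, map_zero, add_zero, HahnSeries.ofPowerSeries_X]
  have h2 : (HahnSeries.single (n : ℤ) (1 : K)) * laurentAt c f = HahnSeries.ofPowerSeries ℤ K p := by
    rw [← hp, map_mul, map_pow, h1, HahnSeries.single_pow]
    simp
  have h3 := congrArg (fun s : LaurentSeries K => s.coeff 0) h2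
  have h4 := HahnSeries.coeff_single_mul_add (r := (1 : K)) (x := laurentAt c f) (a := -(n : ℤ)) (b := n)
  rw [neg_add_cancel, one_mul] at h4
  simp only [h4] at h3
  refine h3.trans ?_
  rw [show (0 : ℤ) = ((0 : ℕ) : ℤ) from rfl]
  exact (HahnSeries.ofPowerSeries_apply_coeff p 0).trans (by simp)

theorem coef_eq_zero_of_lt {f : RatFunc K} {x : K} {n n' : ℕ}
    (h : IsVal c (localParam c ^ n * f) x) (hn : n < n') : coef c n' f = 0 :=
  (isVal_localParam_pow_mul_of_lt h hn).coef_eq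

theorem exists_pow_isVal (c : K) (f : RatFunc K) : ∃ n x, IsVal c (localParam c ^ n * f) x := by
  -- The exponent |ord f| works for poles and zeros alike: ord f + |ord f| ≥ 0, so the product is a
  -- power series shifted by this amount.
  refine ⟨(laurentAt c f).order.natAbs, _, PowerSeries.X ^ ((laurentAt c f).order +
    (laurentAt c f).order.natAbs).toNat * (laurentAt c f).powerSeriesPart, ?_, rfl⟩
  rw [map_mul, map_pow, laurentAt_localParam, sub_self, map_zero, add_zero, map_mul, map_pow,
    LaurentSeries.ofPowerSeries_powerSeriesPart, HahnSeries.ofPowerSeries_X, HahnSeries.single_pow,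
    HahnSeries.single_pow, ← mul_assoc, HahnSeries.single_mul_single]
  congr 2
  · simp only [nsmul_eq_mul, mul_one]
    congr 1
    omega
  · simp

end LaurentExpansion

/-! ### Partial fractions on the projective line -/

section PartialFractions

variable {K : Type*} [Field K] {N : ℕ}

theorem coef_C (c x : K) {n : ℕ} (hn : 1 ≤ n) : coef c n (RatFunc.C x) = 0 :=
  coef_eq_zero_of_lt (n := 0) ((isVal_C c x).congr (by simp) rfl) hn

theorem coef_pole_pow (c : K) (n l : ℕ) : coef c n (pole c ^ l) = if n = l then 1 else 0 := by
  have h : laurentAt c (pole c ^ l) = HahnSeries.single (-(l : ℤ)) 1 := by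
    rw [pole, map_pow, map_inv₀, laurentAt_localParam, sub_self, map_zero, add_zero,
      HahnSeries.ofPowerSeries_X, HahnSeries.inv_single, HahnSeries.single_pow]
    simp
  change (laurentAt c (pole c ^ l)).coeff (-n) = _
  rw [h, HahnSeries.coeff_single]
  simp

theorem coef_pole_pow_of_ne {c c' : K} (h : c ≠ c') {n : ℕ} (hn : 1 ≤ n) (l : ℕ) :
    coef c n (pole c' ^ l) = 0 :=
  coef_eq_zero_of_lt (n := 0) (((isVal_pole h).pow l).congr (by simp) rfl) hn

theorem ddt_localParam (c : K) : ddt K (localParam c) = 1 := by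
  rw [localParam, map_sub, ddt_X, ddt_C, sub_zero]

theorem ddt_pole_pow (c : K) (s : ℕ) : ddt K (pole c ^ s) = -(s : RatFunc K) * pole c ^ (s + 1) := by
  rcases s with _ | s
  · simp
  · rw [Derivation.leibniz_pow, pole, Derivation.leibniz_inv, ddt_localParam]
    simp only [smul_eq_mul, nsmul_eq_mul]
    simp only [Nat.add_sub_cancel]
    ring

theorem pole_mul_pole {c c' : K} (h : c ≠ c') :
    pole c * pole c' = RatFunc.C (c - c')⁻¹ * (pole c - pole c') := by
  have h1 := localParam_ne_zero c
  have h2 := localParam_ne_zero c'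
  have h3 : RatFunc.C (c - c') ≠ 0 := by
    rw [map_ne_zero]; exact sub_ne_zero.mpr h
  rw [map_inv₀, pole, pole]
  field_simp
  simp [localParam]

/-- The functions spanned by `1` and the `1 / (t - a_i) ^ s`. -/
def polarFunctions (a : Fin N → K) : Submodule K (RatFunc K) :=
  Submodule.span K ({1} ∪ {x | ∃ i s, 1 ≤ s ∧ x = pole (a i) ^ s})

/-- The functions spanned by the `1 / (t - a_i) ^ s` with `s ≥ 2` and the
`1 / (t - a_i) - 1 / (t - a_j)`. -/
def formFunctions (a : Fin N → K) : Submodule K (RatFunc K) :=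
  Submodule.span K ({x | ∃ i s, 2 ≤ s ∧ x = pole (a i) ^ s} ∪
    {x | ∃ i j, x = pole (a i) - pole (a j)})

variable {a : Fin N → K}

theorem pole_pow_mem_formFunctions (i : Fin N) {s : ℕ} (hs : 2 ≤ s) :
    pole (a i) ^ s ∈ formFunctions a := Submodule.subset_span (Or.inl ⟨i, s, hs, rfl⟩)

theorem pole_sub_mem_formFunctions (i j : Fin N) : pole (a i) - pole (a j) ∈ formFunctions a :=
  Submodule.subset_span (Or.inr ⟨i, j, rfl⟩)

theorem pole_pow_mem_polarFunctions (i : Fin N) (s : ℕ) : pole (a i) ^ s ∈ polarFunctions a := by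
  rcases s with _ | s
  · exact Submodule.subset_span (Or.inl (by simp))
  · exact Submodule.subset_span (Or.inr ⟨i, s + 1, by omega, rfl⟩)

theorem formFunctions_le_polarFunctions : formFunctions a ≤ polarFunctions a := by
  refine Submodule.span_le.mpr ?_
  rintro _ (⟨i, s, -, rfl⟩ | ⟨i, j, rfl⟩)
  · exact pole_pow_mem_polarFunctions i s
  · refine sub_mem ?_ ?_
    · simpa using pole_pow_mem_polarFunctions (a := a) i 1
    · simpa using pole_pow_mem_polarFunctions (a := a) j 1

theorem C_mul_mem {U : Submodule K (RatFunc K)} (c : K) {f : RatFunc K} (hf : f ∈ U) :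
    RatFunc.C c * f ∈ U := by
  rw [← RatFunc.smul_eq_C_mul]
  exact U.smul_mem c hf

/-- A product of two poles vanishes doubly at infinity, so its multiple of dt is regular there. For
distinct points, `pole_mul_pole` lowers the exponent s until a difference of simple poles remains.
-/
theorem pole_mul_pole_pow_mem (ha : Function.Injective a) (i j : Fin N) {s : ℕ} (hs : 1 ≤ s) :
    pole (a j) * pole (a i) ^ s ∈ formFunctions a := by
  by_cases h : i = j
  · subst h
    rw [← pow_succ']
    exact pole_pow_mem_formFunctions _ (by omega)
  · induction s, hs using Nat.le_induction with
    | base =>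
      rw [pow_one, pole_mul_pole (ha.ne (Ne.symm h))]
      exact C_mul_mem _ (pole_sub_mem_formFunctions _ _)
    | succ s hs ih =>
      rw [pow_succ', ← mul_assoc, pole_mul_pole (ha.ne (Ne.symm h)), mul_assoc, sub_mul, ← pow_succ']
      exact C_mul_mem _ (sub_mem ih (pole_pow_mem_formFunctions _ (by omega)))

theorem pole_mul_mem_formFunctions (ha : Function.Injective a) (j : Fin N) {f : RatFunc K}
    (hf : f ∈ formFunctions a) : pole (a j) * f ∈ formFunctions a := by
  induction hf using Submodule.span_induction with
  | zero => simp
  | add x y _ _ hx hy => rw [mul_add]; exact add_mem hx hy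
  | smul c x _ hx => rw [mul_smul_comm]; exact Submodule.smul_mem _ _ hx
  | mem x hx =>
    rcases hx with ⟨i, s, hs, rfl⟩ | ⟨i, l, rfl⟩
    · exact pole_mul_pole_pow_mem ha _ _ (by omega)
    · rw [mul_sub]
      have h1 := pole_mul_pole_pow_mem ha i j le_rfl
      have h2 := pole_mul_pole_pow_mem ha l j le_rfl
      rw [pow_one] at h1 h2
      exact sub_mem h1 h2

theorem pole_mul_mem_polarFunctions (ha : Function.Injective a) (j : Fin N) {f : RatFunc K}
    (hf : f ∈ polarFunctions a) : pole (a j) * f ∈ polarFunctions a := by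
  induction hf using Submodule.span_induction with
  | zero => simp
  | add x y _ _ hx hy => rw [mul_add]; exact add_mem hx hy
  | smul c x _ hx => rw [mul_smul_comm]; exact Submodule.smul_mem _ _ hx
  | mem x hx =>
    rcases hx with hx | ⟨i, s, hs, rfl⟩
    · rw [Set.mem_singleton_iff] at hx
      subst hx
      simpa using pole_pow_mem_polarFunctions (a := a) j 1
    · exact formFunctions_le_polarFunctions (pole_mul_pole_pow_mem ha _ _ hs)

theorem regular_mul_mem {U : Submodule K (RatFunc K)}
    (hU : ∀ j, ∀ f ∈ U, pole (a j) * f ∈ U) {g : RatFunc K} (hg : g ∈ regularFunctions a) :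
    ∀ f ∈ U, g * f ∈ U := by
  induction hg using Algebra.adjoin_induction with
  | mem x hx => obtain ⟨i, rfl⟩ := hx; exact hU i
  | algebraMap r =>
    intro f hf
    rw [← Algebra.smul_def]
    exact U.smul_mem r hf
  | add x y _ _ hx hy => intro f hf; rw [add_mul]; exact add_mem (hx f hf) (hy f hf)
  | mul x y _ _ hx hy => intro f hf; rw [mul_assoc]; exact hx _ (hy f hf)

theorem regularFunctions_le_polarFunctions (ha : Function.Injective a) {f : RatFunc K}
    (hf : f ∈ regularFunctions a) : f ∈ polarFunctions a := by
  have h := regular_mul_mem (fun j _ => pole_mul_mem_polarFunctions ha j) hf 1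
    (Submodule.subset_span (Or.inl rfl))
  rwa [mul_one] at h

theorem regular_mul_mem_formFunctions (ha : Function.Injective a) {g f : RatFunc K}
    (hg : g ∈ regularFunctions a) (hf : f ∈ formFunctions a) : g * f ∈ formFunctions a :=
  regular_mul_mem (fun j _ => pole_mul_mem_formFunctions ha j) hg f hf

theorem polarFunctions_le_regularFunctions {f : RatFunc K}
    (hf : f ∈ polarFunctions a) : f ∈ regularFunctions a := by
  induction hf using Submodule.span_induction with
  | zero => exact zero_mem _
  | add x y _ _ hx hy => exact add_mem hx hy
  | smul c x _ hx => exact Subalgebra.smul_mem _ hx c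
  | mem x hx =>
    rcases hx with hx | ⟨i, s, hs, rfl⟩
    · rw [Set.mem_singleton_iff] at hx
      subst hx
      exact one_mem _
    · exact pow_mem (pole_mem a i) s

theorem ddt_mem_formFunctions (ha : Function.Injective a) {f : RatFunc K}
    (hf : f ∈ regularFunctions a) : ddt K f ∈ formFunctions a := by
  have h := regularFunctions_le_polarFunctions ha hf
  induction h using Submodule.span_induction with
  | zero => simp
  | add x y hx' hy' hx hy =>
    rw [map_add]
    exact add_mem (hx (polarFunctions_le_regularFunctions hx'))
      (hy (polarFunctions_le_regularFunctions hy'))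
  | smul c x hx' hx =>
    rw [Derivation.map_smul]
    exact Submodule.smul_mem _ _ (hx (polarFunctions_le_regularFunctions hx'))
  | mem x hx =>
    rcases hx with hx | ⟨i, s, hs, rfl⟩
    · rw [Set.mem_singleton_iff] at hx
      subst hx
      simp
    · rw [ddt_pole_pow]
      have := C_mul_mem (-(s : K)) (pole_pow_mem_formFunctions (a := a) i (s := s + 1) (by omega))
      simpa using this

theorem coef_pole_pow_eq (ha : Function.Injective a) (i j : Fin N) {n : ℕ} (hn : 1 ≤ n) (l : ℕ) :
    coef (a i) n (pole (a j) ^ l) = if i = j ∧ n = l then 1 else 0 := by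
  by_cases h : i = j
  · subst h; simp [coef_pole_pow]
  · simp [h, coef_pole_pow_of_ne (ha.ne h) hn]

/-- The sum of the polar parts of order at most `S` of a function. -/
def polarSum (a : Fin N → K) (S : Fin N → ℕ) (f : RatFunc K) : RatFunc K :=
  ∑ i, ∑ s ∈ Finset.Icc 1 (S i), RatFunc.C (coef (a i) s f) * pole (a i) ^ s

theorem polarSum_add (S : Fin N → ℕ) (f g : RatFunc K) :
    polarSum a S (f + g) = polarSum a S f + polarSum a S g := by
  simp only [polarSum, map_add, add_mul, Finset.sum_add_distrib]

theorem polarSum_smul (S : Fin N → ℕ) (c : K) (f : RatFunc K) :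
    polarSum a S (c • f) = c • polarSum a S f := by
  simp only [polarSum, map_smul, smul_eq_mul, map_mul, mul_assoc]
  simp only [RatFunc.smul_eq_C_mul, Finset.mul_sum]

theorem polarSum_pole_pow (ha : Function.Injective a) {S : Fin N → ℕ} {j : Fin N} {l : ℕ}
    (hl : 1 ≤ l) (hS : l ≤ S j) : polarSum a S (pole (a j) ^ l) = pole (a j) ^ l := by
  rw [polarSum, Finset.sum_eq_single j, Finset.sum_eq_single l]
  · rw [coef_pole_pow_eq ha j j hl]; simp
  · intro s hs hsl
    rw [coef_pole_pow_eq ha j j (Finset.mem_Icc.mp hs).1]; simp [hsl]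
  · intro h; exact absurd (Finset.mem_Icc.mpr ⟨hl, hS⟩) h
  · intro i _ hij
    refine Finset.sum_eq_zero fun s hs => ?_
    rw [coef_pole_pow_eq ha i j (Finset.mem_Icc.mp hs).1]; simp [hij]
  · simp

/-- The expansion is claimed for every sufficiently large cutoff, because in this form it is
additive and passes through the induction over the span. -/
theorem exists_polarSum (ha : Function.Injective a) {f : RatFunc K} (hf : f ∈ regularFunctions a) :
    ∃ x n, ∀ S : Fin N → ℕ, (∀ i, n ≤ S i) → f = RatFunc.C x + polarSum a S f := by
  have h := regularFunctions_le_polarFunctions ha hf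
  clear hf
  induction h using Submodule.span_induction with
  | zero => exact ⟨0, 0, fun S _ => by simp [polarSum]⟩
  | add f g _ _ hf hg =>
    obtain ⟨x, n, h⟩ := hf
    obtain ⟨y, n', h'⟩ := hg
    refine ⟨x + y, max n n', fun S hS => ?_⟩
    rw [polarSum_add, map_add, add_add_add_comm,
      ← h S fun i => (le_max_left _ _).trans (hS i),
      ← h' S fun i => (le_max_right _ _).trans (hS i)]
  | smul c f _ hf =>
    obtain ⟨x, n, h⟩ := hf
    refine ⟨c * x, n, fun S hS => ?_⟩
    rw [polarSum_smul, map_mul, ← RatFunc.smul_eq_C_mul, ← smul_add, ← h S hS]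
  | mem f hf =>
    rcases hf with hf | ⟨i, s, hs, rfl⟩
    · rw [Set.mem_singleton_iff] at hf
      subst hf
      refine ⟨1, 0, fun S _ => ?_⟩
      rw [polarSum, Finset.sum_eq_zero, map_one, add_zero]
      refine fun i _ => Finset.sum_eq_zero fun s hs => ?_
      have := coef_C (a i) 1 (Finset.mem_Icc.mp hs).1
      rw [map_one] at this
      simp [this]
    · exact ⟨0, s, fun S hS => by rw [polarSum_pole_pow ha hs (hS i), map_zero, zero_add]⟩

theorem polarSum_congr {S S' : Fin N → ℕ} {f : RatFunc K} (hS : ∀ i, S i ≤ S' i)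
    (h : ∀ i, ∃ x, IsVal (a i) (localParam (a i) ^ S i * f) x) :
    polarSum a S f = polarSum a S' f := by
  refine Finset.sum_congr rfl fun i _ => Finset.sum_subset
    (Finset.Icc_subset_Icc_right (hS i)) fun s hs hs' => ?_
  obtain ⟨x, hx⟩ := h i
  have hlt : S i < s := by
    by_contra hlt
    exact hs' (Finset.mem_Icc.mpr ⟨(Finset.mem_Icc.mp hs).1, not_lt.mp hlt⟩)
  rw [coef_eq_zero_of_lt hx hlt]
  simp

theorem eq_C_add_polarSum (ha : Function.Injective a) {f : RatFunc K}
    (hf : f ∈ regularFunctions a) {S : Fin N → ℕ}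
    (h : ∀ i, ∃ x, IsVal (a i) (localParam (a i) ^ S i * f) x) :
    ∃ x, f = RatFunc.C x + polarSum a S f := by
  obtain ⟨x, n, hx⟩ := exists_polarSum ha hf
  refine ⟨x, ?_⟩
  rw [polarSum_congr (S' := fun i => max n (S i)) (fun i => le_max_right _ _) h]
  exact hx _ fun i => le_max_left _ _

/-- Regularity of f dt at infinity, where dt has a double pole, leaves no constant term in f and
makes the residues sum to zero. Both are linear conditions, checked on the spanning functions. -/
theorem formFunctions_polarSum (ha : Function.Injective a) {f : RatFunc K}
    (hf : f ∈ formFunctions a) {S : Fin N → ℕ}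
    (h : ∀ i, ∃ x, IsVal (a i) (localParam (a i) ^ S i * f) x) :
    f = polarSum a S f ∧ ∑ i, coef (a i) 1 f = 0 := by
  have key : ∃ n, (∀ S : Fin N → ℕ, (∀ i, n ≤ S i) → f = polarSum a S f) ∧
      ∑ i, coef (a i) 1 f = 0 := by
    clear h
    induction hf using Submodule.span_induction with
    | zero => exact ⟨0, fun S _ => by simp [polarSum], by simp⟩
    | add f g _ _ hf hg =>
      obtain ⟨n, h, h1⟩ := hf
      obtain ⟨n', h', h1'⟩ := hg
      refine ⟨max n n', fun S hS => ?_, ?_⟩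
      · rw [polarSum_add, ← h S fun i => (le_max_left _ _).trans (hS i),
          ← h' S fun i => (le_max_right _ _).trans (hS i)]
      · simp only [map_add, Finset.sum_add_distrib, h1, h1', add_zero]
    | smul c f _ hf =>
      obtain ⟨n, h, h1⟩ := hf
      refine ⟨n, fun S hS => ?_, ?_⟩
      · rw [polarSum_smul, ← h S hS]
      · simp only [map_smul, ← Finset.smul_sum, h1, smul_zero]
    | mem f hf =>
      rcases hf with ⟨i, s, hs, rfl⟩ | ⟨i, j, rfl⟩
      · refine ⟨s, fun S hS => by rw [polarSum_pole_pow ha (by omega) (hS i)], ?_⟩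
        refine Finset.sum_eq_zero fun l _ => ?_
        rw [coef_pole_pow_eq ha l i le_rfl, if_neg (by omega)]
      · have h1 : ∀ i : Fin N, ∑ l, coef (a l) 1 (pole (a i)) = 1 := by
          intro i
          have := fun l => coef_pole_pow_eq ha l i le_rfl 1
          simp only [pow_one, and_true] at this
          simp [this]
        refine ⟨1, fun S hS => ?_, ?_⟩
        · have h2 : ∀ i : Fin N, polarSum a S (pole (a i)) = pole (a i) := fun i => by
            simpa using polarSum_pole_pow ha (j := i) le_rfl (hS i)
          rw [sub_eq_add_neg, ← neg_one_smul K, polarSum_add, polarSum_smul, h2, h2]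
        · simp only [map_sub, Finset.sum_sub_distrib, h1, sub_self]
  obtain ⟨n, hn, h1⟩ := key
  refine ⟨?_, h1⟩
  rw [polarSum_congr (S' := fun i => max n (S i)) (fun i => le_max_right _ _) h]
  exact hn _ fun i => le_max_left _ _

end PartialFractions

/-! ### Relative forms as functions times dt -/

section RelativeForms

variable {K : Type*} [Field K] {N : ℕ} {a : Fin N → K}

/-- The function `f` such that a relative form equals `f dt`. -/
def relCoef (a : Fin N → K) : relForms a →ₗ[K] RatFunc K where
  toFun y := pairing (ddt K) (y : Ω[RatFunc K⁄K])
  map_add' x y := by simp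
  map_smul' c x := by
    rw [Submodule.coe_smul_of_tower, ← algebraMap_smul (RatFunc K) c, map_smul, RingHom.id_apply,
      algebraMap_smul]

theorem relCoef_injective : Function.Injective (relCoef a) := fun _ _ h =>
  Subtype.ext (relForm_ext h)

theorem relCoef_smul (f : regularFunctions a) (y : relForms a) :
    relCoef a (f • y) = f * relCoef a y :=
  map_smul (pairing (ddt K)) (f : RatFunc K) (y : Ω[RatFunc K⁄K])

theorem relCoef_relDiff (f : regularFunctions a) : relCoef a (relDiff a f) = ddt K f :=
  Derivation.liftKaehlerDifferential_comp_D _ _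

theorem relCoef_polarForm (i : Fin N) (s : ℕ) (hs : 2 ≤ s) :
    relCoef a (polarForm a i s hs) = pole (a i) ^ s := by
  change pairing (ddt K) (pole (a i) ^ s • KaehlerDifferential.D K (RatFunc K) RatFunc.X) = _
  simp [ddt_X]

theorem relCoef_simpleForm (i j : Fin N) :
    relCoef a (simpleForm a i j) = pole (a i) - pole (a j) := by
  change pairing (ddt K)
    ((pole (a i) - pole (a j)) • KaehlerDifferential.D K (RatFunc K) RatFunc.X) = _
  simp [ddt_X]

theorem relCoef_mem (ha : Function.Injective a) (y : relForms a) :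
    relCoef a y ∈ formFunctions a := by
  obtain ⟨y, hy⟩ := y
  change pairing (ddt K) y ∈ _
  rw [relForms] at hy
  induction hy using Submodule.span_induction with
  | zero => simp
  | add x y _ _ hx hy => rw [map_add]; exact add_mem hx hy
  | smul c x _ hx =>
    have : pairing (ddt K) (c • x) = c * pairing (ddt K) x :=
      map_smul (pairing (ddt K)) (c : RatFunc K) x
    rw [this]
    exact regular_mul_mem_formFunctions ha c.2 hx
  | mem x hx =>
    obtain ⟨f, rfl⟩ := hx
    rw [pairing, Derivation.liftKaehlerDifferential_comp_D]
    exact ddt_mem_formFunctions ha f.2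

theorem relCoef_toRel {k : Type*} [Field k] [Algebra k K] (x : absForms k a) :
    relCoef a (toRel a x) = pairing ((ddt K).restrictScalars k) (x : Ω[RatFunc K⁄k]) :=
  pairing_map _

end RelativeForms

/-! ### Values and pole orders of vectors and matrices -/

section Values

variable {K : Type*} [Field K] {r : ℕ} {c : K}

/-- Values of vectors of rational functions. -/
def VecVal (c : K) (f : Fin r → RatFunc K) (x : Fin r → K) : Prop := ∀ μ, IsVal c (f μ) (x μ)

/-- Values of matrices of rational functions. -/
def MatVal (c : K) (f : Matrix (Fin r) (Fin r) (RatFunc K)) (x : Matrix (Fin r) (Fin r) K) : Prop :=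
  ∀ μ ν, IsVal c (f μ ν) (x μ ν)

/-- All entries of `f` have a pole of order at most `n` at `c`. -/
def PoleOrderLE (c : K) (n : ℕ) (f : Fin r → RatFunc K) : Prop :=
  ∃ x, VecVal c (localParam c ^ n • f) x

theorem VecVal.congr {f g : Fin r → RatFunc K} {x y : Fin r → K} (h : VecVal c f x) (hf : f = g)
    (hx : x = y) : VecVal c g y := hf ▸ hx ▸ h

theorem VecVal.unique {f : Fin r → RatFunc K} {x y : Fin r → K} (h : VecVal c f x)
    (h' : VecVal c f y) : x = y := funext fun μ => (h μ).unique (h' μ)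

theorem VecVal.add {f g : Fin r → RatFunc K} {x y : Fin r → K} (h : VecVal c f x)
    (h' : VecVal c g y) : VecVal c (f + g) (x + y) := fun μ => (h μ).add (h' μ)

theorem VecVal.sub {f g : Fin r → RatFunc K} {x y : Fin r → K} (h : VecVal c f x)
    (h' : VecVal c g y) : VecVal c (f - g) (x - y) := fun μ => (h μ).sub (h' μ)

theorem VecVal.smul {f : RatFunc K} {g : Fin r → RatFunc K} {x : K} {y : Fin r → K}
    (h : IsVal c f x) (h' : VecVal c g y) : VecVal c (f • g) (x • y) := fun μ => h.mul (h' μ)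

theorem vecVal_zero (c : K) : VecVal c (0 : Fin r → RatFunc K) 0 := fun _ => isVal_zero c

theorem vecVal_C (c : K) (x : Fin r → K) : VecVal c (RatFunc.C ∘ x) x := fun _ => isVal_C c _

theorem vecVal_sum {ι : Type*} (s : Finset ι) {f : ι → Fin r → RatFunc K} {x : ι → Fin r → K}
    (h : ∀ i ∈ s, VecVal c (f i) (x i)) : VecVal c (∑ i ∈ s, f i) (∑ i ∈ s, x i) := by
  intro μ
  rw [Finset.sum_apply, Finset.sum_apply]
  exact isVal_sum s fun i hi => h i hi μ

theorem MatVal.congr {f g : Matrix (Fin r) (Fin r) (RatFunc K)} {x y : Matrix (Fin r) (Fin r) K}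
    (h : MatVal c f x) (hf : f = g) (hx : x = y) : MatVal c g y := hf ▸ hx ▸ h

theorem MatVal.unique {f : Matrix (Fin r) (Fin r) (RatFunc K)} {x y : Matrix (Fin r) (Fin r) K}
    (h : MatVal c f x) (h' : MatVal c f y) : x = y :=
  Matrix.ext fun μ ν => (h μ ν).unique (h' μ ν)

theorem MatVal.add {f g : Matrix (Fin r) (Fin r) (RatFunc K)} {x y : Matrix (Fin r) (Fin r) K}
    (h : MatVal c f x) (h' : MatVal c g y) : MatVal c (f + g) (x + y) :=
  fun μ ν => (h μ ν).add (h' μ ν)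

theorem MatVal.sub {f g : Matrix (Fin r) (Fin r) (RatFunc K)} {x y : Matrix (Fin r) (Fin r) K}
    (h : MatVal c f x) (h' : MatVal c g y) : MatVal c (f - g) (x - y) :=
  fun μ ν => (h μ ν).sub (h' μ ν)

theorem MatVal.smul {f : RatFunc K} {g : Matrix (Fin r) (Fin r) (RatFunc K)} {x : K}
    {y : Matrix (Fin r) (Fin r) K} (h : IsVal c f x) (h' : MatVal c g y) :
    MatVal c (f • g) (x • y) := fun μ ν => h.mul (h' μ ν)

theorem matVal_C (c : K) (x : Matrix (Fin r) (Fin r) K) : MatVal c (x.map RatFunc.C) x :=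
  fun _ _ => isVal_C c _

theorem matVal_one (c : K) : MatVal c (1 : Matrix (Fin r) (Fin r) (RatFunc K)) 1 :=
  (matVal_C c 1).congr (by simp) rfl

theorem matVal_sum {ι : Type*} (s : Finset ι) {f : ι → Matrix (Fin r) (Fin r) (RatFunc K)}
    {x : ι → Matrix (Fin r) (Fin r) K}
    (h : ∀ i ∈ s, MatVal c (f i) (x i)) : MatVal c (∑ i ∈ s, f i) (∑ i ∈ s, x i) := by
  intro μ ν
  rw [Matrix.sum_apply, Matrix.sum_apply]
  exact isVal_sum s fun i hi => h i hi μ ν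

theorem MatVal.mul {f g : Matrix (Fin r) (Fin r) (RatFunc K)} {x y : Matrix (Fin r) (Fin r) K}
    (h : MatVal c f x) (h' : MatVal c g y) : MatVal c (f * g) (x * y) := by
  intro μ ν
  rw [Matrix.mul_apply, Matrix.mul_apply]
  exact isVal_sum _ fun i _ => (h μ i).mul (h' i ν)

theorem MatVal.mulVec {f : Matrix (Fin r) (Fin r) (RatFunc K)} {g : Fin r → RatFunc K}
    {x : Matrix (Fin r) (Fin r) K} {y : Fin r → K}
    (h : MatVal c f x) (h' : VecVal c g y) : VecVal c (f.mulVec g) (x.mulVec y) := by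
  intro μ
  simp only [Matrix.mulVec, dotProduct]
  exact isVal_sum _ fun i _ => (h μ i).mul (h' i)

theorem MatVal.trace {f : Matrix (Fin r) (Fin r) (RatFunc K)} {x : Matrix (Fin r) (Fin r) K}
    (h : MatVal c f x) : IsVal c f.trace x.trace := isVal_sum _ fun i _ => h i i

theorem VecVal.of_lt {f : Fin r → RatFunc K} {x : Fin r → K} {n n' : ℕ}
    (h : VecVal c (localParam c ^ n • f) x) (hn : n < n') : VecVal c (localParam c ^ n' • f) 0 :=
  fun μ => isVal_localParam_pow_mul_of_lt (h μ) hn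

theorem PoleOrderLE.mono {f : Fin r → RatFunc K} {n n' : ℕ} (h : PoleOrderLE c n f)
    (hn : n ≤ n') : PoleOrderLE c n' f := by
  rcases hn.eq_or_lt with rfl | hn
  · exact h
  · exact ⟨0, h.choose_spec.of_lt hn⟩

theorem PoleOrderLE.add {f g : Fin r → RatFunc K} {n : ℕ} (h : PoleOrderLE c n f)
    (h' : PoleOrderLE c n g) : PoleOrderLE c n (f + g) := by
  obtain ⟨x, hx⟩ := h
  obtain ⟨y, hy⟩ := h'
  exact ⟨x + y, by rw [smul_add]; exact hx.add hy⟩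

theorem PoleOrderLE.sub {f g : Fin r → RatFunc K} {n : ℕ} (h : PoleOrderLE c n f)
    (h' : PoleOrderLE c n g) : PoleOrderLE c n (f - g) := by
  obtain ⟨x, hx⟩ := h
  obtain ⟨y, hy⟩ := h'
  exact ⟨x - y, by rw [smul_sub]; exact hx.sub hy⟩

theorem PoleOrderLE.const_smul {f : Fin r → RatFunc K} {n : ℕ} (x : K) (h : PoleOrderLE c n f) :
    PoleOrderLE c n (x • f) := by
  obtain ⟨y, hy⟩ := h
  refine ⟨x • y, ((hy.smul (isVal_C c x)).congr ?_ rfl)⟩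
  funext μ
  simp [RatFunc.smul_eq_C_mul, mul_left_comm]

theorem poleOrderLE_zero (c : K) (n : ℕ) : PoleOrderLE c n (0 : Fin r → RatFunc K) :=
  ⟨0, (vecVal_zero c).congr (by simp) rfl⟩

theorem VecVal.poleOrderLE {f : Fin r → RatFunc K} {x : Fin r → K} (h : VecVal c f x) :
    PoleOrderLE c 0 f := ⟨x, h.congr (by simp) rfl⟩

theorem PoleOrderLE.of_zero {f : Fin r → RatFunc K} {n : ℕ}
    (h : VecVal c (localParam c ^ (n + 1) • f) 0) : PoleOrderLE c n f := by
  have h' : ∀ μ, ∃ x, IsVal c (localParam c ^ n * f μ) x := fun μ =>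
    IsVal.exists_of_mul_localParam ((h μ).congr (by simp only [Pi.smul_apply, smul_eq_mul]; ring) rfl)
  choose x hx using h'
  exact ⟨x, hx⟩

theorem exists_poleOrderLE (c : K) (f : Fin r → RatFunc K) : ∃ n, PoleOrderLE c n f := by
  choose n x h using fun μ => exists_pow_isVal c (f μ)
  choose y hy using fun μ => exists_isVal_of_le (h μ) (Finset.le_sup (f := n) (Finset.mem_univ μ))
  exact ⟨_, y, hy⟩

end Values

/-! ### The action of ε d + γ_K on leading terms -/

section Operators

variable {k K : Type*} [Field k] [Field K] [Algebra k K] {N r : ℕ} {a : Fin N → K}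

/-- The vector of rational functions given by a section of `E(*D)`. -/
def secVec (a : Fin N → K) (r : ℕ) : Sections a r →ₗ[K] (Fin r → RatFunc K) :=
  (regularFunctions a).val.toLinearMap.compLeft (Fin r)

/-- The vector of rational functions `f` such that a section of `E ⊗ ω(*D)` equals `f dt`. -/
def relVec (a : Fin N → K) (r : ℕ) : FormSections a r →ₗ[K] (Fin r → RatFunc K) :=
  (relCoef a).compLeft (Fin r)

theorem secVec_apply (u : Sections a r) (μ : Fin r) : secVec a r u μ = u μ := rfl

theorem relVec_apply (w : FormSections a r) (μ : Fin r) : relVec a r w μ = relCoef a (w μ) := rfl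

theorem secVec_injective : Function.Injective (secVec a r) := fun _ _ h =>
  funext fun μ => Subtype.ext (congrFun h μ)

theorem relVec_injective : Function.Injective (relVec a r) := fun _ _ h =>
  funext fun μ => relCoef_injective (congrFun h μ)

/-- The matrix `F` such that the relative connection is `d + F dt`. -/
def relMatrix (A : Matrix (Fin r) (Fin r) (absForms k a)) : Matrix (Fin r) (Fin r) (RatFunc K) :=
  fun μ ν => pairing ((ddt K).restrictScalars k) (A μ ν : Ω[RatFunc K⁄k])

/-- The relative `ε`-connection `ε d + γ_K`. -/
def epsConnection (A : Matrix (Fin r) (Fin r) (absForms k a)) (ε : K) :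
    Sections a r →ₗ[K] FormSections a r :=
  ε • (relDiff a).compLeft (Fin r) + higgsField A

theorem epsConnection_zero (A : Matrix (Fin r) (Fin r) (absForms k a)) :
    epsConnection A 0 = higgsField A := by simp [epsConnection]

theorem epsConnection_one (A : Matrix (Fin r) (Fin r) (absForms k a)) :
    epsConnection A 1 = relConnection A := by simp [epsConnection, relConnection]

theorem relVec_relDiff (u : Sections a r) :
    relVec a r ((relDiff a).compLeft (Fin r) u) = fun μ => ddt K (secVec a r u μ) :=
  funext fun μ => relCoef_relDiff (u μ)

theorem relVec_higgsField (A : Matrix (Fin r) (Fin r) (absForms k a)) (u : Sections a r) :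
    relVec a r (higgsField A u) = (relMatrix A).mulVec (secVec a r u) := by
  funext μ
  rw [relVec_apply]
  change relCoef a (∑ ν, u ν • toRel a (A μ ν)) = _
  rw [map_sum]
  refine Finset.sum_congr rfl fun ν _ => ?_
  rw [relCoef_smul, relCoef_toRel, mul_comm]
  rfl

theorem relVec_epsConnection (A : Matrix (Fin r) (Fin r) (absForms k a)) (ε : K)
    (u : Sections a r) : relVec a r (epsConnection A ε u) =
      ε • (fun μ => ddt K (secVec a r u μ)) + (relMatrix A).mulVec (secVec a r u) := by
  rw [epsConnection, LinearMap.add_apply, map_add, relVec_higgsField, LinearMap.smul_apply,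
    map_smul, relVec_relDiff]

/-- Termwise differentiation of the partial fraction expansion turns x z^(-n) into -n x z^(-n-1).
For n = 0 the value 0 records that a derivative has no simple pole. -/
theorem isVal_ddt (ha : Function.Injective a) {f : RatFunc K} (hf : f ∈ regularFunctions a)
    (i : Fin N) {n : ℕ} {x : K} (h : IsVal (a i) (localParam (a i) ^ n * f) x) :
    IsVal (a i) (localParam (a i) ^ (n + 1) * ddt K f) (-(n : K) * x) := by
  obtain ⟨x0, l, hl⟩ := exists_polarSum ha hf
  -- The cutoff at a_i can be reduced to n, as the coefficients of higher order vanish there; at the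
  -- other points it stays at l.
  have hf' : f = RatFunc.C x0 + polarSum a (fun j => if j = i then n else l) f := by
    conv_lhs => rw [hl (fun j => if j = i then max n l else l) fun j => by split_ifs <;> simp]
    congr 1
    refine Finset.sum_congr rfl fun j _ => ?_
    by_cases hj : j = i
    · subst hj
      simp only [if_true]
      symm
      refine Finset.sum_subset (Finset.Icc_subset_Icc_right (le_max_left _ _)) fun s hs hs' => ?_
      rw [coef_eq_zero_of_lt h (n' := s) (by
        rw [Finset.mem_Icc] at hs hs'; omega)]
      simp
    · simp [hj]
  have hd : ddt K f = ∑ j, ∑ s ∈ Finset.Icc 1 (if j = i then n else l),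
      RatFunc.C (-(s : K) * coef (a j) s f) * pole (a j) ^ (s + 1) := by
    conv_lhs => rw [hf', polarSum]
    rw [map_add, ddt_C, zero_add, map_sum]
    refine Finset.sum_congr rfl fun j _ => ?_
    rw [map_sum]
    refine Finset.sum_congr rfl fun s _ => ?_
    rw [Derivation.leibniz, ddt_C, ddt_pole_pow]
    simp only [smul_eq_mul, mul_zero, add_zero, map_mul, map_neg, map_natCast]
    ring
  have hz := isVal_localParam_self (a i)
  rw [hd, Finset.mul_sum]
  have hval : -(n : K) * x = ∑ j, if j = i then -(n : K) * x else 0 := by simp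
  rw [hval]
  refine isVal_sum _ fun j _ => ?_
  rw [Finset.mul_sum]
  by_cases hj : j = i
  · subst hj
    simp only [if_true]
    rcases n with _ | n
    · simpa using isVal_zero (a j)
    · have hx : -((n + 1 : ℕ) : K) * x = ∑ s ∈ Finset.Icc 1 (n + 1),
          if s = n + 1 then -((n + 1 : ℕ) : K) * x else 0 := by
        rw [Finset.sum_ite_eq']; simp
      rw [hx]
      refine isVal_sum _ fun s hs => ?_
      by_cases hs' : s = n + 1
      · subst hs'
        rw [if_pos rfl, mul_left_comm, localParam_pow_mul_pole_pow, mul_one, h.coef_eq]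
        exact isVal_C _ _
      · rw [if_neg hs']
        obtain ⟨d, hd⟩ := Nat.exists_eq_add_of_lt
          (lt_of_le_of_ne (Finset.mem_Icc.mp hs).2 hs')
        refine ((hz.pow (d + 1)).mul (isVal_C (a j) (-(s : K) * coef (a j) s f))).congr ?_ (by simp)
        rw [show n + 1 + 1 = (d + 1) + (s + 1) by omega, pow_add]
        linear_combination (-localParam (a j) ^ (d + 1) * RatFunc.C (-(s : K) * coef (a j) s f)) *
          localParam_pow_mul_pole_pow (a j) (s + 1)
  · simp only [if_neg hj]
    have : (0 : K) = ∑ s ∈ Finset.Icc 1 l, (0 : K) := by simp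
    rw [this]
    refine isVal_sum _ fun s _ => ?_
    refine ((hz.pow (n + 1)).mul ((isVal_C _ _).mul
      ((isVal_pole (ha.ne (Ne.symm hj))).pow _))).congr rfl (by simp)

/-- The leading matrix of the `ε`-connection on sections with a pole of order `n` at a point of
multiplicity `m`. -/
def leadMatrix (ε : K) (m n : ℕ) (g : Matrix (Fin r) (Fin r) K) : Matrix (Fin r) (Fin r) K :=
  g - (if m = 1 then ε * n else 0) • 1

/-- The derivative has pole order at most n + 1 against m + n for the product with the connection
matrix, so it reaches the leading term only if m = 1, where it adds -ε n. -/
theorem vecVal_epsConnection (ha : Function.Injective a)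
    {A : Matrix (Fin r) (Fin r) (absForms k a)} {i : Fin N} {m : ℕ} (hm : 1 ≤ m)
    {g : Matrix (Fin r) (Fin r) K} (hF : MatVal (a i) (localParam (a i) ^ m • relMatrix A) g)
    (ε : K) {n : ℕ} {u : Sections a r} {x : Fin r → K}
    (h : VecVal (a i) (localParam (a i) ^ n • secVec a r u) x) :
    VecVal (a i) (localParam (a i) ^ (m + n) • relVec a r (epsConnection A ε u))
      ((leadMatrix ε m n g).mulVec x) := by
  have hD : VecVal (a i) (localParam (a i) ^ (m + n) • fun μ => ddt K (secVec a r u μ))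
      (if m = 1 then -(n : K) • x else 0) := by
    intro μ
    have h1 := isVal_ddt ha (u μ).2 i (h μ)
    split_ifs with hm1
    · subst hm1
      rw [add_comm]
      exact h1
    · exact isVal_localParam_pow_mul_of_lt h1 (by omega)
  have h2 := (hD.smul (isVal_C (a i) ε)).add (hF.mulVec h)
  refine h2.congr ?_ ?_
  · rw [relVec_epsConnection, smul_add]
    congr 1
    · funext μ
      simp [RatFunc.smul_eq_C_mul, mul_left_comm]
    · rw [Matrix.smul_mulVec, Matrix.mulVec_smul, smul_smul, ← pow_add]
  · rw [leadMatrix, Matrix.sub_mulVec, Matrix.smul_mulVec, Matrix.one_mulVec]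
    split_ifs
    · rw [smul_smul, mul_neg, neg_smul]
      abel
    · simp

/-- If u had a pole of order l > n, its leading coefficient would be killed by an invertible matrix.
Descending induction starts from any bound for the pole order of u. -/
theorem poleOrderLE_of_epsConnection (ha : Function.Injective a)
    {A : Matrix (Fin r) (Fin r) (absForms k a)} {i : Fin N} {m : ℕ} (hm : 1 ≤ m)
    {g : Matrix (Fin r) (Fin r) K} (hF : MatVal (a i) (localParam (a i) ^ m • relMatrix A) g)
    (ε : K) {n : ℕ} (hg : ∀ l, n < l → IsUnit (leadMatrix ε m l g)) {u : Sections a r}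
    (h : PoleOrderLE (a i) (m + n) (relVec a r (epsConnection A ε u))) :
    PoleOrderLE (a i) n (secVec a r u) := by
  have key : ∀ d, PoleOrderLE (a i) (n + d) (secVec a r u) → PoleOrderLE (a i) n (secVec a r u) := by
    intro d
    induction d with
    | zero => exact id
    | succ d ih =>
      rintro ⟨x, hx⟩
      apply ih
      obtain ⟨y, hy⟩ := h
      have h1 := (vecVal_epsConnection ha hm hF ε hx).unique (hy.of_lt (by omega))
      have h2 : x = 0 := by
        refine Matrix.mulVec_injective_of_isUnit (hg (n + (d + 1)) (by omega)) ?_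
        rw [h1, Matrix.mulVec_zero]
      subst h2
      exact PoleOrderLE.of_zero hx
  obtain ⟨d, hd⟩ := exists_poleOrderLE (a i) (secVec a r u)
  exact key d (hd.mono (by omega))

end Operators

/-! ### H as a space of forms with bounded poles -/

section SubspaceH

variable {K : Type*} [Field K] {N r : ℕ} {a : Fin N → K}

/-- The maximal pole orders of the elements of `H`. -/
def hOrder (m : Fin N → ℕ) (o i : Fin N) : ℕ := if i = o then m i - 1 else m i

theorem poleOrderLE_of_mem_H (ha : Function.Injective a) {m : Fin N → ℕ} (hm : ∀ i, 1 ≤ m i)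
    {o : Fin N} (ho : 2 ≤ m o) {w : FormSections a r} (hw : w ∈ H a m o r) (i : Fin N) :
    PoleOrderLE (a i) (hOrder m o i) (relVec a r w) := by
  have hpole : ∀ (j : Fin N) (s : ℕ), (j = i → s ≤ hOrder m o i) →
      ∃ x, IsVal (a i) (localParam (a i) ^ hOrder m o i * pole (a j) ^ s) x := by
    intro j s h
    by_cases hj : j = i
    · subst hj
      refine exists_isVal_of_le ((isVal_one (a j)).congr ?_ rfl) (h rfl)
      rw [localParam_pow_mul_pole_pow]
    · exact ⟨_, ((isVal_localParam_self _).pow _).mul ((isVal_pole (ha.ne (Ne.symm hj))).pow _)⟩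
  have hsingle : ∀ (μ : Fin r) (y : relForms a),
      (∃ x, IsVal (a i) (localParam (a i) ^ hOrder m o i * relCoef a y) x) →
      PoleOrderLE (a i) (hOrder m o i) (relVec a r (Pi.single μ y)) := by
    rintro μ y ⟨x, hx⟩
    refine ⟨Pi.single μ x, fun ν => ?_⟩
    rw [Pi.smul_apply, relVec_apply]
    by_cases h : ν = μ
    · subst h
      simpa using hx
    · simpa [h] using isVal_zero (a i)
  have h1 : ∀ i, 1 ≤ hOrder m o i := by
    intro i
    rw [hOrder]
    split_ifs with h
    · subst h; omega
    · exact hm i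
  induction hw using Submodule.span_induction with
  | zero => rw [map_zero]; exact poleOrderLE_zero _ _
  | add x y _ _ hx hy => rw [map_add]; exact hx.add hy
  | smul c x _ hx => rw [map_smul]; exact hx.const_smul c
  | mem x hx =>
    rcases hx with ⟨μ, j, s, hs, hsm, rfl⟩ | ⟨μ, j, -, rfl⟩
    · refine hsingle μ _ ?_
      rw [relCoef_polarForm]
      exact hpole j s fun h => by subst h; exact hsm
    · refine hsingle μ _ ?_
      rw [relCoef_simpleForm, mul_sub]
      obtain ⟨x, hx⟩ := hpole j 1 fun _ => h1 i
      obtain ⟨y, hy⟩ := hpole o 1 fun _ => h1 i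
      rw [pow_one] at hx hy
      exact ⟨_, hx.sub hy⟩

/-- Together with `poleOrderLE_of_mem_H` this replaces the spanning set of H by pole order bounds,
which is how membership is tested from here on. -/
theorem mem_H_of_poleOrderLE (ha : Function.Injective a) {m : Fin N → ℕ} {o : Fin N}
    {w : FormSections a r} (hm : ∀ i, 1 ≤ hOrder m o i)
    (hw : ∀ i, PoleOrderLE (a i) (hOrder m o i) (relVec a r w)) : w ∈ H a m o r := by
  have hexp : w = ∑ μ, ∑ i, ((∑ s ∈ Finset.Icc 2 (hOrder m o i), coef (a i) s (relVec a r w μ) •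
      (Pi.single μ (if hs : 2 ≤ s then polarForm a i s hs else 0) : FormSections a r)) +
      coef (a i) 1 (relVec a r w μ) • (Pi.single μ (simpleForm a i o) : FormSections a r)) := by
    apply relVec_injective
    funext ν
    obtain ⟨h1, h2⟩ := formFunctions_polarSum ha (relCoef_mem ha (w ν)) (S := hOrder m o)
      fun i => ⟨_, (hw i).choose_spec ν⟩
    have h3 : ∀ (μ : Fin r) (y : relForms a), relVec a r (Pi.single μ y) ν =
        if ν = μ then relCoef a y else 0 := by
      intro μ y
      rw [relVec_apply]
      by_cases h : ν = μ
      · subst h; simp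
      · simp [h]
    simp only [map_sum, map_add, map_smul, Finset.sum_apply, Pi.add_apply, Pi.smul_apply, h3,
      smul_ite, smul_zero]
    rw [Finset.sum_eq_single ν (fun μ _ h => by simp [Ne.symm h]) (by simp)]
    simp only [if_true, relCoef_simpleForm]
    rw [Finset.sum_add_distrib]
    -- The subtracted terms add up to the sum of the residues times 1/(t - a_o), and that sum is
    -- zero.
    have h4 : ∑ i, coef (a i) 1 (relVec a r w ν) • (pole (a i) - pole (a o)) =
        ∑ i, coef (a i) 1 (relVec a r w ν) • pole (a i) := by
      simp only [smul_sub, Finset.sum_sub_distrib, ← Finset.sum_smul]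
      rw [relVec_apply, h2, zero_smul, sub_zero]
    rw [h4, ← Finset.sum_add_distrib, relVec_apply]
    conv_lhs => rw [h1]
    refine Finset.sum_congr rfl fun i _ => ?_
    rw [← Finset.sum_Ioc_add_eq_sum_Icc (hm i), RatFunc.smul_eq_C_mul]
    congr 1
    · refine Finset.sum_congr rfl fun s hs => ?_
      have hs2 : 2 ≤ s := (Finset.mem_Icc.mp hs).1
      rw [dif_pos hs2, relCoef_polarForm, RatFunc.smul_eq_C_mul]
    · simp
  rw [hexp]
  refine sum_mem fun μ _ => sum_mem fun i _ => add_mem (sum_mem fun s hs => ?_) ?_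
  · refine Submodule.smul_mem _ _ (Submodule.subset_span (Or.inl ?_))
    have hs2 : 2 ≤ s := (Finset.mem_Icc.mp hs).1
    exact ⟨μ, i, s, hs2, (Finset.mem_Icc.mp hs).2, by rw [dif_pos hs2]⟩
  · by_cases hi : i = o
    · subst hi
      have : simpleForm a i i = 0 := by
        apply relCoef_injective
        rw [relCoef_simpleForm, sub_self, map_zero]
      rw [this, Pi.single_zero, smul_zero]
      exact zero_mem _
    · exact Submodule.smul_mem _ _ (Submodule.subset_span (Or.inr ⟨μ, i, hi, rfl⟩))

end SubspaceH

/-! ### H as a complement of the image of ε d + γ_K -/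

section Complement

variable {k K : Type*} [Field k] [Field K] [Algebra k K] {N r : ℕ}

/-- The relative connection has a pole of order `m i` with invertible leading matrix `g i` at each
`a i`. -/
structure HasLeadingTerms (a : Fin N → K) (m : Fin N → ℕ) (o : Fin N)
    (A : Matrix (Fin r) (Fin r) (absForms k a)) (g : Fin N → Matrix (Fin r) (Fin r) K) : Prop where
  inj : Function.Injective a
  one_le : ∀ i, 1 ≤ m i
  two_le : 2 ≤ m o
  val : ∀ i, MatVal (a i) (localParam (a i) ^ m i • relMatrix A) (g i)
  unit : ∀ i, IsUnit (g i)

variable {a : Fin N → K} {m : Fin N → ℕ} {o : Fin N}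
  {A : Matrix (Fin r) (Fin r) (absForms k a)} {g : Fin N → Matrix (Fin r) (Fin r) K}

theorem leadMatrix_zero_right (ε : K) (m : ℕ) (g : Matrix (Fin r) (Fin r) K) :
    leadMatrix ε m 0 g = g := by simp [leadMatrix]

theorem leadMatrix_zero_left (m n : ℕ) (g : Matrix (Fin r) (Fin r) K) :
    leadMatrix 0 m n g = g := by simp [leadMatrix]

theorem leadMatrix_of_two_le (ε : K) {m : ℕ} (hm : 2 ≤ m) (n : ℕ) (g : Matrix (Fin r) (Fin r) K) :
    leadMatrix ε m n g = g := by simp [leadMatrix, show m ≠ 1 by omega]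

/-- Constant sections. -/
def constSection (a : Fin N → K) (x : Fin r → K) : Sections a r :=
  fun μ => algebraMap K (regularFunctions a) (x μ)

theorem secVec_constSection (x : Fin r → K) :
    secVec a r (constSection a x) = RatFunc.C ∘ x := rfl

/-- The section `∑ i, v i / (t - a i) ^ n`. -/
def polarSection (a : Fin N → K) (n : ℕ) (v : Fin N → Fin r → K) : Sections a r :=
  fun μ => ∑ i, v i μ • (⟨pole (a i), pole_mem a i⟩ : regularFunctions a) ^ n

theorem secVec_polarSection (n : ℕ) (v : Fin N → Fin r → K) :
    secVec a r (polarSection a n v) = ∑ i, pole (a i) ^ n • (RatFunc.C ∘ v i) := by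
  funext μ
  simp [secVec_apply, polarSection, RatFunc.smul_eq_C_mul, mul_comm]

theorem vecVal_polarSection (ha : Function.Injective a) {n : ℕ} (hn : 1 ≤ n)
    (v : Fin N → Fin r → K) (i : Fin N) :
    VecVal (a i) (localParam (a i) ^ n • secVec a r (polarSection a n v)) (v i) := by
  rw [secVec_polarSection, Finset.smul_sum]
  have hv : v i = ∑ j, if j = i then v i else 0 := by simp
  rw [hv]
  refine vecVal_sum _ fun j _ => ?_
  rw [smul_smul]
  split_ifs with h
  · subst h
    rw [localParam_pow_mul_pole_pow, one_smul]
    exact vecVal_C _ _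
  · refine (VecVal.smul (((isVal_localParam_self (a i)).pow n).mul
      ((isVal_pole (ha.ne (Ne.symm h))).pow n)) (vecVal_C _ _)).congr rfl ?_
    simp [show n ≠ 0 by omega]

theorem exists_eq_constSection (ha : Function.Injective a) {u : Sections a r}
    (hu : ∀ i, PoleOrderLE (a i) 0 (secVec a r u)) : ∃ x, u = constSection a x := by
  have h : ∀ μ, ∃ x, (u μ : RatFunc K) = RatFunc.C x := by
    intro μ
    obtain ⟨x, hx⟩ := eq_C_add_polarSum ha (u μ).2 (S := fun _ => 0)
      fun i => ⟨_, (hu i).choose_spec μ⟩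
    exact ⟨x, by simpa [polarSum] using hx⟩
  choose x hx using h
  exact ⟨x, secVec_injective (funext hx)⟩

namespace HasLeadingTerms

theorem one_le_hOrder (h : HasLeadingTerms a m o A g) (i : Fin N) : 1 ≤ hOrder m o i := by
  rw [hOrder]
  split_ifs with hi
  · subst hi; have := h.two_le; omega
  · exact h.one_le i

theorem poleOrderLE_epsConnection (h : HasLeadingTerms a m o A g) (ε : K) {u : Sections a r}
    {i : Fin N} {n : ℕ} (hu : PoleOrderLE (a i) n (secVec a r u)) :
    PoleOrderLE (a i) (m i + n) (relVec a r (epsConnection A ε u)) := by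
  obtain ⟨x, hx⟩ := hu
  exact ⟨_, vecVal_epsConnection h.inj (h.one_le i) (h.val i) ε hx⟩

/-- The image has order at most m_i at each a_i, so u has no poles and is a constant x. At a_o the
order is even at most m_o - 1, hence g_o x = 0. -/
theorem eq_zero_of_epsConnection_mem (h : HasLeadingTerms a m o A g) {ε : K}
    (hg : ∀ i n, 1 ≤ n → IsUnit (leadMatrix ε (m i) n (g i))) {u : Sections a r}
    (hu : epsConnection A ε u ∈ H a m o r) : u = 0 := by
  have hH := poleOrderLE_of_mem_H h.inj h.one_le h.two_le hu
  obtain ⟨x, rfl⟩ := exists_eq_constSection h.inj fun i =>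
    poleOrderLE_of_epsConnection h.inj (h.one_le i) (h.val i) ε (hg i)
      ((hH i).mono (by rw [hOrder]; split_ifs <;> omega))
  have h1 := vecVal_epsConnection h.inj (h.one_le o) (h.val o) ε (n := 0)
    (u := constSection a x) ((vecVal_C (a o) x).congr (by rw [pow_zero, one_smul]; rfl) rfl)
  obtain ⟨y, hy⟩ := hH o
  have h2 := h1.unique (hy.of_lt (by rw [hOrder, if_pos rfl]; have := h.two_le; omega))
  rw [leadMatrix_zero_right] at h2
  have h3 : x = 0 := by
    refine Matrix.mulVec_injective_of_isUnit (h.unit o) ?_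
    rw [h2, Matrix.mulVec_zero]
  subst h3
  exact secVec_injective (by funext μ; simp [secVec_constSection])

/-- A single section ∑ v_i / (t - a_i)^(n+1) corrects all points at once: its term at a_j is regular
at a_i for j ≠ i, so each v_i can be chosen independently. -/
theorem exists_reduce (h : HasLeadingTerms a m o A g) {ε : K} {n : ℕ}
    (hg : ∀ i, IsUnit (leadMatrix ε (m i) (n + 1) (g i))) (w : FormSections a r)
    (hw : ∀ i, PoleOrderLE (a i) (m i + (n + 1)) (relVec a r w)) :
    ∃ u, ∀ i, PoleOrderLE (a i) (m i + n) (relVec a r (w - epsConnection A ε u)) := by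
  choose x hx using hw
  refine ⟨polarSection a (n + 1) fun i => (leadMatrix ε (m i) (n + 1) (g i))⁻¹.mulVec (x i),
    fun i => PoleOrderLE.of_zero ?_⟩
  have h1 := vecVal_epsConnection h.inj (h.one_le i) (h.val i) ε
    (vecVal_polarSection h.inj (Nat.le_add_left 1 n)
      (fun i => (leadMatrix ε (m i) (n + 1) (g i))⁻¹.mulVec (x i)) i)
  rw [Matrix.mulVec_mulVec, Matrix.mul_nonsing_inv _ ((Matrix.isUnit_iff_isUnit_det _).mp (hg i)),
    Matrix.one_mulVec] at h1
  refine ((hx i).sub h1).congr ?_ (sub_self _)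
  rw [map_sub, smul_sub]
  rfl

/-- The constant section g_o⁻¹ x_o cancels the term of order m_o at a_o, and being regular it
creates no pole of order above m_i elsewhere. -/
theorem exists_reduce_mem_H (h : HasLeadingTerms a m o A g) (ε : K) (w : FormSections a r)
    (hw : ∀ i, PoleOrderLE (a i) (m i) (relVec a r w)) :
    ∃ u, w - epsConnection A ε u ∈ H a m o r := by
  choose x hx using hw
  refine ⟨constSection a ((g o)⁻¹.mulVec (x o)), mem_H_of_poleOrderLE h.inj h.one_le_hOrder
    fun i => ?_⟩
  have h1 := fun j => vecVal_epsConnection h.inj (h.one_le j) (h.val j) ε (n := 0)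
    (u := constSection a ((g o)⁻¹.mulVec (x o)))
    ((vecVal_C (a j) ((g o)⁻¹.mulVec (x o))).congr (by rw [pow_zero, one_smul]; rfl) rfl)
  simp only [leadMatrix_zero_right, add_zero] at h1
  have h2 := (hx i).sub (h1 i)
  rw [← smul_sub, ← map_sub] at h2
  rw [hOrder]
  split_ifs with hi
  · subst hi
    rw [Matrix.mulVec_mulVec, Matrix.mul_nonsing_inv _ ((Matrix.isUnit_iff_isUnit_det _).mp (h.unit i)),
      Matrix.one_mulVec, sub_self] at h2
    refine PoleOrderLE.of_zero ?_
    rwa [Nat.sub_add_cancel (h.one_le i)]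
  · exact ⟨_, h2⟩

theorem exists_sub_mem_H (h : HasLeadingTerms a m o A g) {ε : K}
    (hg : ∀ i n, 1 ≤ n → IsUnit (leadMatrix ε (m i) n (g i))) (w : FormSections a r) :
    ∃ u, w - epsConnection A ε u ∈ H a m o r := by
  have key : ∀ n, ∀ w : FormSections a r, (∀ i, PoleOrderLE (a i) (m i + n) (relVec a r w)) →
      ∃ u, w - epsConnection A ε u ∈ H a m o r := by
    intro n
    induction n with
    | zero => exact fun w hw => h.exists_reduce_mem_H ε w hw
    | succ n ih =>
      intro w hw
      obtain ⟨u, hu⟩ := h.exists_reduce (fun i => hg i (n + 1) (by omega)) w hw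
      obtain ⟨u', hu'⟩ := ih _ hu
      exact ⟨u + u', by rwa [map_add, ← sub_sub]⟩
  choose n hn using fun i => exists_poleOrderLE (a i) (relVec a r w)
  exact key (Finset.univ.sup n) w fun i => (hn i).mono
    ((Finset.le_sup (Finset.mem_univ i)).trans (Nat.le_add_left _ _))

theorem isCompl_H (h : HasLeadingTerms a m o A g) {ε : K}
    (hg : ∀ i n, 1 ≤ n → IsUnit (leadMatrix ε (m i) n (g i))) :
    IsCompl (H a m o r) (LinearMap.range (epsConnection A ε)) := by
  constructor
  · rw [Submodule.disjoint_def]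
    rintro _ hx ⟨u, rfl⟩
    rw [h.eq_zero_of_epsConnection_mem hg hx, map_zero]
  · rw [codisjoint_iff, Submodule.eq_top_iff']
    intro w
    obtain ⟨u, hu⟩ := h.exists_sub_mem_H hg w
    exact Submodule.mem_sup.mpr ⟨_, hu, _, ⟨u, rfl⟩, sub_add_cancel _ _⟩

theorem isUnit_leadMatrix_zero (h : HasLeadingTerms a m o A g) (i : Fin N) (n : ℕ) :
    IsUnit (leadMatrix 0 (m i) n (g i)) := by
  rw [leadMatrix_zero_left]
  exact h.unit i

theorem isCompl_higgsField (h : HasLeadingTerms a m o A g) :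
    IsCompl (H a m o r) (LinearMap.range (higgsField A)) := by
  rw [← epsConnection_zero]
  exact h.isCompl_H fun i n _ => h.isUnit_leadMatrix_zero i n

theorem isCompl_relConnection (h : HasLeadingTerms a m o A g)
    (hg : ∀ i, m i = 1 → ∀ n : ℕ, (n : K) ∉ spectrum K (g i)) :
    IsCompl (H a m o r) (LinearMap.range (relConnection A)) := by
  rw [← epsConnection_one]
  refine h.isCompl_H fun i n _ => ?_
  by_cases hi : m i = 1
  · have := spectrum.notMem_iff.mp (hg i hi n)
    rw [leadMatrix, if_pos hi, one_mul, ← Algebra.algebraMap_eq_smul_one, ← IsUnit.neg_iff, neg_sub]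
    exact this
  · rw [leadMatrix_of_two_le _ (by have := h.one_le i; omega)]
    exact h.unit i

end HasLeadingTerms

/-- The sections with a pole of order at most `n` at each point. -/
def boundedSections (a : Fin N → K) (r n : ℕ) : Submodule K (Sections a r) where
  carrier := {u | ∀ i, PoleOrderLE (a i) n (secVec a r u)}
  zero_mem' i := by rw [map_zero]; exact poleOrderLE_zero _ _
  add_mem' hu hv i := by rw [map_add]; exact (hu i).add (hv i)
  smul_mem' c u hu i := by rw [map_smul]; exact (hu i).const_smul c

theorem finite_boundedSections (ha : Function.Injective a) (n : ℕ) :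
    Module.Finite K (boundedSections a r n) := by
  let U : Submodule K (RatFunc K) :=
    Submodule.span K (insert 1 (Set.range fun p : Fin N × Fin (n + 1) => pole (a p.1) ^ (p.2 : ℕ)))
  have : Module.Finite K U :=
    Module.Finite.span_of_finite K ((Set.finite_range _).insert _)
  have hU : ∀ u ∈ boundedSections a r n, ∀ μ, secVec a r u μ ∈ U := by
    intro u hu μ
    obtain ⟨x, hx⟩ := eq_C_add_polarSum ha (u μ).2 (S := fun _ => n)
      fun i => ⟨_, (hu i).choose_spec μ⟩
    rw [secVec_apply, hx]
    refine add_mem ?_ (sum_mem fun i _ => sum_mem fun s hs => C_mul_mem _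
      (Submodule.subset_span (Or.inr ⟨(i, ⟨s, ?_⟩), rfl⟩)))
    · rw [← mul_one (RatFunc.C x)]
      exact C_mul_mem _ (Submodule.subset_span (Or.inl rfl))
    · exact Nat.lt_succ_of_le (Finset.mem_Icc.mp hs).2
  let f : boundedSections a r n →ₗ[K] (Fin r → U) :=
    { toFun := fun u μ => ⟨secVec a r u μ, hU u u.2 μ⟩
      map_add' := fun u v => by ext; simp
      map_smul' := fun c u => by ext; simp }
  refine Module.Finite.of_injective f fun u v huv => Subtype.ext (secVec_injective ?_)
  funext μ
  change (f u μ : RatFunc K) = f v μ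
  rw [huv]

end Complement

/-- P is the projection onto the image of C along U followed by the inverse of C. Thus w - C (P w)
is the component of w in U, and projections become statements about P. -/
theorem exists_retraction {K V W : Type*} [Field K] [AddCommGroup V] [Module K V] [AddCommGroup W]
    [Module K W] (C : V →ₗ[K] W) (hC : Function.Injective C) {U : Submodule K W}
    (h : IsCompl U (LinearMap.range C)) : ∃ P : W →ₗ[K] V,
      (∀ u, P (C u) = u) ∧ (∀ x ∈ U, P x = 0) ∧ ∀ w, w - C (P w) ∈ U := by
  obtain ⟨L, hL⟩ := C.exists_leftInverse_of_injective (LinearMap.ker_eq_bot.mpr hC)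
  have hL' : ∀ u, L (C u) = u := fun u => LinearMap.congr_fun hL u
  let P : W →ₗ[K] V := L ∘ₗ (LinearMap.range C).subtype ∘ₗ (LinearMap.range C).projectionOnto U h.symm
  have h1 : ∀ u, P (C u) = u := fun u => by
    have : (LinearMap.range C).projectionOnto U h.symm (C u) = ⟨C u, u, rfl⟩ :=
      Submodule.projectionOnto_apply_left h.symm ⟨C u, u, rfl⟩
    simp [P, this, hL']
  have h2 : ∀ x ∈ U, P x = 0 := fun x hx => by
    have : (LinearMap.range C).projectionOnto U h.symm x = 0 :=
      Submodule.projectionOnto_apply_right h.symm ⟨x, hx⟩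
    simp [P, this]
  refine ⟨P, h1, h2, fun w => ?_⟩
  obtain ⟨x, hx, _, ⟨u, rfl⟩, rfl⟩ := Submodule.mem_sup.mp
    (show w ∈ U ⊔ LinearMap.range C by rw [h.sup_eq_top]; trivial)
  rwa [map_add, h2 x hx, h1, zero_add, add_sub_cancel_right]

/-- For m = 1 the matrix is g - l. The spectrum of g is finite and, in characteristic zero, the
integers l are distinct in K, so only finitely many l are excluded. -/
theorem exists_isUnit_leadMatrix {K : Type*} [Field K] [CharZero K] {r : ℕ}
    {g : Matrix (Fin r) (Fin r) K} (hg : IsUnit g) (m : ℕ) :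
    ∃ n₀, ∀ l, n₀ < l → IsUnit (leadMatrix 1 m l g) := by
  by_cases hm : m = 1
  · have hfin : ((fun l : ℕ => (l : K)) ⁻¹' spectrum K g).Finite :=
      (Matrix.finite_spectrum g).preimage (Nat.cast_injective.injOn)
    obtain ⟨n₀, hn₀⟩ := hfin.bddAbove
    refine ⟨n₀, fun l hl => ?_⟩
    have h1 : (l : K) ∉ spectrum K g := fun h => absurd (hn₀ h) (not_le.mpr hl)
    rw [leadMatrix, if_pos hm, one_mul, ← Algebra.algebraMap_eq_smul_one, ← IsUnit.neg_iff, neg_sub]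
    exact spectrum.notMem_iff.mp h1
  · exact ⟨0, fun l _ => by simpa [leadMatrix, hm] using hg⟩

/-! ### Recovering invertible leading matrices from the complement property -/

namespace HasLeadingTerms

variable {k K : Type*} [Field k] [Field K] [Algebra k K] {N r : ℕ} {a : Fin N → K} {m : Fin N → ℕ}
  {o : Fin N} {A : Matrix (Fin r) (Fin r) (absForms k a)} {g : Fin N → Matrix (Fin r) (Fin r) K}

theorem poleOrderLE_of_mem_H (h : HasLeadingTerms a m o A g) {w : FormSections a r}
    (hw : w ∈ H a m o r) (i : Fin N) : PoleOrderLE (a i) (m i) (relVec a r w) :=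
  (HiggsDeRham.poleOrderLE_of_mem_H h.inj h.one_le h.two_le hw i).mono (by
    rw [hOrder]; split_ifs <;> omega)

theorem injective_epsConnection (h : HasLeadingTerms a m o A g) {ε : K}
    (hg : ∀ i n, 1 ≤ n → IsUnit (leadMatrix ε (m i) n (g i))) :
    Function.Injective (epsConnection A ε) := by
  rw [injective_iff_map_eq_zero]
  exact fun u hu => h.eq_zero_of_epsConnection_mem hg (by rw [hu]; exact zero_mem _)

/-- If `H` is a complement of the image of the relative connection, then the leading matrices of the
connection at the points of multiplicity one are invertible. -/
theorem isUnit_leadMatrix_of_isCompl [CharZero K] (h : HasLeadingTerms a m o A g)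
    (hd : IsCompl (H a m o r) (LinearMap.range (epsConnection A 1))) (i : Fin N) {n : ℕ}
    (hn : 1 ≤ n) : IsUnit (leadMatrix 1 (m i) n (g i)) := by
  have hg0 : ∀ i n, 1 ≤ n → IsUnit (leadMatrix 0 (m i) n (g i)) :=
    fun i n _ => h.isUnit_leadMatrix_zero i n
  obtain ⟨P, hP1, hP2, hP3⟩ := exists_retraction (epsConnection A 0) (h.injective_epsConnection hg0)
    (h.isCompl_H hg0)
  -- T compares the connection with the Higgs field. It preserves the bounds on pole orders and acts
  -- on leading coefficients of order n ≥ 1 as g⁻¹ times the leading matrix, so surjectivity of T on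
  -- each space of bounded sections is what is needed.
  let T := P ∘ₗ epsConnection A 1
  have hT : ∀ n, ∀ u ∈ boundedSections a r n, T u ∈ boundedSections a r n := by
    intro n u hu j
    refine poleOrderLE_of_epsConnection h.inj (h.one_le j) (h.val j) 0
      (fun l _ => h.isUnit_leadMatrix_zero j l) ?_
    have h1 := h.poleOrderLE_epsConnection 1 (hu j)
    have h2 := (h.poleOrderLE_of_mem_H (hP3 (epsConnection A 1 u)) j).mono (Nat.le_add_right _ n)
    have h3 := h1.sub h2
    rwa [← map_sub, sub_sub_cancel] at h3
  obtain ⟨n₀, hn₀⟩ : ∃ n₀, ∀ j l, n₀ < l → IsUnit (leadMatrix 1 (m j) l (g j)) := by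
    choose n₀ h₀ using fun j => exists_isUnit_leadMatrix (h.unit j) (m j)
    exact ⟨Finset.univ.sup n₀, fun j l hl =>
      h₀ j l ((Finset.le_sup (Finset.mem_univ j)).trans_lt hl)⟩
  -- Decompose γ e = x + ∇u with x in H. Beyond n₀ the leading matrices are invertible, so u has
  -- poles of order at most n, and applying P gives T u = e.
  have hsurj : ∀ n, n₀ ≤ n → Function.Surjective (T.restrict (hT n)) := by
    rintro n hn ⟨e, he⟩
    obtain ⟨x, hx, _, ⟨u, rfl⟩, hxu⟩ := Submodule.mem_sup.mp
      (show epsConnection A 0 e ∈ H a m o r ⊔ LinearMap.range (epsConnection A 1) by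
        rw [hd.sup_eq_top]; trivial)
    have hu : u ∈ boundedSections a r n := by
      intro j
      refine poleOrderLE_of_epsConnection h.inj (h.one_le j) (h.val j) 1
        (fun l hl => hn₀ j l (by omega)) ?_
      have h1 := h.poleOrderLE_epsConnection 0 (he j)
      have h2 := (h.poleOrderLE_of_mem_H hx j).mono (Nat.le_add_right _ n)
      have h3 := h1.sub h2
      rwa [← map_sub, ← hxu, add_sub_cancel_left] at h3
    refine ⟨⟨u, hu⟩, Subtype.ext ?_⟩
    change P (epsConnection A 1 u) = e
    rw [← hP1 e, ← hxu, map_add, hP2 x hx, zero_add]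
  -- Every section lies in some bounded space with n ≥ n₀, where surjective implies injective by
  -- finite dimension.
  have hTinj : Function.Injective T := by
    rw [injective_iff_map_eq_zero]
    intro u hu
    choose d hd using fun j => exists_poleOrderLE (a j) (secVec a r u)
    have hu' : u ∈ boundedSections a r (max n₀ (Finset.univ.sup d)) := fun j =>
      (hd j).mono ((Finset.le_sup (Finset.mem_univ j)).trans (le_max_right _ _))
    have := finite_boundedSections (r := r) h.inj (max n₀ (Finset.univ.sup d))
    have h1 := LinearMap.injective_iff_surjective.mpr (hsurj _ (le_max_left n₀ (Finset.univ.sup d)))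
    have h2 : (⟨u, hu'⟩ : boundedSections a r (max n₀ (Finset.univ.sup d))) = 0 :=
      h1 (Subtype.ext (by simpa using hu))
    exact congrArg Subtype.val h2
  have := finite_boundedSections (r := r) h.inj n
  -- The dimension argument in reverse: global injectivity gives surjectivity also for n below n₀.
  have hsurj' : Function.Surjective (T.restrict (hT n)) := by
    refine LinearMap.injective_iff_surjective.mp fun u v huv => Subtype.ext (hTinj ?_)
    exact congrArg Subtype.val huv
  -- Solve T u = e with e of leading coefficient g⁻¹ y. Then ∇u - γ e lies in H and has order at
  -- most m_i < m_i + n, so comparing leading terms shows that the leading matrix sends x to y.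
  refine Matrix.mulVec_surjective_iff_isUnit.mp fun y => ?_
  have hval := vecVal_polarSection (r := r) h.inj hn (fun j => (g j)⁻¹.mulVec y)
  obtain ⟨⟨u, hu⟩, hTu⟩ := hsurj' ⟨polarSection a n fun j => (g j)⁻¹.mulVec y,
    fun j => ⟨_, hval j⟩⟩
  have hTu' : P (epsConnection A 1 u) = polarSection a n fun j => (g j)⁻¹.mulVec y :=
    congrArg Subtype.val hTu
  obtain ⟨x, hx⟩ := hu i
  refine ⟨x, ?_⟩
  have h1 := vecVal_epsConnection h.inj (h.one_le i) (h.val i) 1 hx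
  have h2 := vecVal_epsConnection h.inj (h.one_le i) (h.val i) 0 (hval i)
  obtain ⟨z, hz⟩ := h.poleOrderLE_of_mem_H (hP3 (epsConnection A 1 u)) i
  have h3 := hz.of_lt (Nat.lt_add_of_pos_right (n := m i) hn)
  rw [hTu', map_sub, smul_sub] at h3
  have h4 := (h1.sub h2).unique h3
  rw [sub_eq_zero.mp h4, leadMatrix_zero_left, Matrix.mulVec_mulVec,
    Matrix.mul_nonsing_inv _ ((Matrix.isUnit_iff_isUnit_det _).mp (h.unit i)), Matrix.one_mulVec]

end HasLeadingTerms

/-! ### Matrices given by their polar parts -/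

section PolarMatrices

variable {K : Type*} [Field K] {N r : ℕ} {a : Fin N → K}

theorem localParam_pow_add_mul_pole_pow (c : K) (s d : ℕ) :
    localParam c ^ (s + d) * pole c ^ s = localParam c ^ d := by
  rw [pow_add, mul_right_comm, localParam_pow_mul_pole_pow, one_mul]

/-- The matrix of functions `∑ i, ∑ 1 ≤ s ≤ S i, x i s / (t - a i) ^ s`. -/
def polarMatrix (a : Fin N → K) (S : Fin N → ℕ) (x : Fin N → ℕ → Matrix (Fin r) (Fin r) K) :
    Matrix (Fin r) (Fin r) (RatFunc K) :=
  ∑ i, ∑ s ∈ Finset.Icc 1 (S i), pole (a i) ^ s • (x i s).map RatFunc.C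

theorem polarMatrix_apply (S : Fin N → ℕ) (x : Fin N → ℕ → Matrix (Fin r) (Fin r) K) (μ ν : Fin r) :
    polarMatrix a S x μ ν =
      ∑ i, ∑ s ∈ Finset.Icc 1 (S i), pole (a i) ^ s * RatFunc.C (x i s μ ν) := by
  simp [polarMatrix, Matrix.sum_apply]

theorem polarMatrix_mem (S : Fin N → ℕ) (x : Fin N → ℕ → Matrix (Fin r) (Fin r) K) (μ ν : Fin r) :
    polarMatrix a S x μ ν ∈ regularFunctions a := by
  rw [polarMatrix_apply]
  exact sum_mem fun i _ => sum_mem fun s _ =>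
    mul_mem (pow_mem (pole_mem a i) s) (Subalgebra.algebraMap_mem _ (x i s μ ν))

theorem matVal_polarMatrix (ha : Function.Injective a) {S : Fin N → ℕ}
    (x : Fin N → ℕ → Matrix (Fin r) (Fin r) K) (i : Fin N) {n : ℕ} (hn : 1 ≤ n) (hS : S i ≤ n) :
    MatVal (a i) (localParam (a i) ^ n • polarMatrix a S x) (if S i = n then x i n else 0) := by
  rw [polarMatrix, Finset.smul_sum]
  have hv : (if S i = n then x i n else 0) =
      ∑ j, if j = i then (if S i = n then x i n else 0) else 0 := by simp
  rw [hv]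
  refine matVal_sum _ fun j _ => ?_
  rw [Finset.smul_sum]
  have hz := isVal_localParam_self (a i)
  split_ifs with h h'
  · subst h
    have hx : x j n = ∑ s ∈ Finset.Icc 1 (S j), if s = n then x j n else 0 := by
      rw [Finset.sum_ite_eq', if_pos (Finset.mem_Icc.mpr ⟨hn, h'.ge⟩)]
    rw [hx]
    refine matVal_sum _ fun s hs => ?_
    rw [smul_smul]
    split_ifs with hs'
    · subst hs'
      rw [localParam_pow_mul_pole_pow, one_smul]
      exact matVal_C _ _
    · obtain ⟨d, rfl⟩ := Nat.exists_eq_add_of_lt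
        (lt_of_le_of_ne ((Finset.mem_Icc.mp hs).2.trans hS) hs')
      refine (MatVal.smul (hz.pow (d + 1)) (matVal_C _ (x j s))).congr ?_
        (y := 0) (by simp)
      rw [add_assoc, localParam_pow_add_mul_pole_pow]
  · subst h
    rw [← Finset.sum_const_zero (ι := ℕ) (s := Finset.Icc 1 (S j))]
    refine matVal_sum _ fun s hs => ?_
    obtain ⟨d, rfl⟩ := Nat.exists_eq_add_of_lt
      ((Finset.mem_Icc.mp hs).2.trans_lt (lt_of_le_of_ne hS h'))
    rw [smul_smul]
    refine (MatVal.smul (hz.pow (d + 1)) (matVal_C _ (x j s))).congr ?_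
      (y := 0) (by simp)
    rw [add_assoc, localParam_pow_add_mul_pole_pow]
  · rw [← Finset.sum_const_zero (ι := ℕ) (s := Finset.Icc 1 (S j))]
    refine matVal_sum _ fun s _ => ?_
    rw [smul_smul]
    exact (MatVal.smul ((hz.pow n).mul ((isVal_pole (ha.ne (Ne.symm h))).pow s))
      (matVal_C _ _)).congr rfl (by simp [show n ≠ 0 by omega])

theorem exists_matVal_polarMatrix_sub (ha : Function.Injective a) {S : Fin N → ℕ}
    (x : Fin N → ℕ → Matrix (Fin r) (Fin r) K) (i : Fin N) (hS : S i = 1) :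
    ∃ y, MatVal (a i) (polarMatrix a S x - pole (a i) • (x i 1).map RatFunc.C) y := by
  have h : polarMatrix a S x - pole (a i) • (x i 1).map RatFunc.C =
      ∑ j ∈ Finset.univ.erase i, ∑ s ∈ Finset.Icc 1 (S j), pole (a j) ^ s • (x j s).map RatFunc.C := by
    rw [polarMatrix, ← Finset.add_sum_erase _ _ (Finset.mem_univ i), hS]
    simp
  rw [h]
  exact ⟨_, matVal_sum _ fun j hj => matVal_sum _ fun s _ => MatVal.smul
    ((isVal_pole (ha.ne (Finset.ne_of_mem_erase hj).symm)).pow s) (matVal_C _ _)⟩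

theorem matVal_ddt (ha : Function.Injective a) {B : Matrix (Fin r) (Fin r) (RatFunc K)}
    (hB : ∀ μ ν, B μ ν ∈ regularFunctions a) (i : Fin N) {n : ℕ} {x : Matrix (Fin r) (Fin r) K}
    (h : MatVal (a i) (localParam (a i) ^ n • B) x) :
    MatVal (a i) (localParam (a i) ^ (n + 1) • B.map (ddt K)) (-(n : K) • x) :=
  fun μ ν => isVal_ddt ha (hB μ ν) i (h μ ν)

end PolarMatrices

/-! ### Verticality as a flatness equation, and its consequences -/

section Equations

variable {k K : Type*} [Field k] [Field K] [Algebra k K] {N r : ℕ} {a : Fin N → K} {m : Fin N → ℕ}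
  {A : Matrix (Fin r) (Fin r) (absForms k a)}

theorem liftDer_localParam (δ : Derivation k K K) (c : K) :
    liftDer δ (localParam c) = -RatFunc.C (δ c) := by
  rw [localParam, map_sub, liftDer_X, liftDer_C, zero_sub]

/-- The function 1/(t - c) depends on c only through t - c, so moving the pole amounts to -δ(c)
d/dt. -/
theorem liftDer_pole_pow (δ : Derivation k K K) (c : K) (s : ℕ) :
    liftDer δ (pole c ^ s) = -(RatFunc.C (δ c) * ddt K (pole c ^ s)) := by
  have h : liftDer δ (pole c) = -(RatFunc.C (δ c) * ddt K (pole c)) := by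
    rw [pole, Derivation.leibniz_inv, Derivation.leibniz_inv, liftDer_localParam, ddt_localParam]
    simp only [smul_eq_mul]
    ring
  rw [Derivation.leibniz_pow, Derivation.leibniz_pow, h]
  simp only [smul_eq_mul, nsmul_eq_mul]
  ring

theorem liftDer_polarMatrix (δ : Derivation k K K) (S : Fin N → ℕ)
    (x : Fin N → ℕ → Matrix (Fin r) (Fin r) K) (μ ν : Fin r) :
    liftDer δ (polarMatrix a S x μ ν) = polarMatrix a S (fun i s => (x i s).map δ) μ ν -
      ddt K (∑ i, ∑ s ∈ Finset.Icc 1 (S i),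
        RatFunc.C (δ (a i)) * (pole (a i) ^ s * RatFunc.C (x i s μ ν))) := by
  simp only [polarMatrix_apply, map_sum, ← Finset.sum_sub_distrib]
  refine Finset.sum_congr rfl fun i _ => Finset.sum_congr rfl fun s _ => ?_
  simp only [Derivation.leibniz, ddt_C, liftDer_C, liftDer_pole_pow, smul_eq_mul, Matrix.map_apply]
  ring

/-- The part of the connection in the direction of the base, contracted with a functional. -/
def etaMatrix (a : Fin N → K) (m : Fin N → ℕ) (η : Fin N → ℕ → Matrix (Fin r) (Fin r) Ω[K⁄k])
    (η₀ : Matrix (Fin r) (Fin r) Ω[K⁄k]) (l : Ω[K⁄k] →ₗ[K] K) :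
    Matrix (Fin r) (Fin r) (RatFunc K) :=
  polarMatrix a (fun i => etaOrder (m i)) (fun i s => (η i s).map l) + (η₀.map l).map RatFunc.C

theorem etaMatrix_mem (η : Fin N → ℕ → Matrix (Fin r) (Fin r) Ω[K⁄k])
    (η₀ : Matrix (Fin r) (Fin r) Ω[K⁄k]) (l : Ω[K⁄k] →ₗ[K] K) (μ ν : Fin r) :
    etaMatrix a m η η₀ l μ ν ∈ regularFunctions a :=
  add_mem (polarMatrix_mem _ _ μ ν) (Subalgebra.algebraMap_mem _ (l (η₀ μ ν)))

theorem one_le_etaOrder {m : ℕ} (hm : 1 ≤ m) : 1 ≤ etaOrder m := by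
  rw [etaOrder]; split_ifs <;> omega

theorem matVal_etaMatrix (ha : Function.Injective a)
    (η : Fin N → ℕ → Matrix (Fin r) (Fin r) Ω[K⁄k])
    (η₀ : Matrix (Fin r) (Fin r) Ω[K⁄k]) (l : Ω[K⁄k] →ₗ[K] K) (i : Fin N) (hm : 1 ≤ m i) :
    MatVal (a i) (localParam (a i) ^ etaOrder (m i) • etaMatrix a m η η₀ l)
      ((η i (etaOrder (m i))).map l) := by
  have h1 := one_le_etaOrder hm
  rw [etaMatrix, smul_add]
  have h2 := matVal_polarMatrix ha (S := fun i => etaOrder (m i)) (fun i s => (η i s).map l) i h1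
    le_rfl
  rw [if_pos rfl] at h2
  exact (h2.add (MatVal.smul ((isVal_localParam_self (a i)).pow (etaOrder (m i)))
    (matVal_C (a i) (η₀.map l)))).congr rfl (by
      rw [zero_pow (by omega), zero_smul, add_zero])

namespace HasEquation

variable {g : Fin N → ℕ → Matrix (Fin r) (Fin r) K}
  {η : Fin N → ℕ → Matrix (Fin r) (Fin r) Ω[K⁄k]} {η₀ : Matrix (Fin r) (Fin r) Ω[K⁄k]}

theorem relMatrix_eq (h : HasEquation a m A g η η₀) : relMatrix A = polarMatrix a m g := by
  ext μ ν
  rw [relMatrix, h μ ν, polarMatrix_apply]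
  simp only [map_add, map_sum, map_smul, pairing_ddt_base, mul_zero, Finset.sum_const_zero,
    add_zero, Derivation.liftKaehlerDifferential_comp_D, Derivation.coe_restrictScalars, smul_eq_mul,
    ddt_localParam, mul_one]
  exact Finset.sum_congr rfl fun i _ => Finset.sum_congr rfl fun s _ => mul_comm _ _

theorem pairing_liftDer_eq (h : HasEquation a m A g η η₀) (l : Ω[K⁄k] →ₗ[K] K) (μ ν : Fin r) :
    pairing (liftDer (functionalDer l)) (A μ ν : Ω[RatFunc K⁄k]) = etaMatrix a m η η₀ l μ ν -
      ∑ i, ∑ s ∈ Finset.Icc 1 (m i),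
        RatFunc.C (functionalDer l (a i)) * (pole (a i) ^ s * RatFunc.C (g i s μ ν)) := by
  rw [h μ ν, etaMatrix, Matrix.add_apply, polarMatrix_apply]
  simp only [map_add, map_sum, map_smul, pairing_liftDer_base,
    Derivation.liftKaehlerDifferential_comp_D, smul_eq_mul, liftDer_localParam, Matrix.map_apply,
    mul_neg, Finset.sum_neg_distrib]
  have : ∀ i s, RatFunc.C (g i s μ ν) * pole (a i) ^ s * RatFunc.C (functionalDer l (a i)) =
      RatFunc.C (functionalDer l (a i)) * (pole (a i) ^ s * RatFunc.C (g i s μ ν)) :=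
    fun i s => by ring
  simp only [this]
  ring

/-- The flatness equation satisfied by a vertical connection. -/
theorem flatness (h : HasEquation a m A g η η₀) (hv : IsVertical A) (l : Ω[K⁄k] →ₗ[K] K) :
    ∃ θ : Matrix (Fin r) (Fin r) (RatFunc K),
      θ = etaMatrix a m η η₀ l - ∑ i, RatFunc.C (functionalDer l (a i)) •
        ∑ s ∈ Finset.Icc 1 (m i), pole (a i) ^ s • (g i s).map RatFunc.C ∧
      polarMatrix a m (fun i s => (g i s).map (functionalDer l)) -
        (etaMatrix a m η η₀ l).map (ddt K) = relMatrix A * θ - θ * relMatrix A := by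
  -- θ is the contraction of the absolute connection with the lifted derivation δ; as δ kills t,
  -- each d(t - a_i) contributes -δ(a_i).
  have hθ : ∀ μ ν, (etaMatrix a m η η₀ l - ∑ i, RatFunc.C (functionalDer l (a i)) •
        ∑ s ∈ Finset.Icc 1 (m i), pole (a i) ^ s • (g i s).map RatFunc.C) μ ν =
      pairing (liftDer (functionalDer l)) (A μ ν : Ω[RatFunc K⁄k]) := by
    intro μ ν
    rw [h.pairing_liftDer_eq]
    simp [Matrix.sum_apply, Finset.mul_sum]
  refine ⟨_, rfl, ?_⟩
  ext μ ν
  -- The curvature is evaluated on the constant vector e_ν, whose covariant derivative is the ν-th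
  -- column of the connection matrix.
  have h1 := pairingTwo_baseTwoForms (functionalDer l) (hv (Pi.single ν 1) μ)
  have h2 : (nablaZero k (A.map Subtype.val)
      fun κ => ((Pi.single ν 1 : Fin r → regularFunctions a) κ : RatFunc K)) =
      fun κ => (A κ ν : Ω[RatFunc K⁄k]) := by
    funext κ
    have h3 : ∀ κ, ((Pi.single ν 1 : Fin r → regularFunctions a) κ : RatFunc K) =
        if κ = ν then 1 else 0 := by
      intro κ
      by_cases hκ : κ = ν
      · subst hκ; simp
      · simp [hκ]
    simp only [nablaZero, h3]
    rw [Finset.sum_eq_single ν (fun κ' _ h => by simp [h]) (by simp)]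
    rw [if_pos rfl, one_smul]
    split_ifs <;> simp
  have he := pairingTwo_extDeriv (liftDer (functionalDer l)) ((ddt K).restrictScalars k)
    (fun f => liftDer_ddt_comm _ f) (A μ ν : Ω[RatFunc K⁄k])
  rw [h2, nablaOne, map_add, he, map_sum] at h1
  simp only [pairingTwo_wedge, Matrix.map_apply, ← hθ] at h1
  change liftDer _ (relMatrix A μ ν) - ddt K _ + ∑ x, ((_ : RatFunc K) * relMatrix A x ν -
    relMatrix A μ x * _) = 0 at h1
  rw [Finset.sum_sub_distrib, ← Matrix.mul_apply, ← Matrix.mul_apply] at h1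
  have h4 : liftDer (functionalDer l) (relMatrix A μ ν) =
      liftDer (functionalDer l) (polarMatrix a m g μ ν) := by rw [h.relMatrix_eq]
  -- The moving poles enter twice with opposite signs, through δ(F) and through -dθ/dt, and cancel.
  rw [h4, liftDer_polarMatrix, hθ μ ν, h.pairing_liftDer_eq, map_sub] at h1
  simp only [Matrix.sub_apply, Matrix.map_apply]
  linear_combination h1

end HasEquation

theorem pairing_ddt_baseForms {c : K} {x : Ω[RatFunc K⁄k]} (hx : x ∈ baseForms k c) :
    pairing ((ddt K).restrictScalars k) x = 0 := by
  rw [baseForms] at hx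
  induction hx using Submodule.span_induction with
  | zero => simp
  | add x y _ _ hx hy => rw [map_add, hx, hy, add_zero]
  | smul f x _ hx =>
    have : pairing ((ddt K).restrictScalars k) (f • x) =
        f * pairing ((ddt K).restrictScalars k) x := map_smul _ (f : RatFunc K) x
    rw [this, hx, mul_zero]
  | mem x hx =>
    obtain ⟨y, rfl⟩ := hx
    simp [ddt_C]

theorem HasLocalEquation.relMatrix_eq {c : K} {m M : ℕ} {G : Matrix (Fin r) (Fin r) (localRing c)}
    (h : HasLocalEquation (A.map Subtype.val) c m M G) :
    localParam c ^ m • relMatrix A = G.map Subtype.val := by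
  obtain ⟨B, hB⟩ := h
  ext μ ν
  have h1 := hB μ ν
  rw [Matrix.map_apply] at h1
  rw [Matrix.smul_apply, relMatrix, h1, map_add, map_smul, map_smul, pairing_ddt_baseForms (B μ ν).2]
  simp only [Derivation.liftKaehlerDifferential_comp_D, Derivation.coe_restrictScalars, ddt_localParam,
    smul_eq_mul, mul_one, mul_zero, add_zero, Matrix.map_apply]
  rw [← mul_assoc, localParam_pow_mul_pole_pow, one_mul]

theorem exists_matVal_localRing {c : K} (G : Matrix (Fin r) (Fin r) (localRing c)) :
    ∃ y, MatVal c (G.map Subtype.val) y := by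
  choose y hy using fun μ ν => exists_isVal_of_mem_localRing (G μ ν).2
  exact ⟨y, hy⟩

namespace IsPseudoAdmissible

theorem exists_localEquation (hA : IsPseudoAdmissible a m A) (i : Fin N) :
    1 ≤ m i ∧ ∃ G : Matrix (Fin r) (Fin r) (localRing (a i)), IsUnit G ∧
      HasLocalEquation (A.map Subtype.val) (a i) (m i) (etaOrder (m i)) G := by
  rcases hA i with ⟨h2, G, hG, hG'⟩ | ⟨h1, G, hG, hG'⟩
  · exact ⟨by omega, G, hG, by rwa [etaOrder, if_pos h2]⟩
  · exact ⟨h1.ge, G, hG, by rw [h1, etaOrder, if_neg (by omega)]; exact hG'⟩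

/-- The inverse of G also has entries in the local ring, so both products can be evaluated at a_i.
The inverse is kept as a matrix of functions because the trace of the flatness equation is taken
before expanding. -/
theorem exists_inverse (hA : IsPseudoAdmissible a m A) (i : Fin N) :
    ∃ (G' : Matrix (Fin r) (Fin r) (RatFunc K)) (x y : Matrix (Fin r) (Fin r) K),
      MatVal (a i) (localParam (a i) ^ m i • relMatrix A) x ∧ MatVal (a i) G' y ∧
      (localParam (a i) ^ m i • relMatrix A) * G' = 1 ∧
      G' * (localParam (a i) ^ m i • relMatrix A) = 1 ∧ x * y = 1 ∧ y * x = 1 := by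
  obtain ⟨-, G, ⟨G, rfl⟩, hG⟩ := hA.exists_localEquation i
  obtain ⟨x, hx⟩ := exists_matVal_localRing G.1
  obtain ⟨y, hy⟩ := exists_matVal_localRing G.2
  have h1 : G.1.map Subtype.val * G.2.map Subtype.val = (1 : Matrix _ _ (RatFunc K)) := by
    change G.1.map (localRing (a i)).val * G.2.map (localRing (a i)).val = 1
    rw [← Matrix.map_mul, G.val_inv, Matrix.map_one _ (map_zero _) (map_one _)]
  have h2 : G.2.map Subtype.val * G.1.map Subtype.val = (1 : Matrix _ _ (RatFunc K)) := by
    change G.2.map (localRing (a i)).val * G.1.map (localRing (a i)).val = 1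
    rw [← Matrix.map_mul, G.inv_val, Matrix.map_one _ (map_zero _) (map_one _)]
  rw [hG.relMatrix_eq]
  refine ⟨_, x, y, hx, hy, h1, h2, ?_, ?_⟩
  · have := hx.mul hy
    rw [h1] at this
    exact this.unique (matVal_one _)
  · have := hy.mul hx
    rw [h2] at this
    exact this.unique (matVal_one _)

theorem matVal_relMatrix (hA : IsPseudoAdmissible a m A) (ha : Function.Injective a)
    {g : Fin N → ℕ → Matrix (Fin r) (Fin r) K}
    {η : Fin N → ℕ → Matrix (Fin r) (Fin r) Ω[K⁄k]} {η₀ : Matrix (Fin r) (Fin r) Ω[K⁄k]}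
    (h : HasEquation a m A g η η₀) (i : Fin N) :
    MatVal (a i) (localParam (a i) ^ m i • relMatrix A) (g i (m i)) := by
  have := matVal_polarMatrix ha g i (hA.exists_localEquation i).1 le_rfl
  rwa [if_pos rfl, ← h.relMatrix_eq] at this

theorem hasLeadingTerms (hA : IsPseudoAdmissible a m A) (ha : Function.Injective a) {o : Fin N}
    (ho : 2 ≤ m o) {g : Fin N → ℕ → Matrix (Fin r) (Fin r) K}
    {η : Fin N → ℕ → Matrix (Fin r) (Fin r) Ω[K⁄k]} {η₀ : Matrix (Fin r) (Fin r) Ω[K⁄k]}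
    (h : HasEquation a m A g η η₀) : HasLeadingTerms a m o A fun i => g i (m i) where
  inj := ha
  one_le i := (hA.exists_localEquation i).1
  two_le := ho
  val := hA.matVal_relMatrix ha h
  unit i := by
    obtain ⟨G', x, y, hx, -, -, -, hxy, hyx⟩ := hA.exists_inverse i
    rw [(hA.matVal_relMatrix ha h i).unique hx]
    exact ⟨⟨x, y, hxy, hyx⟩, rfl⟩

theorem exists_inverse_of_hasEquation (hA : IsPseudoAdmissible a m A) (ha : Function.Injective a)
    {g : Fin N → ℕ → Matrix (Fin r) (Fin r) K}
    {η : Fin N → ℕ → Matrix (Fin r) (Fin r) Ω[K⁄k]} {η₀ : Matrix (Fin r) (Fin r) Ω[K⁄k]}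
    (h : HasEquation a m A g η η₀) (i : Fin N) :
    ∃ G' : Matrix (Fin r) (Fin r) (RatFunc K), MatVal (a i) G' (g i (m i))⁻¹ ∧
      (localParam (a i) ^ m i • relMatrix A) * G' = 1 ∧
      G' * (localParam (a i) ^ m i • relMatrix A) = 1 := by
  obtain ⟨G', x, y, hx, hy, h1, h2, hxy, hyx⟩ := hA.exists_inverse i
  rw [(hA.matVal_relMatrix ha h i).unique hx, Matrix.inv_eq_left_inv hyx]
  exact ⟨G', hy, h1, h2⟩

/-- The trace of the flatness equation multiplied by the inverse of the relative connection. -/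
theorem trace_flatness {g : Fin N → ℕ → Matrix (Fin r) (Fin r) K}
    {η : Fin N → ℕ → Matrix (Fin r) (Fin r) Ω[K⁄k]} {η₀ : Matrix (Fin r) (Fin r) Ω[K⁄k]}
    (h : HasEquation a m A g η η₀) (hv : IsVertical A) (l : Ω[K⁄k] →ₗ[K] K) {i : Fin N}
    {G' : Matrix (Fin r) (Fin r) (RatFunc K)}
    (h1 : (localParam (a i) ^ m i • relMatrix A) * G' = 1)
    (h2 : G' * (localParam (a i) ^ m i • relMatrix A) = 1) :
    (G' * (localParam (a i) ^ m i • polarMatrix a m fun i s => (g i s).map (functionalDer l))).trace =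
      (G' * (localParam (a i) ^ m i • (etaMatrix a m η η₀ l).map (ddt K))).trace := by
  obtain ⟨θ, -, hθ⟩ := h.flatness hv l
  -- The difference of the two sides is tr(F⁻¹ [F, θ]), which is zero; the power of the local
  -- parameter cancels.
  rw [← sub_eq_zero, ← Matrix.trace_sub, ← Matrix.mul_sub, ← smul_sub, hθ, smul_sub, Matrix.mul_sub,
    ← Matrix.smul_mul, ← Matrix.mul_smul, ← Matrix.mul_assoc, h2, Matrix.one_mul, Matrix.trace_sub,
    Matrix.trace_mul_comm G', Matrix.mul_assoc, h1, Matrix.mul_one, sub_self]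

variable {g : Fin N → ℕ → Matrix (Fin r) (Fin r) K}
  {η : Fin N → ℕ → Matrix (Fin r) (Fin r) Ω[K⁄k]} {η₀ : Matrix (Fin r) (Fin r) Ω[K⁄k]}

/-- The leading term of η has order m_i - 1, so dη/dt has order m_i and picks up the factor -(m_i -
1). Both sides of `trace_flatness` then have values at a_i. -/
theorem trace_inv_mul_der_of_two_le (hA : IsPseudoAdmissible a m A) (ha : Function.Injective a)
    (h : HasEquation a m A g η η₀) (hv : IsVertical A) (l : Ω[K⁄k] →ₗ[K] K) {i : Fin N}
    (hi : 2 ≤ m i) :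
    ((g i (m i))⁻¹ * (g i (m i)).map (functionalDer l)).trace =
      -((m i : K) - 1) * ((g i (m i))⁻¹ * (η i (m i - 1)).map l).trace := by
  obtain ⟨G', hG, h1, h2⟩ := hA.exists_inverse_of_hasEquation ha h i
  have h3 := matVal_polarMatrix ha (S := m) (fun i s => (g i s).map (functionalDer l)) i
    (by omega : 1 ≤ m i) le_rfl
  rw [if_pos rfl] at h3
  have h4 := matVal_ddt ha (etaMatrix_mem η η₀ l) i
    (matVal_etaMatrix (m := m) ha η η₀ l i (by omega : 1 ≤ m i))
  have h5 : etaOrder (m i) = m i - 1 := by rw [etaOrder, if_pos hi]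
  rw [h5, Nat.sub_add_cancel (by omega : 1 ≤ m i), Nat.cast_sub (by omega), Nat.cast_one] at h4
  have h6 := (hG.mul h3).trace
  rw [trace_flatness h hv l h1 h2] at h6
  rw [h6.unique (hG.mul h4).trace, Matrix.mul_smul, Matrix.trace_smul, smul_eq_mul]

/-- This is the coefficient of z^(-2) in the flatness equation. The derivative of g has only a
simple pole, -dη/dt contributes η_1, and the multiple of g_1 contained in θ commutes with g_1. -/
theorem eta_eq_commutator (hA : IsPseudoAdmissible a m A) (ha : Function.Injective a)
    (h : HasEquation a m A g η η₀) (hv : IsVertical A) (l : Ω[K⁄k] →ₗ[K] K) {i : Fin N}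
    (hi : m i = 1) :
    (η i 1).map l = g i 1 * (η i 1).map l - (η i 1).map l * g i 1 := by
  obtain ⟨θ, hθ, hflat⟩ := h.flatness hv l
  have hz := isVal_localParam_self (a i)
  have he : etaOrder (m i) = 1 := by rw [hi]; rfl
  have h1 := matVal_polarMatrix ha (S := m) (fun i s => (g i s).map (functionalDer l)) i
    (n := 2) (by omega) (by omega)
  rw [if_neg (by omega)] at h1
  have h2 := matVal_etaMatrix (m := m) ha η η₀ l i hi.ge
  have h3 := matVal_ddt ha (etaMatrix_mem η η₀ l) i h2
  rw [he] at h2 h3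
  have h4 := hA.matVal_relMatrix ha h i
  rw [hi] at h4
  have h5 : MatVal (a i) (localParam (a i) ^ 1 • θ)
      ((η i 1).map l - functionalDer l (a i) • g i 1) := by
    have h6 := matVal_polarMatrix ha (S := m) (fun j s => functionalDer l (a j) • g j s) i
      (n := 1) le_rfl hi.le
    rw [if_pos hi] at h6
    refine (h2.sub h6).congr ?_ rfl
    rw [hθ, smul_sub]
    congr 2
    refine Finset.sum_congr rfl fun j _ => ?_
    rw [Finset.smul_sum]
    refine Finset.sum_congr rfl fun s _ => ?_
    ext μ ν
    simp
    ring
  have h7 := ((h4.mul h5).sub (h5.mul h4)).unique ((h1.sub h3).congr (by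
    rw [← smul_sub, hflat, smul_sub, Matrix.smul_mul, Matrix.mul_smul, Matrix.smul_mul,
      Matrix.mul_smul, smul_smul, smul_smul, ← pow_add]) rfl)
  rw [Matrix.mul_sub, Matrix.sub_mul, Matrix.mul_smul, Matrix.smul_mul, sub_sub_sub_cancel_right]
    at h7
  rw [h7]
  simp

/-- As the trace of g⁻¹ η_1 vanishes, the next order counts. With F = g/z + f + ... one has (zF)⁻¹ =
g⁻¹ - z g⁻¹ f g⁻¹ + ..., and its second term meets z dη/dt = -η_1/z + .... -/
theorem trace_inv_mul_der_of_eq_one (hA : IsPseudoAdmissible a m A) (ha : Function.Injective a)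
    (h : HasEquation a m A g η η₀) (hv : IsVertical A) (l : Ω[K⁄k] →ₗ[K] K) {i : Fin N}
    (hi : m i = 1) (htr : ((g i 1)⁻¹ * (η i 1).map l).trace = 0) {f : Matrix (Fin r) (Fin r) K}
    (hg : IsUnit (g i 1))
    (hf : MatVal (a i) (relMatrix A - pole (a i) • (g i 1).map RatFunc.C) f) :
    ((g i 1)⁻¹ * (g i 1).map (functionalDer l)).trace =
      ((g i 1)⁻¹ * f * (g i 1)⁻¹ * (η i 1).map l).trace := by
  obtain ⟨G', hG, h1, h2⟩ := hA.exists_inverse_of_hasEquation ha h i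
  have he : etaOrder (m i) = 1 := by rw [hi]; rfl
  have h3 := matVal_polarMatrix ha (S := m) (fun i s => (g i s).map (functionalDer l)) i
    (n := m i) hi.ge le_rfl
  have h0 := trace_flatness h hv l h1 h2
  rw [if_pos rfl] at h3
  rw [hi, pow_one] at h1 h2 h3 h0
  rw [hi] at hG
  obtain ⟨e, hE⟩ := exists_matVal_polarMatrix_sub ha (S := fun i => etaOrder (m i))
    (fun i s => (η i s).map l) i he
  set R := etaMatrix a m η η₀ l - pole (a i) • ((η i 1).map l).map RatFunc.C with hR
  have hRval : MatVal (a i) R (e + η₀.map l) :=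
    (hE.add (matVal_C (a i) (η₀.map l))).congr (by rw [hR, etaMatrix]; abel) rfl
  have hRmem : ∀ μ ν, R μ ν ∈ regularFunctions a := fun μ ν =>
    sub_mem (etaMatrix_mem η η₀ l μ ν) (mul_mem (pole_mem a i) (Subalgebra.algebraMap_mem _ _))
  have h4 := matVal_ddt ha hRmem i (n := 0) (hRval.congr (by simp) rfl)
  rw [zero_add, pow_one, Nat.cast_zero, neg_zero, zero_smul] at h4
  have h5 : localParam (a i) • (etaMatrix a m η η₀ l).map (ddt K) =
      localParam (a i) • R.map (ddt K) - pole (a i) • ((η i 1).map l).map RatFunc.C := by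
    ext μ ν
    have hp := ddt_pole_pow (a i) 1
    rw [pow_one] at hp
    simp only [hR, Matrix.smul_apply, Matrix.map_apply, Matrix.sub_apply, map_sub,
      Derivation.leibniz, ddt_C, smul_eq_mul, hp]
    have := localParam_mul_pole (a i)
    linear_combination (-RatFunc.C (l (η i 1 μ ν)) * pole (a i)) * this
  -- An exact identity in place of the first-order expansion of (zF)⁻¹: the remainder is absorbed in
  -- the last factor `G'`.
  have h6 : G' = (g i 1)⁻¹.map RatFunc.C - ((g i 1)⁻¹.map RatFunc.C *
      (localParam (a i) • (relMatrix A - pole (a i) • (g i 1).map RatFunc.C))) * G' := by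
    have hgg : (g i 1)⁻¹.map RatFunc.C * (g i 1).map RatFunc.C =
        (1 : Matrix (Fin r) (Fin r) (RatFunc K)) := by
      rw [← Matrix.map_mul, Matrix.nonsing_inv_mul _ ((Matrix.isUnit_iff_isUnit_det _).mp hg)]
      simp
    rw [smul_sub, smul_smul, localParam_mul_pole, one_smul, Matrix.mul_sub, hgg, Matrix.sub_mul,
      Matrix.mul_assoc, h1, Matrix.mul_one, Matrix.one_mul]
    abel
  have h7 : (G' * (pole (a i) • ((η i 1).map l).map RatFunc.C)).trace =
      -((g i 1)⁻¹.map RatFunc.C * (relMatrix A - pole (a i) • (g i 1).map RatFunc.C) * G' *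
        ((η i 1).map l).map RatFunc.C).trace := by
    have htr' : ((g i 1)⁻¹.map RatFunc.C * ((η i 1).map l).map RatFunc.C).trace = 0 := by
      rw [← Matrix.map_mul, ← AddMonoidHom.map_trace, htr, map_zero]
    conv_lhs => rw [h6]
    rw [Matrix.mul_smul, Matrix.sub_mul, Matrix.trace_smul, Matrix.trace_sub, htr', zero_sub,
      Matrix.mul_smul, Matrix.smul_mul, Matrix.smul_mul, Matrix.trace_smul, smul_eq_mul, smul_eq_mul,
      mul_neg, ← mul_assoc, mul_comm (pole (a i)), localParam_mul_pole, one_mul]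
  rw [h5, Matrix.mul_sub, Matrix.trace_sub, h7, sub_neg_eq_add] at h0
  have h8 := (hG.mul h3).trace
  rw [h0] at h8
  have h9 := h8.unique ((hG.mul h4).trace.add
    (((((matVal_C (a i) (g i 1)⁻¹).mul hf).mul hG).mul (matVal_C (a i) ((η i 1).map l))).trace))
  rw [h9, Matrix.mul_zero, Matrix.trace_zero, zero_add]

end IsPseudoAdmissible

end Equations

/-! ### Traces with values in a vector space -/

section TensorTraces

variable {K V M : Type*} [Field K] [AddCommGroup V] [Module K V] [AddCommGroup M] [Module K M]

/-- The contraction of the second factor of a tensor product with a functional. -/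
def contractRight (V : Type*) [AddCommGroup V] [Module K V] (l : M →ₗ[K] K) : V ⊗[K] M →ₗ[K] V :=
  (TensorProduct.rid K V).toLinearMap ∘ₗ l.lTensor V

theorem contractRight_tmul (l : M →ₗ[K] K) (v : V) (x : M) :
    contractRight V l (v ⊗ₜ x) = l x • v := by
  simp [contractRight]

theorem contractRight_rTensor {W : Type*} [AddCommGroup W] [Module K W] (l : M →ₗ[K] K)
    (f : V →ₗ[K] W) (t : V ⊗[K] M) :
    contractRight W l (f.rTensor M t) = f (contractRight V l t) := by
  induction t with
  | zero => simp
  | add x y hx hy => simp only [map_add, hx, hy]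
  | tmul v x => simp [contractRight_tmul]

/-- Contraction with a functional turns the form-valued trace into an ordinary one, so the whole
trace computation takes place over K. -/
theorem apply_tensorTrace [Module.Finite K V] (l : M →ₗ[K] K) (φ : V →ₗ[K] V ⊗[K] M) :
    l (tensorTrace φ) = LinearMap.trace K V (contractRight V l ∘ₗ φ) := by
  rw [LinearMap.trace_eq_matrix_trace K (Module.finBasis K V), tensorTrace, map_sum, Matrix.trace]
  refine Finset.sum_congr rfl fun j _ => ?_
  rw [Matrix.diag_apply, LinearMap.toMatrix_apply, LinearMap.comp_apply]
  have h : ∀ t : K ⊗[K] M, l (TensorProduct.lid K M t) = contractRight K l t := by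
    intro t
    induction t with
    | zero => simp
    | add x y hx hy => simp only [map_add, hx, hy]
    | tmul v x => simp [contractRight_tmul, mul_comm]
  rw [h, contractRight_rTensor]
  rfl

theorem contractRight_inducedOperator {W P : Submodule K V} (h : IsCompl W P) (l : M →ₗ[K] K)
    (φ : V →ₗ[K] V ⊗[K] M) : contractRight W l ∘ₗ inducedOperator h φ =
      W.projectionOnto P h ∘ₗ (contractRight V l ∘ₗ φ) ∘ₗ W.subtype := by
  ext x
  simp only [inducedOperator, LinearMap.comp_apply, contractRight_rTensor]

theorem map_sum_sum_sum_smul {W ι ι' ι'' : Type*} [AddCommGroup W] [Module K W] (f : V →ₗ[K] W)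
    (s : Finset ι) (t : ι → Finset ι') (u : Finset ι'') (c : ι → ι' → ι'' → K)
    (v : ι → ι' → ι'' → V) :
    f (∑ i ∈ s, ∑ j ∈ t i, ∑ l ∈ u, c i j l • v i j l) =
      ∑ i ∈ s, ∑ j ∈ t i, ∑ l ∈ u, c i j l • f (v i j l) := by
  simp only [map_sum, map_smul]

theorem trace_eq_sum_of_apply_eq [Module.Finite K V] {ι ι' ι'' : Type*} {φ : V →ₗ[K] V}
    (s : Finset ι) (t : ι → Finset ι') (u : Finset ι'') (c : ι → ι' → ι'' → V →ₗ[K] K)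
    (v : ι → ι' → ι'' → V)
    (h : ∀ x, φ x = ∑ i ∈ s, ∑ j ∈ t i, ∑ l ∈ u, c i j l x • v i j l) :
    LinearMap.trace K V φ = ∑ i ∈ s, ∑ j ∈ t i, ∑ l ∈ u, c i j l (v i j l) := by
  have h1 : φ = ∑ i ∈ s, ∑ j ∈ t i, ∑ l ∈ u, (c i j l).smulRight (v i j l) := by
    ext x
    simp only [h, LinearMap.sum_apply, LinearMap.smulRight_apply]
  rw [h1]
  simp only [map_sum, LinearMap.trace_smulRight]

end TensorTraces

/-! ### Multiplication by η -/

section EtaOperator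

variable {k K : Type*} [Field k] [Field K] [Algebra k K] {N r : ℕ} {a : Fin N → K} {m : Fin N → ℕ}
  (η : Fin N → ℕ → Matrix (Fin r) (Fin r) Ω[K⁄k]) (η₀ : Matrix (Fin r) (Fin r) Ω[K⁄k])

theorem relCoef_mulFun (f : regularFunctions a) (y : relForms a) :
    relCoef a (mulFun a f y) = f * relCoef a y :=
  relCoef_smul f y

theorem relVec_contractRight_mulForm (l : Ω[K⁄k] →ₗ[K] K) (f : regularFunctions a)
    (B : Matrix (Fin r) (Fin r) Ω[K⁄k]) (x : FormSections a r) :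
    relVec a r (contractRight _ l (mulForm a f B x)) =
      ((f : RatFunc K) • (B.map l).map RatFunc.C).mulVec (relVec a r x) := by
  change relVec a r (contractRight _ l
    (∑ μ, ∑ ν, (Pi.single μ (mulFun a f (x ν)) : FormSections a r) ⊗ₜ[K] B μ ν)) = _
  simp only [map_sum, contractRight_tmul, map_smul]
  funext κ
  rw [Finset.sum_apply, Finset.sum_eq_single κ]
  · rw [Finset.sum_apply]
    refine Finset.sum_congr rfl fun ν _ => ?_
    rw [Pi.smul_apply, relVec_apply, Pi.single_eq_same, RatFunc.smul_eq_C_mul]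
    rw [relCoef_mulFun, relVec_apply]
    change _ = ((f : RatFunc K) * RatFunc.C (l (B κ ν))) * relCoef a (x ν)
    ring
  · intro μ _ hμ
    rw [Finset.sum_apply]
    refine Finset.sum_eq_zero fun ν _ => ?_
    rw [Pi.smul_apply, relVec_apply, Pi.single_eq_of_ne hμ.symm, map_zero, smul_zero]
  · simp

variable (a m)

/-- Multiplication by `η`, contracted with a functional. -/
def etaOperator (l : Ω[K⁄k] →ₗ[K] K) : FormSections a r →ₗ[K] FormSections a r :=
  contractRight _ l ∘ₗ mulEta a m η η₀

variable {a m}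

theorem relVec_etaOperator (l : Ω[K⁄k] →ₗ[K] K) (x : FormSections a r) :
    relVec a r (etaOperator a m η η₀ l x) = (etaMatrix a m η η₀ l).mulVec (relVec a r x) := by
  rw [etaOperator, LinearMap.comp_apply, mulEta, LinearMap.add_apply, map_add, map_add,
    relVec_contractRight_mulForm, LinearMap.sum_apply, map_sum, map_sum, etaMatrix,
    Matrix.add_mulVec, polarMatrix, Matrix.sum_mulVec]
  congr 1
  · refine Finset.sum_congr rfl fun i _ => ?_
    rw [LinearMap.sum_apply, map_sum, map_sum, Matrix.sum_mulVec]
    refine Finset.sum_congr rfl fun s _ => ?_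
    rw [relVec_contractRight_mulForm]
    rfl
  · rw [OneMemClass.coe_one, one_smul]

theorem vecVal_etaOperator (ha : Function.Injective a) (l : Ω[K⁄k] →ₗ[K] K) {i : Fin N}
    (hm : 1 ≤ m i) {n : ℕ} {w : FormSections a r} {x : Fin r → K}
    (h : VecVal (a i) (localParam (a i) ^ n • relVec a r w) x) :
    VecVal (a i) (localParam (a i) ^ (etaOrder (m i) + n) • relVec a r (etaOperator a m η η₀ l w))
      (((η i (etaOrder (m i))).map l).mulVec x) := by
  refine ((matVal_etaMatrix ha η η₀ l i hm).mulVec h).congr ?_ rfl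
  rw [relVec_etaOperator, Matrix.smul_mulVec, Matrix.mulVec_smul, smul_smul, ← pow_add]

end EtaOperator

/-! ### The difference of traces as a sum of local contributions -/

section TraceFormula

variable {k K : Type*} [Field k] [Field K] [Algebra k K] {N r : ℕ}
  {a : Fin N → K} {m : Fin N → ℕ} {o : Fin N}
  {A : Matrix (Fin r) (Fin r) (absForms k a)} {g : Fin N → Matrix (Fin r) (Fin r) K}

/-- The section `e_μ / (t - a i) ^ s`. -/
def monomialSection (a : Fin N → K) (i : Fin N) (s : ℕ) (μ : Fin r) : Sections a r :=
  Pi.single μ ((⟨pole (a i), pole_mem a i⟩ : regularFunctions a) ^ s)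

/-- The derivative of sections in the direction of the projective line. -/
abbrev relDerivative (a : Fin N → K) (r : ℕ) : Sections a r →ₗ[K] FormSections a r :=
  (relDiff a).compLeft (Fin r)

theorem relVec_relDerivative_monomialSection (i : Fin N) (s : ℕ) (μ : Fin r) :
    relVec a r (relDerivative a r (monomialSection a i s μ)) =
      pole (a i) ^ (s + 1) • (RatFunc.C ∘ Pi.single μ (-(s : K))) := by
  rw [relVec_relDiff]
  funext ν
  by_cases h : ν = μ
  · subst h
    have : secVec a r (monomialSection a i s ν) ν = pole (a i) ^ s := by
      rw [secVec_apply, monomialSection, Pi.single_eq_same]; rfl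
    rw [this, ddt_pole_pow]
    simp [mul_comm]
  · have : secVec a r (monomialSection a i s μ) ν = 0 := by
      rw [secVec_apply, monomialSection, Pi.single_eq_of_ne h]; rfl
    rw [this]
    simp [h]

theorem vecVal_relDerivative_monomialSection (i : Fin N) (s : ℕ) (μ : Fin r) :
    VecVal (a i) (localParam (a i) ^ (s + 1) •
      relVec a r (relDerivative a r (monomialSection a i s μ))) (Pi.single μ (-(s : K))) := by
  rw [relVec_relDerivative_monomialSection, smul_smul, localParam_pow_mul_pole_pow, one_smul]
  exact vecVal_C _ _

theorem poleOrderLE_relDerivative_monomialSection (ha : Function.Injective a) {i j : Fin N}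
    (hij : j ≠ i) (s : ℕ) (μ : Fin r) :
    PoleOrderLE (a j) 0 (relVec a r (relDerivative a r (monomialSection a i s μ))) := by
  rw [relVec_relDerivative_monomialSection]
  exact (VecVal.smul ((isVal_pole (ha.ne hij)).pow _) (vecVal_C _ _)).poleOrderLE

/-- The maximal pole orders of the sections which contribute to the difference of the traces. -/
def sOrder (m : Fin N → ℕ) (o i : Fin N) : ℕ := if i = o then m i - 2 else etaOrder (m i)

theorem relDerivative_eq_sum (ha : Function.Injective a) {S : Fin N → ℕ} {u : Sections a r}
    (hu : ∀ i, PoleOrderLE (a i) (S i) (secVec a r u)) :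
    relDerivative a r u = ∑ i, ∑ s ∈ Finset.Icc 1 (S i), ∑ μ,
      coef (a i) s (secVec a r u μ) • relDerivative a r (monomialSection a i s μ) := by
  apply relVec_injective
  simp only [map_sum, map_smul, relVec_relDerivative_monomialSection]
  rw [relVec_relDiff]
  funext ν
  obtain ⟨x, hx⟩ := eq_C_add_polarSum ha (u ν).2 (S := S) fun i => ⟨_, (hu i).choose_spec ν⟩
  conv_lhs => rw [secVec_apply, hx]
  rw [map_add, ddt_C, zero_add, polarSum, map_sum, Finset.sum_apply]
  refine Finset.sum_congr rfl fun i _ => ?_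
  rw [map_sum, Finset.sum_apply]
  refine Finset.sum_congr rfl fun s _ => ?_
  rw [Finset.sum_apply, Finset.sum_eq_single ν (fun μ _ h => by simp [h.symm]) (by simp),
    Derivation.leibniz, ddt_C, ddt_pole_pow]
  simp only [Pi.smul_apply, smul_eq_mul, Function.comp_apply, Pi.single_eq_same,
    RatFunc.smul_eq_C_mul, map_neg, map_natCast, secVec_apply]
  ring

namespace HasLeadingTerms

theorem poleOrderLE_retraction (h : HasLeadingTerms a m o A g) {ε : K}
    (hg : ∀ i n, 1 ≤ n → IsUnit (leadMatrix ε (m i) n (g i)))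
    {P : FormSections a r →ₗ[K] Sections a r}
    (hP : ∀ w, w - epsConnection A ε (P w) ∈ H a m o r) {w : FormSections a r} {i : Fin N} {n : ℕ}
    (hw : PoleOrderLE (a i) (m i + n) (relVec a r w)) : PoleOrderLE (a i) n (secVec a r (P w)) := by
  refine poleOrderLE_of_epsConnection h.inj (h.one_le i) (h.val i) ε
    (fun l hl => hg i l (by omega)) ?_
  have h1 := hw.sub ((h.poleOrderLE_of_mem_H (hP w) i).mono (Nat.le_add_right _ n))
  rwa [← map_sub, sub_sub_cancel] at h1

/-- P divides a leading coefficient by the leading matrix, because the H-component of w has order at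
most m_i, below m_i + n. -/
theorem coef_retraction (h : HasLeadingTerms a m o A g) {ε : K}
    (hg : ∀ i n, 1 ≤ n → IsUnit (leadMatrix ε (m i) n (g i)))
    {P : FormSections a r →ₗ[K] Sections a r}
    (hP : ∀ w, w - epsConnection A ε (P w) ∈ H a m o r) {w : FormSections a r} {i : Fin N} {n : ℕ}
    (hn : 1 ≤ n) {y : Fin r → K}
    (hw : VecVal (a i) (localParam (a i) ^ (m i + n) • relVec a r w) y) (μ : Fin r) :
    coef (a i) n (secVec a r (P w) μ) = ((leadMatrix ε (m i) n (g i))⁻¹.mulVec y) μ := by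
  obtain ⟨x, hx⟩ := h.poleOrderLE_retraction hg hP ⟨y, hw⟩
  have h1 := vecVal_epsConnection h.inj (h.one_le i) (h.val i) ε hx
  obtain ⟨z, hz⟩ := h.poleOrderLE_of_mem_H (hP w) i
  have h2 := hw.sub (hz.of_lt (Nat.lt_add_of_pos_right (n := m i) hn))
  rw [← smul_sub, ← map_sub, sub_sub_cancel, sub_zero] at h2
  rw [(hx μ).coef_eq, ← h1.unique h2, Matrix.mulVec_mulVec,
    Matrix.nonsing_inv_mul _ ((Matrix.isUnit_iff_isUnit_det _).mp (hg i n hn)), Matrix.one_mulVec]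

/-- The difference of the traces of the Higgs operator and of the de Rham operator, as a sum of
coefficients of polar parts. -/
theorem trace_sub_trace (h : HasLeadingTerms a m o A g)
    (hg : ∀ i n, 1 ≤ n → IsUnit (leadMatrix 1 (m i) n (g i)))
    (η : Fin N → ℕ → Matrix (Fin r) (Fin r) Ω[K⁄k]) (η₀ : Matrix (Fin r) (Fin r) Ω[K⁄k])
    (l : Ω[K⁄k] →ₗ[K] K) (hγ : IsCompl (H a m o r) (LinearMap.range (higgsField A)))
    (hd : IsCompl (H a m o r) (LinearMap.range (relConnection A)))
    {P : FormSections a r →ₗ[K] Sections a r}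
    (hP : ∀ w, w - epsConnection A 1 (P w) ∈ H a m o r) :
    l (tensorTrace (inducedOperator hγ (mulEta a m η η₀) - inducedOperator hd (mulEta a m η η₀))) =
      ∑ i, ∑ s ∈ Finset.Icc 1 (sOrder m o i), ∑ μ, coef (a i) s (secVec a r (P (etaOperator a m η η₀ l
        ((H a m o r).projectionOnto _ hγ (relDerivative a r (monomialSection a i s μ))))) μ) := by
  set πγ := (H a m o r).projectionOnto _ hγ
  set πd := (H a m o r).projectionOnto _ hd
  set S := etaOperator a m η η₀ l
  -- On w - ∇(P w), an element of H, both projections are the identity. π_∇ kills ∇(P w) and π_γ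
  -- kills γ(P w), so only the derivative of P w survives.
  have h1 : ∀ w, πγ w - πd w = πγ (relDerivative a r (P w)) := by
    intro w
    have e1 : πd (epsConnection A 1 (P w)) = 0 :=
      Submodule.projectionOnto_apply_of_mem_right hd ⟨P w, by rw [epsConnection_one]⟩
    have e2 : πγ (higgsField A (P w)) = 0 :=
      Submodule.projectionOnto_apply_of_mem_right hγ ⟨P w, rfl⟩
    have e3 : πγ (w - epsConnection A 1 (P w)) = πd (w - epsConnection A 1 (P w)) :=
      (Submodule.projectionOnto_apply_of_mem_left hγ (hP w)).trans
        (Submodule.projectionOnto_apply_of_mem_left hd (hP w)).symm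
    have e4 : epsConnection A 1 (P w) = relDerivative a r (P w) + higgsField A (P w) := by
      rw [epsConnection_one]; rfl
    rw [map_sub, map_sub, e1, sub_zero, e4, map_add, e2, add_zero] at e3
    rw [← e3, sub_sub_cancel]
  have h2 : ∀ x, (contractRight (H a m o r) l ∘ₗ (inducedOperator hγ (mulEta a m η η₀) -
      inducedOperator hd (mulEta a m η η₀))) x =
      ∑ i, ∑ s ∈ Finset.Icc 1 (sOrder m o i), ∑ μ,
        (coef (a i) s ∘ₗ LinearMap.proj μ ∘ₗ secVec a r ∘ₗ P ∘ₗ S ∘ₗ (H a m o r).subtype) x •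
        πγ (relDerivative a r (monomialSection a i s μ)) := by
    intro x
    rw [LinearMap.comp_sub, contractRight_inducedOperator, contractRight_inducedOperator]
    change πγ (S x) - πd (S x) = _
    -- η raises the order of x by M_i and P lowers it by m_i. This leaves M_i for i ≠ o, and (m_o -
    -- 1) + (m_o - 1) - m_o = m_o - 2 at a_o.
    have h3 : ∀ i, PoleOrderLE (a i) (sOrder m o i) (secVec a r (P (S x))) := by
      intro i
      refine h.poleOrderLE_retraction hg hP ?_
      obtain ⟨y, hy⟩ := HiggsDeRham.poleOrderLE_of_mem_H h.inj h.one_le h.two_le x.2 i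
      have := vecVal_etaOperator η η₀ h.inj l (h.one_le i) hy
      refine PoleOrderLE.mono ⟨_, this⟩ ?_
      have h2 := h.two_le
      by_cases hio : i = o
      · subst hio
        rw [hOrder, sOrder, etaOrder, if_pos h2, if_pos rfl, if_pos rfl]
        omega
      · rw [hOrder, sOrder, if_neg hio, if_neg hio]
        omega
    rw [h1, relDerivative_eq_sum h.inj h3, map_sum_sum_sum_smul]
    rfl
  rw [apply_tensorTrace, trace_eq_sum_of_apply_eq _ _ _ _ _ h2]
  rfl

/-- The derivative of e_μ z^(-s) has order s + 1, within the bound for H, so the projection does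
nothing. The factors -s, η_(m_i-1) and g⁻¹ come from d, η and P acting on leading coefficients. -/
theorem sum_coef_of_two_le (h : HasLeadingTerms a m o A g)
    (hg : ∀ i n, 1 ≤ n → IsUnit (leadMatrix 1 (m i) n (g i)))
    (η : Fin N → ℕ → Matrix (Fin r) (Fin r) Ω[K⁄k]) (η₀ : Matrix (Fin r) (Fin r) Ω[K⁄k])
    (l : Ω[K⁄k] →ₗ[K] K) (hγ : IsCompl (H a m o r) (LinearMap.range (higgsField A)))
    {P : FormSections a r →ₗ[K] Sections a r}
    (hP : ∀ w, w - epsConnection A 1 (P w) ∈ H a m o r) {i : Fin N} (hi : 2 ≤ m i) {s : ℕ}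
    (hs : s ∈ Finset.Icc 1 (sOrder m o i)) :
    ∑ μ, coef (a i) s (secVec a r (P (etaOperator a m η η₀ l
        ((H a m o r).projectionOnto _ hγ (relDerivative a r (monomialSection a i s μ))))) μ) =
      -(s : K) * ((g i)⁻¹ * (η i (m i - 1)).map l).trace := by
  have he : etaOrder (m i) = m i - 1 := by rw [etaOrder, if_pos hi]
  obtain ⟨hs1, hs2⟩ := Finset.mem_Icc.mp hs
  rw [Matrix.trace, Finset.mul_sum]
  refine Finset.sum_congr rfl fun μ _ => ?_
  have h1 : relDerivative a r (monomialSection a i s μ) ∈ H a m o r := by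
    refine mem_H_of_poleOrderLE h.inj h.one_le_hOrder fun j => ?_
    by_cases hj : j = i
    · subst hj
      refine PoleOrderLE.mono ⟨_, vecVal_relDerivative_monomialSection j s μ⟩ ?_
      rw [sOrder] at hs2
      rw [hOrder]
      split_ifs at hs2 ⊢ <;> omega
    · exact (poleOrderLE_relDerivative_monomialSection h.inj hj s μ).mono (Nat.zero_le _)
  rw [Submodule.projectionOnto_apply_of_mem_left hγ h1]
  have h2 := vecVal_etaOperator η η₀ h.inj l (h.one_le i)
    (vecVal_relDerivative_monomialSection (a := a) i s μ)
  rw [show etaOrder (m i) + (s + 1) = m i + s by omega] at h2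
  rw [h.coef_retraction hg hP hs1 h2, leadMatrix_of_two_le _ hi, Matrix.mulVec_mulVec, he,
    Matrix.mulVec_single]
  simp [mul_comm]

/-- At such a point -e_μ z^(-2) exceeds the pole bound for H. Its projection is found by adding γ u
with u = (1/z - 1/(a_o - a_i)) g⁻¹ e_μ: the first term cancels the double pole, and u vanishes at
a_o, so that the order there stays at most m_o - 1. -/
theorem sum_coef_of_eq_one (h : HasLeadingTerms a m o A g)
    (hg : ∀ i n, 1 ≤ n → IsUnit (leadMatrix 1 (m i) n (g i)))
    (η : Fin N → ℕ → Matrix (Fin r) (Fin r) Ω[K⁄k]) (η₀ : Matrix (Fin r) (Fin r) Ω[K⁄k])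
    (l : Ω[K⁄k] →ₗ[K] K) (hγ : IsCompl (H a m o r) (LinearMap.range (higgsField A)))
    {P : FormSections a r →ₗ[K] Sections a r}
    (hP : ∀ w, w - epsConnection A 1 (P w) ∈ H a m o r) {i : Fin N} (hi : m i = 1)
    {f : Matrix (Fin r) (Fin r) K}
    (hf : MatVal (a i) (relMatrix A - pole (a i) • (g i).map RatFunc.C) f) :
    ∑ μ, coef (a i) 1 (secVec a r (P (etaOperator a m η η₀ l
        ((H a m o r).projectionOnto _ hγ (relDerivative a r (monomialSection a i 1 μ))))) μ) =
      ((g i - 1)⁻¹ * (η i 1).map l * (f * (g i)⁻¹ - (a o - a i)⁻¹ • 1)).trace := by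
  have hio : o ≠ i := by
    rintro rfl
    have := h.two_le
    omega
  have hginv : g i * (g i)⁻¹ = 1 :=
    Matrix.mul_nonsing_inv _ ((Matrix.isUnit_iff_isUnit_det _).mp (h.unit i))
  rw [Matrix.trace]
  refine Finset.sum_congr rfl fun μ _ => ?_
  set v := (g i)⁻¹.mulVec (Pi.single μ 1) with hv
  have hgv : (g i).mulVec v = Pi.single μ 1 := by
    rw [hv, Matrix.mulVec_mulVec, hginv, Matrix.one_mulVec]
  set u : Sections a r := polarSection a 1 (Pi.single i v) - constSection a ((a o - a i)⁻¹ • v)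
  have hu : secVec a r u = (pole (a i) - RatFunc.C (a o - a i)⁻¹) • (RatFunc.C ∘ v) := by
    rw [map_sub, secVec_polarSection, secVec_constSection,
      Finset.sum_eq_single i (fun j _ hj => by rw [Pi.single_eq_of_ne hj]; ext; simp) (by simp),
      Pi.single_eq_same, sub_smul, pow_one]
    congr 1
    ext
    simp
  have huo : VecVal (a o) (localParam (a o) ^ 0 • secVec a r u) 0 := by
    refine (VecVal.smul ((isVal_pole (h.inj.ne hio)).sub (isVal_C (a o) (a o - a i)⁻¹)) (vecVal_C _ v)).congr
      ?_ ?_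
    · rw [hu, pow_zero, one_smul]
    · rw [sub_self, zero_smul]
  have hui : VecVal (a i) (localParam (a i) ^ 1 • secVec a r u) v := by
    refine (VecVal.smul ((isVal_one (a i)).sub ((isVal_localParam_self (a i)).mul
      (isVal_C (a i) (a o - a i)⁻¹))) (vecVal_C _ v)).congr ?_ (by simp)
    rw [hu, smul_smul, mul_sub, pow_one, localParam_mul_pole]
  have hDi := vecVal_relDerivative_monomialSection (a := a) i 1 μ
  rw [Nat.cast_one] at hDi
  have hmem : relDerivative a r (monomialSection a i 1 μ) + epsConnection A 0 u ∈ H a m o r := by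
    refine mem_H_of_poleOrderLE h.inj h.one_le_hOrder fun j => ?_
    rw [map_add, hOrder]
    by_cases hj : j = i
    · subst hj
      rw [if_neg (Ne.symm hio)]
      refine PoleOrderLE.of_zero ?_
      have h1 := vecVal_epsConnection h.inj (h.one_le j) (h.val j) 0 hui
      rw [leadMatrix_zero_left, hgv, hi] at h1
      rw [hi, smul_add]
      refine (hDi.add h1).congr rfl ?_
      rw [← Pi.single_add]
      simp
    · refine ((poleOrderLE_relDerivative_monomialSection h.inj hj 1 μ).mono (Nat.zero_le _)).add ?_
      by_cases hjo : j = o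
      · subst hjo
        rw [if_pos rfl]
        refine PoleOrderLE.of_zero ?_
        have h1 := vecVal_epsConnection h.inj (h.one_le j) (h.val j) 0 huo
        rw [Matrix.mulVec_zero, add_zero] at h1
        rwa [Nat.sub_add_cancel (h.one_le j)]
      · rw [if_neg hjo]
        refine h.poleOrderLE_epsConnection 0 (n := 0) ?_
        rw [hu]
        exact (VecVal.smul ((isVal_pole (h.inj.ne hj)).sub (isVal_C _ _)) (vecVal_C _ v)).poleOrderLE
  have hproj : (H a m o r).projectionOnto _ hγ (relDerivative a r (monomialSection a i 1 μ)) =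
      ⟨_, hmem⟩ := by
    have h1 : (H a m o r).projectionOnto _ hγ (epsConnection A 0 u) = 0 :=
      Submodule.projectionOnto_apply_of_mem_right hγ ⟨u, by rw [epsConnection_zero]⟩
    have h2 := Submodule.projectionOnto_apply_of_mem_left hγ hmem
    rwa [map_add, h1, add_zero] at h2
  -- With v = g⁻¹ e_μ and F v = e_μ/z + f v + ..., the coefficient of 1/z in F u is f v - e_μ/(a_o -
  -- a_i).
  have hval : VecVal (a i) (localParam (a i) ^ 1 • relVec a r
      (relDerivative a r (monomialSection a i 1 μ) + epsConnection A 0 u))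
      ((f * (g i)⁻¹ - (a o - a i)⁻¹ • 1).mulVec (Pi.single μ 1)) := by
    have h1 := ((hf.mulVec (vecVal_C (a i) v)).sub ((vecVal_C (a i) ((a o - a i)⁻¹ • Pi.single μ 1)))).sub
      (VecVal.smul (isVal_localParam_self (a i)) (VecVal.smul (isVal_C (a i) (a o - a i)⁻¹)
        (hf.mulVec (vecVal_C (a i) v))))
    refine h1.congr ?_ ?_
    · have hgv' : ((g i).map RatFunc.C).mulVec (RatFunc.C ∘ v) =
          (RatFunc.C ∘ Pi.single μ 1 : Fin r → RatFunc K) := by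
        rw [← hgv]
        funext ν
        exact (RingHom.map_mulVec RatFunc.C (g i) v ν).symm
      have hF : (relMatrix A).mulVec (RatFunc.C ∘ v) =
          (relMatrix A - pole (a i) • (g i).map RatFunc.C).mulVec (RatFunc.C ∘ v) +
          pole (a i) • (RatFunc.C ∘ Pi.single μ 1 : Fin r → RatFunc K) := by
        rw [Matrix.sub_mulVec, Matrix.smul_mulVec, hgv', sub_add_cancel]
      rw [map_add, relVec_relDerivative_monomialSection, epsConnection_zero, relVec_higgsField, hu,
        Matrix.mulVec_smul, hF]
      funext ν
      have hs : ∀ c : K, RatFunc.C ((Pi.single μ c : Fin r → K) ν) =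
          RatFunc.C c * RatFunc.C ((Pi.single μ 1 : Fin r → K) ν) := by
        intro c
        rw [← map_mul]
        by_cases hν : ν = μ
        · subst hν; simp
        · simp [hν]
      have hz := localParam_mul_pole (a i)
      simp only [Pi.add_apply, Pi.sub_apply, Pi.smul_apply, Function.comp_apply, smul_eq_mul, map_mul,
        Nat.cast_one, hs (-1), map_neg, map_one, pow_one]
      linear_combination
        (-((relMatrix A - pole (a i) • (g i).map RatFunc.C).mulVec (RatFunc.C ∘ v) ν) +
          RatFunc.C (a o - a i)⁻¹ * RatFunc.C ((Pi.single μ 1 : Fin r → K) ν)) * hz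
    · rw [hv, Matrix.sub_mulVec, Matrix.mulVec_mulVec, Matrix.smul_mulVec, Matrix.one_mulVec, zero_smul,
        sub_zero]
  have h2 := vecVal_etaOperator η η₀ h.inj l (h.one_le i) hval
  have he : etaOrder (m i) = 1 := by rw [hi]; rfl
  rw [he] at h2
  rw [hproj, h.coef_retraction hg hP le_rfl (by rw [hi]; exact h2), leadMatrix, if_pos hi, one_mul,
    Nat.cast_one, one_smul, Matrix.mulVec_mulVec, Matrix.mulVec_mulVec, Matrix.mulVec_single_one]
  rfl

end HasLeadingTerms

end TraceFormula

/-! ### Logarithmic derivatives -/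

section LogarithmicDerivatives

variable {k K : Type*} [Field k] [Field K] [Algebra k K]

theorem dlog_one : dlog k (1 : K) = 0 := by
  rw [dlog, Derivation.map_one_eq_zero, smul_zero]

theorem dlog_mul {x y : K} (hx : x ≠ 0) (hy : y ≠ 0) : dlog k (x * y) = dlog k x + dlog k y := by
  rw [dlog, dlog, dlog, Derivation.leibniz, smul_add, smul_smul, smul_smul, add_comm]
  congr 2 <;> field_simp

theorem dlog_inv {x : K} (hx : x ≠ 0) : dlog k x⁻¹ = -dlog k x := by
  rw [eq_neg_iff_add_eq_zero, ← dlog_mul (inv_ne_zero hx) hx, inv_mul_cancel₀ hx, dlog_one]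

theorem dlog_prod {ι : Type*} (s : Finset ι) {x : ι → K} (hx : ∀ i ∈ s, x i ≠ 0) :
    dlog k (∏ i ∈ s, x i) = ∑ i ∈ s, dlog k (x i) := by
  classical
  induction s using Finset.induction_on with
  | empty => simp [dlog_one]
  | insert i s hi ih =>
    rw [Finset.prod_insert hi, Finset.sum_insert hi, dlog_mul (hx i (Finset.mem_insert_self i s))
      (Finset.prod_ne_zero_iff.mpr fun j hj => hx j (Finset.mem_insert_of_mem hj)),
      ih fun j hj => hx j (Finset.mem_insert_of_mem hj)]

theorem apply_dlog_det (l : Ω[K⁄k] →ₗ[K] K) {ι : Type*} [Fintype ι] [DecidableEq ι]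
    {M : Matrix ι ι K} (hM : IsUnit M) :
    l (dlog k M.det) = (M⁻¹ * M.map (functionalDer l)).trace := by
  have h := (Matrix.isUnit_iff_isUnit_det M).mp hM
  rw [dlog, map_smul, ← functionalDer_apply, derivation_det _ _ h, smul_eq_mul, ← mul_assoc,
    inv_mul_cancel₀ h.ne_zero, one_mul]

theorem two_mul_sum_Icc_natCast (n : ℕ) : 2 * ∑ s ∈ Finset.Icc 1 n, (s : K) = n * (n + 1) := by
  induction n with
  | zero => simp
  | succ n ih =>
    rw [Finset.sum_Icc_succ_top (Nat.le_add_left 1 n), mul_add, ih]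
    push_cast
    ring

end LogarithmicDerivatives

/-! ### Consequences of E = [g, E] -/

section CommutatorTraces

variable {K ι : Type*} [Field K] [Fintype ι] [DecidableEq ι] {g E : Matrix ι ι K}

theorem trace_inv_mul_of_eq_commutator (hg : IsUnit g) (hE : E = g * E - E * g) :
    (g⁻¹ * E).trace = 0 := by
  have h := (Matrix.isUnit_iff_isUnit_det g).mp hg
  rw [hE, Matrix.mul_sub, Matrix.trace_sub, Matrix.nonsing_inv_mul_cancel_left _ _ h,
    Matrix.trace_mul_comm g⁻¹ (E * g), Matrix.mul_nonsing_inv_cancel_right _ _ h, sub_self]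

/-- The relation says (g - 1) E = E g, hence (g - 1) (E g⁻¹) = E. -/
theorem sub_one_inv_mul_of_eq_commutator (hg : IsUnit g) (hg1 : IsUnit (g - 1))
    (hE : E = g * E - E * g) : (g - 1)⁻¹ * E = E * g⁻¹ := by
  have h := (Matrix.isUnit_iff_isUnit_det g).mp hg
  have h1 := (Matrix.isUnit_iff_isUnit_det (g - 1)).mp hg1
  have h2 : (g - 1) * (E * g⁻¹) = E := by
    rw [← Matrix.mul_assoc, Matrix.sub_mul, Matrix.one_mul]
    conv_lhs => rw [show g * E - E = E * g by nth_rewrite 2 [hE]; abel]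
    exact Matrix.mul_nonsing_inv_cancel_right _ _ h
  rw [← Matrix.nonsing_inv_mul_cancel_left _ (E * g⁻¹) h1, h2]

end CommutatorTraces

/-! ### Summing the local contributions -/

section TraceOfDifference

variable {k K : Type*} [Field k] [Field K] [Algebra k K] [CharZero K] {N r : ℕ}
  {a : Fin N → K} {m : Fin N → ℕ} {o : Fin N}
  {A : Matrix (Fin r) (Fin r) (absForms k a)} {g : Fin N → ℕ → Matrix (Fin r) (Fin r) K}
  {η : Fin N → ℕ → Matrix (Fin r) (Fin r) Ω[K⁄k]} {η₀ : Matrix (Fin r) (Fin r) Ω[K⁄k]}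

/-- The contribution of one singularity to the difference of the traces. -/
theorem IsPseudoAdmissible.sum_coef (hA : IsPseudoAdmissible a m A) (ha : Function.Injective a)
    (ho : 2 ≤ m o) (h : HasEquation a m A g η η₀) (hv : IsVertical A) (l : Ω[K⁄k] →ₗ[K] K)
    (hγ : IsCompl (H a m o r) (LinearMap.range (higgsField A)))
    (hg : ∀ i n, 1 ≤ n → IsUnit (leadMatrix 1 (m i) n (g i (m i))))
    {P : FormSections a r →ₗ[K] Sections a r}
    (hP : ∀ w, w - epsConnection A 1 (P w) ∈ H a m o r) (i : Fin N) :
    ∑ s ∈ Finset.Icc 1 (sOrder m o i), ∑ μ, coef (a i) s (secVec a r (P (etaOperator a m η η₀ l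
        ((H a m o r).projectionOnto _ hγ (relDerivative a r (monomialSection a i s μ))))) μ) =
      (if 2 ≤ m i then 1 / 2 * ((m i : K) * l (dlog k (g i (m i)).det)) else 0) +
      (if m i = 1 then l (dlog k (g i (m i)).det) else 0) -
      if i = o then l (dlog k (g i (m i)).det) else 0 := by
  have hL : HasLeadingTerms a m o A fun i => g i (m i) := hA.hasLeadingTerms ha ho h
  rw [apply_dlog_det l (hL.unit i)]
  by_cases hi : 2 ≤ m i
  · rw [Finset.sum_congr rfl fun s hs => hL.sum_coef_of_two_le hg η η₀ l hγ hP hi hs,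
      ← Finset.sum_mul, Finset.sum_neg_distrib, if_pos hi, if_neg (by omega),
      hA.trace_inv_mul_der_of_two_le ha h hv l hi]
    set T := ((g i (m i))⁻¹ * (η i (m i - 1)).map l).trace
    have h2 := two_mul_sum_Icc_natCast (K := K) (sOrder m o i)
    obtain ⟨n, hn⟩ := Nat.exists_eq_add_of_le' hi
    have hm : (m i : K) = n + 2 := by rw [hn]; push_cast; rfl
    -- The sum is -T times the sum of the s, while dlog det g gives -(m_i - 1) T. The range s ≤ m_i
    -- - 1 yields m_i/2 times dlog det g, the shorter range s ≤ m_o - 2 only m_o/2 - 1 times.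
    by_cases hio : i = o
    · have hs : sOrder m o i = n := by rw [sOrder, if_pos hio, hn, Nat.add_sub_cancel]
      rw [hs] at h2 ⊢
      rw [if_pos hio, hm]
      linear_combination (-T / 2) * h2
    · have hs : sOrder m o i = n + 1 := by rw [sOrder, if_neg hio, etaOrder, if_pos hi, hn]; rfl
      rw [hs] at h2 ⊢
      rw [if_neg hio, hm]
      push_cast at h2 ⊢
      linear_combination (-T / 2) * h2
  · have hi1 : m i = 1 := by have := hL.one_le i; omega
    have hio : i ≠ o := by rintro rfl; exact hi ho
    have hs : sOrder m o i = 1 := by rw [sOrder, if_neg hio, hi1]; rfl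
    obtain ⟨f, hf⟩ := exists_matVal_polarMatrix_sub ha g i hi1
    rw [← h.relMatrix_eq] at hf
    have hf' : MatVal (a i) (relMatrix A - pole (a i) • (g i (m i)).map RatFunc.C) f := by rwa [hi1]
    have hu := hL.unit i
    have hu1 := hg i 1 le_rfl
    simp only [hi1] at hu
    rw [leadMatrix, if_pos hi1, Nat.cast_one, one_mul, one_smul, hi1] at hu1
    have hE := hA.eta_eq_commutator ha h hv l hi1
    have htr := trace_inv_mul_of_eq_commutator hu hE
    -- Replacing (g - 1)⁻¹ η_1 by η_1 g⁻¹ makes the term with 1/(a_o - a_i) a multiple of tr(g⁻¹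
    -- η_1) = 0; the rest is tr(g⁻¹ f g⁻¹ η_1), the value of dlog det g.
    rw [hs, Finset.Icc_self, Finset.sum_singleton,
      hL.sum_coef_of_eq_one hg η η₀ l hγ hP hi1 hf', if_neg hi, if_pos hi1, if_neg hio, sub_zero,
      zero_add, hi1, hA.trace_inv_mul_der_of_eq_one ha h hv l hi1 htr hu hf,
      sub_one_inv_mul_of_eq_commutator hu hu1 hE, Matrix.mul_sub, Matrix.trace_sub, Matrix.mul_smul,
      Matrix.mul_one, Matrix.trace_smul, Matrix.trace_mul_comm (η i 1 |>.map l) (g i 1)⁻¹, htr,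
      smul_zero, sub_zero, Matrix.mul_assoc, Matrix.trace_mul_comm]
    simp only [Matrix.mul_assoc]

/-- The difference of the traces of the Higgs operator and of the de Rham operator. -/
theorem IsPseudoAdmissible.tensorTrace_sub (hA : IsPseudoAdmissible a m A)
    (ha : Function.Injective a) (ho : 2 ≤ m o) (h : HasEquation a m A g η η₀) (hv : IsVertical A)
    (hγ : IsCompl (H a m o r) (LinearMap.range (higgsField A)))
    (hd : IsCompl (H a m o r) (LinearMap.range (relConnection A))) :
    ∃ f : K, f ≠ 0 ∧
      tensorTrace (inducedOperator hγ (mulEta a m η η₀) - inducedOperator hd (mulEta a m η η₀)) =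
        (1 / 2 : K) • (∑ i with 2 ≤ m i, (m i : K) • dlog k (g i (m i)).det) + dlog k f := by
  have hL : HasLeadingTerms a m o A fun i => g i (m i) := hA.hasLeadingTerms ha ho h
  have hd' : IsCompl (H a m o r) (LinearMap.range (epsConnection A 1)) := by
    rwa [epsConnection_one]
  have hg : ∀ i n, 1 ≤ n → IsUnit (leadMatrix 1 (m i) n (g i (m i))) :=
    fun i _ hn => hL.isUnit_leadMatrix_of_isCompl hd' i hn
  obtain ⟨P, -, -, hP⟩ := exists_retraction (epsConnection A 1) (hL.injective_epsConnection hg) hd'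
  have hdet : ∀ i, (g i (m i)).det ≠ 0 :=
    fun i => ((Matrix.isUnit_iff_isUnit_det _).mp (hL.unit i)).ne_zero
  have hprod : ∏ i with m i = 1, (g i (m i)).det ≠ 0 :=
    Finset.prod_ne_zero_iff.mpr fun i _ => hdet i
  -- The numerator collects the points of multiplicity one, and the inverse determinant accounts for
  -- the missing summand s = m_o - 1 at a_o.
  refine ⟨(∏ i with m i = 1, (g i (m i)).det) * (g o (m o)).det⁻¹,
    mul_ne_zero hprod (inv_ne_zero (hdet o)), ?_⟩
  rw [dlog_mul hprod (inv_ne_zero (hdet o)), dlog_inv (hdet o), dlog_prod _ fun i _ => hdet i,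
    ← sub_eq_zero, ← Module.forall_dual_apply_eq_zero_iff K]
  -- Linear functionals separate the elements of the K-vector space of one-forms, so scalar
  -- identities suffice.
  intro l
  rw [map_sub, sub_eq_zero, hL.trace_sub_trace hg η η₀ l hγ hd hP,
    Finset.sum_congr rfl fun i _ => hA.sum_coef ha ho h hv l hγ hg hP i, Finset.sum_sub_distrib,
    Finset.sum_add_distrib, Finset.sum_ite_eq' Finset.univ o, if_pos (Finset.mem_univ o),
    ← Finset.sum_filter, ← Finset.sum_filter]
  simp only [map_add, map_smul, map_sum, map_neg, smul_eq_mul, Finset.mul_sum]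
  ring

end TraceOfDifference

/-! ### Absolute forms as a dt-part and a base part -/

section AbsoluteForms

variable {k K : Type*} [Field k] [Field K] [Algebra k K] {N r : ℕ} {a : Fin N → K}

variable (k) in
/-- The forms `∑ f dx` with `f` regular outside the `a i` and `x` constant. -/
def polarBaseForms (a : Fin N → K) : Submodule (regularFunctions a) Ω[RatFunc K⁄k] :=
  Submodule.span _ (Set.range fun x : K =>
    KaehlerDifferential.D k (RatFunc K) (algebraMap K (RatFunc K) x))

/-- The form `∑ i, ∑ 1 ≤ s ≤ n, ω i s / (t - a i) ^ s + ω₀`. -/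
def polarBaseSum (a : Fin N → K) (ω : Fin N → ℕ → Ω[K⁄k]) (ω₀ : Ω[K⁄k]) (n : ℕ) :
    Ω[RatFunc K⁄k] :=
  (∑ i, ∑ s ∈ Finset.Icc 1 n, pole (a i) ^ s • KaehlerDifferential.map k k K (RatFunc K) (ω i s)) +
    KaehlerDifferential.map k k K (RatFunc K) ω₀

theorem map_smul_eq_C_smul (c : K) (x : Ω[K⁄k]) : KaehlerDifferential.map k k K (RatFunc K) (c • x) =
    RatFunc.C c • KaehlerDifferential.map k k K (RatFunc K) x := by
  rw [map_smul, ← RatFunc.algebraMap_eq_C, algebraMap_smul]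

theorem exists_polarBaseSum (ha : Function.Injective a) {x : Ω[RatFunc K⁄k]}
    (hx : x ∈ polarBaseForms k a) : ∃ ω ω₀ n₀, ∀ n, n₀ ≤ n → x = polarBaseSum a ω ω₀ n := by
  rw [polarBaseForms] at hx
  induction hx using Submodule.closure_induction with
  | zero => exact ⟨0, 0, 0, fun n _ => by simp [polarBaseSum]⟩
  | add x y _ _ hx hy =>
    obtain ⟨ω, ω₀, n, h⟩ := hx
    obtain ⟨ω', ω₀', n', h'⟩ := hy
    refine ⟨ω + ω', ω₀ + ω₀', max n n', fun l hl => ?_⟩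
    rw [h l ((le_max_left _ _).trans hl), h' l ((le_max_right _ _).trans hl)]
    simp only [polarBaseSum, Pi.add_apply, map_add, smul_add, Finset.sum_add_distrib]
    abel
  | smul_mem f x hx =>
    obtain ⟨b, rfl⟩ := hx
    obtain ⟨x, n, h⟩ := exists_polarSum ha f.2
    refine ⟨fun i s => coef (a i) s f • KaehlerDifferential.D k K b,
      x • KaehlerDifferential.D k K b, n, fun l hl => ?_⟩
    change (f : RatFunc K) • KaehlerDifferential.D k (RatFunc K) (algebraMap K (RatFunc K) b) = _
    conv_lhs => rw [h (fun _ => l) fun _ => hl]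
    rw [polarBaseSum, polarSum, add_comm, add_smul, Finset.sum_smul]
    simp only [Finset.sum_smul, map_smul_eq_C_smul, KaehlerDifferential.map_D, smul_smul, mul_comm]

theorem D_localParam_eq (c : K) : KaehlerDifferential.D k (RatFunc K) (localParam c) =
    KaehlerDifferential.D k (RatFunc K) RatFunc.X -
      KaehlerDifferential.map k k K (RatFunc K) (KaehlerDifferential.D k K c) := by
  rw [localParam, map_sub, KaehlerDifferential.map_D, RatFunc.algebraMap_eq_C]

/-- d(1/(t - c)) = -(dt - dc)/(t - c)² settles the generators of the ring, and the shape is stable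
under sums and regular multiples. -/
theorem exists_formFunctions_of_mem_absForms (ha : Function.Injective a) {x : Ω[RatFunc K⁄k]}
    (hx : x ∈ absForms k a) : ∃ f ∈ formFunctions a, ∃ b ∈ polarBaseForms k a,
      x = f • KaehlerDifferential.D k (RatFunc K) RatFunc.X + b := by
  have hsmul : ∀ {g : RatFunc K} {x : Ω[RatFunc K⁄k]}, g ∈ regularFunctions a →
      (∃ f ∈ formFunctions a, ∃ b ∈ polarBaseForms k a,
        x = f • KaehlerDifferential.D k (RatFunc K) RatFunc.X + b) →
      ∃ f ∈ formFunctions a, ∃ b ∈ polarBaseForms k a,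
        g • x = f • KaehlerDifferential.D k (RatFunc K) RatFunc.X + b := by
    rintro g _ hg ⟨f, hf, b, hb, rfl⟩
    refine ⟨g * f, regular_mul_mem_formFunctions ha hg hf, g • b,
      Submodule.smul_mem _ (⟨g, hg⟩ : regularFunctions a) hb, ?_⟩
    rw [smul_add, smul_smul]
  have hadd : ∀ {x y : Ω[RatFunc K⁄k]},
      (∃ f ∈ formFunctions a, ∃ b ∈ polarBaseForms k a,
        x = f • KaehlerDifferential.D k (RatFunc K) RatFunc.X + b) →
      (∃ f ∈ formFunctions a, ∃ b ∈ polarBaseForms k a,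
        y = f • KaehlerDifferential.D k (RatFunc K) RatFunc.X + b) →
      ∃ f ∈ formFunctions a, ∃ b ∈ polarBaseForms k a,
        x + y = f • KaehlerDifferential.D k (RatFunc K) RatFunc.X + b := by
    rintro _ _ ⟨f, hf, b, hb, rfl⟩ ⟨f', hf', b', hb', rfl⟩
    refine ⟨f + f', add_mem hf hf', b + b', add_mem hb hb', ?_⟩
    rw [add_smul]
    abel
  have hD : ∀ g ∈ regularFunctions a, ∃ f ∈ formFunctions a, ∃ b ∈ polarBaseForms k a,
      KaehlerDifferential.D k (RatFunc K) g =
        f • KaehlerDifferential.D k (RatFunc K) RatFunc.X + b := by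
    intro g hg
    induction hg using Algebra.adjoin_induction with
    | mem g hg =>
      obtain ⟨i, rfl⟩ := hg
      refine ⟨-pole (a i) ^ 2, neg_mem (pole_pow_mem_formFunctions i le_rfl),
        pole (a i) ^ 2 • KaehlerDifferential.D k (RatFunc K) (algebraMap K (RatFunc K) (a i)),
        Submodule.smul_mem _ (⟨_, pow_mem (pole_mem a i) 2⟩ : regularFunctions a)
          (Submodule.subset_span ⟨a i, rfl⟩), ?_⟩
      change KaehlerDifferential.D k (RatFunc K) (localParam (a i))⁻¹ = _
      rw [pole, Derivation.leibniz_inv, D_localParam_eq, KaehlerDifferential.map_D, smul_sub, neg_smul,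
        neg_smul, sub_neg_eq_add]
    | algebraMap c =>
      exact ⟨0, zero_mem _, _, Submodule.subset_span ⟨c, rfl⟩, by rw [zero_smul, zero_add]⟩
    | add f g _ _ hf hg => rw [map_add]; exact hadd hf hg
    | mul f g hf' hg' hf hg =>
      rw [Derivation.leibniz]
      exact hadd (hsmul hf' hg) (hsmul hg' hf)
  rw [absForms] at hx
  induction hx using Submodule.span_induction with
  | zero => exact ⟨0, zero_mem _, 0, zero_mem _, by simp⟩
  | add x y _ _ hx hy => exact hadd hx hy
  | smul f x _ hx => exact hsmul f.2 hx
  | mem x hx =>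
    obtain ⟨f, rfl⟩ := hx
    exact hD f f.2

theorem pairing_ddt_polarBaseSum (ω : Fin N → ℕ → Ω[K⁄k]) (ω₀ : Ω[K⁄k]) (n : ℕ) :
    pairing ((ddt K).restrictScalars k) (polarBaseSum a ω ω₀ n) = 0 := by
  simp only [polarBaseSum, map_add, map_sum, map_smul, pairing_ddt_base, smul_zero,
    Finset.sum_const_zero, add_zero]

theorem coef_pairing_liftDer_polarBaseSum (ha : Function.Injective a) (l : Ω[K⁄k] →ₗ[K] K)
    (ω : Fin N → ℕ → Ω[K⁄k]) (ω₀ : Ω[K⁄k]) {n s : ℕ} (hs : s ∈ Finset.Icc 1 n) (i : Fin N) :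
    coef (a i) s (pairing (liftDer (functionalDer l)) (polarBaseSum a ω ω₀ n)) = l (ω i s) := by
  have h1 := (Finset.mem_Icc.mp hs).1
  simp only [polarBaseSum, map_add, map_sum, map_smul, pairing_liftDer_base, coef_C _ _ h1, add_zero,
    smul_eq_mul]
  simp only [mul_comm (pole _ ^ _), ← RatFunc.smul_eq_C_mul, map_smul, coef_pole_pow_eq ha i _ h1,
    smul_eq_mul, mul_ite, mul_one, mul_zero]
  rw [Finset.sum_eq_single i (fun j _ hj => Finset.sum_eq_zero fun _ _ =>
    if_neg fun h => hj h.1.symm) (by simp)]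
  simp [hs]

theorem exists_isVal_pairing_liftDer (δ : Derivation k K K) {c : K} {x : Ω[RatFunc K⁄k]}
    (hx : x ∈ baseForms k c) : ∃ y, IsVal c (pairing (liftDer δ) x) y := by
  rw [baseForms] at hx
  induction hx using Submodule.span_induction with
  | zero => exact ⟨0, by rw [map_zero]; exact isVal_zero c⟩
  | add x y _ _ hx hy =>
    obtain ⟨z, hz⟩ := hx
    obtain ⟨w, hw⟩ := hy
    exact ⟨z + w, by rw [map_add]; exact hz.add hw⟩
  | smul f x _ hx =>
    obtain ⟨z, hz⟩ := hx
    obtain ⟨w, hw⟩ := exists_isVal_of_mem_localRing f.2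
    have : pairing (liftDer δ) (f • x) = f * pairing (liftDer δ) x := map_smul _ (f : RatFunc K) x
    exact ⟨w * z, by rw [this]; exact hw.mul hz⟩
  | mem x hx =>
    obtain ⟨p, rfl⟩ := hx
    refine ⟨δ p, ?_⟩
    rw [RatFunc.algebraMap_eq_C, Derivation.liftKaehlerDifferential_comp_D, liftDer_C]
    exact isVal_C c _

end AbsoluteForms

/-! ### Existence of the equation of the connection -/

section ExistenceOfEquations

variable {k K : Type*} [Field k] [Field K] [Algebra k K] {N r : ℕ} {a : Fin N → K} {m : Fin N → ℕ}
  {A : Matrix (Fin r) (Fin r) (absForms k a)}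

/-- The polar part of a form with a local equation is subject to the bound of the local equation. -/
theorem HasLocalEquation.coef_add_eq_zero (ha : Function.Injective a) {i : Fin N} {m M : ℕ}
    {G : Matrix (Fin r) (Fin r) (localRing (a i))}
    (h : HasLocalEquation (A.map Subtype.val) (a i) m M G) {μ ν : Fin r} {f : RatFunc K}
    {ω : Fin N → ℕ → Ω[K⁄k]} {ω₀ : Ω[K⁄k]} {n : ℕ}
    (hx : (A μ ν : Ω[RatFunc K⁄k]) =
      f • KaehlerDifferential.D k (RatFunc K) RatFunc.X + polarBaseSum a ω ω₀ n)
    {s : ℕ} (hs : s ∈ Finset.Icc 1 n) (hM : M < s) :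
    ω i s + coef (a i) s f • KaehlerDifferential.D k K (a i) = 0 := by
  rw [← Module.forall_dual_apply_eq_zero_iff K]
  intro l
  have hf : relMatrix A μ ν = f := by
    rw [relMatrix, hx, map_add, pairing_ddt_polarBaseSum, map_smul]
    simp [ddt_X]
  have hF := congrFun (congrFun h.relMatrix_eq μ) ν
  rw [Matrix.smul_apply, hf, Matrix.map_apply, smul_eq_mul] at hF
  have hG : pole (a i) ^ m * (G μ ν : RatFunc K) = f := by
    rw [← hF, ← mul_assoc, mul_comm (pole _ ^ m), localParam_pow_mul_pole_pow, one_mul]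
  obtain ⟨B, hB⟩ := h
  have h1 := hB μ ν
  rw [Matrix.map_apply, hx, hG] at h1
  -- The lifted derivation kills dt and sends dz to -δ(a_i), so the relative term of the local
  -- equation becomes -δ(a_i) f. The remaining term has order at most M, which fixes the coefficient
  -- of order s > M.
  have h2 := congrArg (pairing (liftDer (functionalDer l))) h1
  simp only [map_add, map_smul, Derivation.liftKaehlerDifferential_comp_D, liftDer_X, mul_zero,
    zero_add, liftDer_localParam, smul_eq_mul] at h2
  obtain ⟨y, hy⟩ := exists_isVal_pairing_liftDer (functionalDer l) (B μ ν).2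
  have h3 : IsVal (a i) (localParam (a i) ^ M *
      (pole (a i) ^ M * pairing (liftDer (functionalDer l)) (B μ ν : Ω[RatFunc K⁄k]))) y := by
    rwa [← mul_assoc, localParam_pow_mul_pole_pow, one_mul]
  have h4 := congrArg (coef (a i) s) h2
  rw [coef_pairing_liftDer_polarBaseSum ha l ω ω₀ hs, map_add, coef_eq_zero_of_lt h3 hM, add_zero,
    mul_neg, mul_comm, ← RatFunc.smul_eq_C_mul, map_neg, map_smul, functionalDer_apply,
    smul_eq_mul] at h4
  rw [map_add, h4, map_smul, smul_eq_mul]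
  ring

/-- Writing dt = d(t - a_i) + da_i in the i-th polar part moves the coefficient times da_i into η.
The local equations then cut off the relative part at m_i and η at M_i. -/
theorem IsPseudoAdmissible.exists_hasEquation (hA : IsPseudoAdmissible a m A)
    (ha : Function.Injective a) : ∃ g η η₀, HasEquation a m A g η η₀ := by
  have h : ∀ μ ν, ∃ f ∈ formFunctions a, ∃ ω ω₀ n₀, ∀ n, n₀ ≤ n → (A μ ν : Ω[RatFunc K⁄k]) =
      f • KaehlerDifferential.D k (RatFunc K) RatFunc.X + polarBaseSum a ω ω₀ n := by
    intro μ ν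
    obtain ⟨f, hf, b, hb, hx⟩ := exists_formFunctions_of_mem_absForms ha (A μ ν).2
    obtain ⟨ω, ω₀, n₀, hn⟩ := exists_polarBaseSum ha hb
    exact ⟨f, hf, ω, ω₀, n₀, fun n h => by rw [hx, hn n h]⟩
  choose f hf ω ω₀ n₀ h using h
  refine ⟨fun i s μ ν => coef (a i) s (f μ ν),
    fun i s μ ν => ω μ ν i s + coef (a i) s (f μ ν) • KaehlerDifferential.D k K (a i), ω₀,
    fun μ ν => ?_⟩
  set n := max (n₀ μ ν) (Finset.univ.sup m) with hn
  have hx := h μ ν n (le_max_left _ _)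
  have hm : ∀ i, m i ≤ n := fun i => (Finset.le_sup (Finset.mem_univ i)).trans (le_max_right _ _)
  have hM : ∀ i, etaOrder (m i) ≤ n := fun i => by
    refine le_trans ?_ (hm i)
    rw [etaOrder]
    split_ifs <;> omega
  have hval : ∀ i, ∃ x, IsVal (a i) (localParam (a i) ^ m i * f μ ν) x := by
    intro i
    obtain ⟨-, G, -, hG⟩ := hA.exists_localEquation i
    have hF := congrFun (congrFun hG.relMatrix_eq μ) ν
    rw [Matrix.smul_apply, Matrix.map_apply, smul_eq_mul, relMatrix, hx, map_add,
      pairing_ddt_polarBaseSum, map_smul] at hF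
    simp only [Derivation.liftKaehlerDifferential_comp_D, Derivation.coe_restrictScalars, ddt_X,
      smul_eq_mul, mul_one, add_zero] at hF
    rw [hF]
    exact exists_isVal_of_mem_localRing (G μ ν).2
  have hη : ∀ i, ∑ s ∈ Finset.Icc 1 (etaOrder (m i)), pole (a i) ^ s •
      KaehlerDifferential.map k k K (RatFunc K)
        (ω μ ν i s + coef (a i) s (f μ ν) • KaehlerDifferential.D k K (a i)) =
      ∑ s ∈ Finset.Icc 1 n, pole (a i) ^ s • KaehlerDifferential.map k k K (RatFunc K)
        (ω μ ν i s + coef (a i) s (f μ ν) • KaehlerDifferential.D k K (a i)) := by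
    intro i
    obtain ⟨-, G, -, hG⟩ := hA.exists_localEquation i
    refine Finset.sum_subset (Finset.Icc_subset_Icc_right (hM i)) fun s hs hs' => ?_
    rw [hG.coef_add_eq_zero ha hx hs, map_zero, smul_zero]
    by_contra hlt
    exact hs' (Finset.mem_Icc.mpr ⟨(Finset.mem_Icc.mp hs).1, not_lt.mp hlt⟩)
  have hg : ∀ i, ∑ s ∈ Finset.Icc 1 (m i), (RatFunc.C (coef (a i) s (f μ ν)) * pole (a i) ^ s) •
      KaehlerDifferential.D k (RatFunc K) (localParam (a i)) =
      ∑ s ∈ Finset.Icc 1 n, (RatFunc.C (coef (a i) s (f μ ν)) * pole (a i) ^ s) •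
      KaehlerDifferential.D k (RatFunc K) (localParam (a i)) := by
    intro i
    refine Finset.sum_subset (Finset.Icc_subset_Icc_right (hm i)) fun s hs hs' => ?_
    obtain ⟨x, hx⟩ := hval i
    rw [coef_eq_zero_of_lt hx, map_zero, zero_mul, zero_smul]
    by_contra hlt
    exact hs' (Finset.mem_Icc.mpr ⟨(Finset.mem_Icc.mp hs).1, not_lt.mp hlt⟩)
  have hpolar : f μ ν = polarSum a (fun _ => n) (f μ ν) :=
    (formFunctions_polarSum ha (hf μ ν) (S := fun _ => n) fun i =>
      exists_isVal_of_le (hval i).choose_spec (hm i)).1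
  rw [Finset.sum_congr rfl fun i _ => hg i, Finset.sum_congr rfl fun i _ => hη i, hx]
  conv_lhs => rw [hpolar]
  rw [polarSum, polarBaseSum, ← add_assoc, Finset.sum_smul, ← Finset.sum_add_distrib,
    ← Finset.sum_add_distrib]
  congr 1
  refine Finset.sum_congr rfl fun i _ => ?_
  rw [Finset.sum_smul, ← Finset.sum_add_distrib, ← Finset.sum_add_distrib]
  refine Finset.sum_congr rfl fun s _ => ?_
  rw [D_localParam_eq, map_add, map_smul_eq_C_smul, smul_sub, smul_add, smul_smul,
    mul_comm (pole _ ^ s)]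
  abel

end ExistenceOfEquations

end HiggsDeRham

end

theorem theorem3p1 {k K : Type*} [Field k] [Field K] [Algebra k K] [CharZero K] {N r : ℕ}
    (a : Fin N → K) (ha : Function.Injective a) (m : Fin N → ℕ) (o : Fin N) (ho : 2 ≤ m o)
    (A : Matrix (Fin r) (Fin r) (absForms k a))
    (hA : IsPseudoAdmissible a m A) (hv : IsVertical A) :
    (∃ g η η₀, HasEquation a m A g η η₀) ∧
    ∀ g η η₀, HasEquation a m A g η η₀ →
      IsCompl (H a m o r) (LinearMap.range (higgsField A)) ∧
      ((∀ i, m i = 1 → ∀ n : ℕ, (n : K) ∉ spectrum K (g i 1)) →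
        IsCompl (H a m o r) (LinearMap.range (relConnection A))) ∧
      ∀ (hγ : IsCompl (H a m o r) (LinearMap.range (higgsField A)))
        (hd : IsCompl (H a m o r) (LinearMap.range (relConnection A))),
        ∃ f : K, f ≠ 0 ∧
          tensorTrace (inducedOperator hγ (mulEta a m η η₀) -
              inducedOperator hd (mulEta a m η η₀)) =
            (1 / 2 : K) • (∑ i with 2 ≤ m i, (m i : K) • dlog k (g i (m i)).det) + dlog k f := by
  refine ⟨hA.exists_hasEquation ha, fun g η η₀ h => ?_⟩
  have hL : HasLeadingTerms a m o A fun i => g i (m i) := hA.hasLeadingTerms ha ho h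
  refine ⟨hL.isCompl_higgsField, fun hg => hL.isCompl_relConnection fun i hi => ?_,
    fun hγ hd => hA.tensorTrace_sub ha ho h hv hγ hd⟩
  rw [hi]
  exact hg i hi
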